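/- \textbf{Setting.} Let $N\ge 1$ agents and $R\ge 1$ identical resources be given, let $K=\lceil N/R\rceil$, and let the context at time-step $t=0,1,2,\dots$ be $k_t = t \bmod K$ (an \emph{episode} is a run through all $K$ contexts). An action is to yield ($Y$) or to access a resource ($A_r$, $1\le r\le R$). The stage payoff of an agent is $0$ if it yields, $1$ if it alone accesses its resource, and $\zeta<0$ in a collision. Each agent $n$ has a strategy $g_n:\{\text{contexts}\}\to\{Y,A_1,\dots,A_R\}$, initially uniformly random, and a flag $accessed_n$, initially false. With back-off probability $p$, the learning rule in a step with context $k$ is: if $g_n(k)=A_r$ and $accessed_n$ is false, agent $n$ accesses $r$; if another agent accesses $r$ in the same step, agent $n$ sets $g_n(k)\leftarrow Y$ with probability $p$, and otherwise $accessed_n$ becomes true. If $g_n(k)=Y$, agent $n$ monitors a uniformly random resource $r$ and sets $g_n(k)\leftarrow A_r$ if nobody accesses $r$ in this step. All initial and later random choices are independent, and all flags are reset to false at the end of each episode. The system \emph{has converged} at time $t$ if there are joint actions $a^{(k)}$, one for each context $k$, such that almost surely at every time $s\ge t$ the agents play $a^{(k_s)}$, and no agent that has not yet successfully accessed a resource in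 the current episode would gain in stage payoff by a unilateral deviation from $a^{(k_s)}$. The discount factors are $\delta_t\in(0,1]$, and $T$ is an \emph{indifference period} if $\delta_t=1$ for all $t\le T$. \textbf{Theorem.} Let $0<p<1$ and $c>0$ be constants. (i) There is a constant $C$, depending only on $p$ and $c$, such that for all $N,R\ge1$, all $\zeta<0$ and every indifference period $T_{ind}$ that is at least linear, $T_{ind}\ge c\,RNK$, the agents following the learning rule satisfy $$\Pr[\text{not converged after } T_{ind} \text{ steps}]\;\le\; C\,\frac{\left(\log\lceil N/R\rceil+1\right)\left(\log N+R\right)}{N}.$$ (ii) This probability tends to $0$ as $N/R\to\infty$: for every $\varepsilon>0$ there is an $M$, depending only on $p$, $c$ and $\varepsilon$, such that for all $N,R\ge1$ with $N/R\ge M$, all $\zeta<0$ and every indifference period $T_{ind}\ge c\,RNK$, the probability of not having converged after $T_{ind}$ steps is less than $\varepsilon$. -/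

import Mathlib

open scoped NNReal ENNReal

noncomputable section

namespace Allocation

/-- An action of one agent: `none` is yielding, `some r` is accessing resource `r`. -/
abbrev Action (R : ℕ) : Type := Option (Fin R)

/-- A joint action of all agents. -/
abbrev Profile (N R : ℕ) : Type := Fin N → Action R

open Classical in
/-- The stage payoff of agent `n`: `0` for yielding, `1` for a successful access, and the
collision payoff `ζ` when somebody else accesses the same resource. -/
def payoff {N R : ℕ} (ζ : ℝ) (n : Fin N) (a : Profile N R) : ℝ :=
  if a n = none then 0
  else if ∀ i, i ≠ n → a i ≠ a n then 1
  else ζ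

/-- `a` is an equilibrium of the stage game for the set `E` of agents that are still entitled to
access a resource: none of them gains by a unilateral deviation. -/
def IsStageEquilibrium {N R : ℕ} (ζ : ℝ) (E : Set (Fin N)) (a : Profile N R) : Prop :=
  ∀ n ∈ E, ∀ b : Action R, payoff ζ n (Function.update a n b) ≤ payoff ζ n a

/-- The size `K = ⌈N / R⌉` of the context space. -/
def numContexts (N R : ℕ) : ℕ := ⌈(N : ℝ) / (R : ℝ)⌉₊

instance instNeZeroNumContexts (N R : ℕ) [NeZero N] [NeZero R] : NeZero (numContexts N R) :=
  ⟨by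
    have hN : (0 : ℝ) < N := Nat.cast_pos.mpr (Nat.pos_of_ne_zero (NeZero.ne N))
    have hR : (0 : ℝ) < R := Nat.cast_pos.mpr (Nat.pos_of_ne_zero (NeZero.ne R))
    exact (Nat.ceil_pos.mpr (div_pos hN hR)).ne'⟩

/-- The context observed at time-step `t = 0, 1, 2, …`; contexts repeat with period `K`. -/
def context (K : ℕ) [NeZero K] (t : ℕ) : Fin K := Fin.ofNat K t

/-- The state of the system: the strategies `g n : contexts → actions` of the agents and
their flags `accessed n`. -/
structure State (N R K : ℕ) where
  strategy : Fin N → Fin K → Action R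
  accessed : Fin N → Bool

namespace State

variable {N R K : ℕ}

/-- The joint action played in state `σ` when the context is `k`. -/
def play (σ : State N R K) (k : Fin K) : Profile N R :=
  fun n => if σ.accessed n then none else σ.strategy n k

/-- Resource `r` is free: nobody accesses it. -/
def Free (σ : State N R K) (k : Fin K) (r : Fin R) : Prop :=
  ∀ n, σ.play k n ≠ some r

/-- At least two agents access resource `r`. -/
def Collision (σ : State N R K) (k : Fin K) (r : Fin R) : Prop :=
  ∃ n m, n ≠ m ∧ σ.play k n = some r ∧ σ.play k m = some r

/-- Agent `n` accesses a resource without collision. -/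
def Succeeds (σ : State N R K) (k : Fin K) (n : Fin N) : Prop :=
  ∃ r, σ.play k n = some r ∧ ¬ σ.Collision k r

end State

/-- A coin that shows `true` with probability `p`. -/
def coin (p : ℝ≥0) (hp : p ≤ 1) : PMF Bool :=
  PMF.ofFintype (fun b => cond b (p : ℝ≥0∞) (1 - p)) (by simp [hp])

/-- The joint law of independent random variables with laws `q i`. -/
def independent {ι α : Type} [Fintype ι] [DecidableEq ι] [Fintype α] (q : ι → PMF α) :
    PMF (ι → α) :=
  PMF.ofFintype (fun f => ∏ i, q i (f i)) (by
    have h := Finset.prod_univ_sum (fun _ : ι => (Finset.univ : Finset α)) (fun i x => q i x)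
    rw [Fintype.piFinset_univ] at h
    rw [← h]
    refine Finset.prod_eq_one fun i _ => ?_
    rw [← tsum_fintype (L := .unconditional _)]
    exact (q i).tsum_coe)

section Dynamics

variable {N R K : ℕ} [NeZero R] (p : ℝ≥0) (hp : p ≤ 1)

open Classical in
/-- The law of the new value of `g n k` after a time-step with context `k`. -/
def nextEntry (σ : State N R K) (k : Fin K) (n : Fin N) : PMF (Action R) :=
  match σ.strategy n k with
  | some r =>
      -- access, unless the quota is used up; after a collision back off with probability `p`
      if σ.accessed n = false ∧ σ.Collision k r then
        (coin p hp).map (fun backoff => if backoff then none else some r)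
      else PMF.pure (some r)
  | none =>
      -- monitor a uniformly random resource and adopt it if it is free
      (PMF.uniformOfFintype (Fin R)).map (fun r => if σ.Free k r then some r else none)

open Classical in
/-- The flags after a time-step with context `k`; they are reset after the last context. -/
def nextAccessed (σ : State N R K) (k : Fin K) (n : Fin N) : Bool :=
  if k.val + 1 = K then false else (σ.accessed n || decide (σ.Succeeds k n))

/-- One time-step of the learning rule with context `k`; the agents randomize independently. -/
def step (k : Fin K) (σ : State N R K) : PMF (State N R K) :=
  (independent (nextEntry p hp σ k)).map fun e =>
    { strategy := fun n => Function.update (σ.strategy n) k (e n)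
      accessed := nextAccessed σ k }

variable [NeZero K]

/-- The law of the state at time `t + s`, given that the state at time `t` is `σ`. -/
def evolve (t : ℕ) (σ : State N R K) : ℕ → PMF (State N R K)
  | 0 => PMF.pure σ
  | s + 1 => (evolve t σ s).bind (step p hp (context K (t + s)))

/-- The law of the initial state: strategies uniformly at random, all flags down. -/
def initial (N R K : ℕ) : PMF (State N R K) :=
  (PMF.uniformOfFintype (Fin N → Fin K → Action R)).map fun g =>
    { strategy := g, accessed := fun _ => false }

/-- The law of the state at time `t`, that is, after `t` time-steps. -/
def law (N R K : ℕ) [NeZero R] [NeZero K] (p : ℝ≥0) (hp : p ≤ 1) (t : ℕ) :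
    PMF (State N R K) :=
  (initial N R K).bind fun σ => evolve p hp 0 σ t

/-- The system has converged to a correlated equilibrium when it is in state `σ` at time `t`:
there is a joint action `a k` for every context `k` such that, from time `t` on, whatever the
random choices, the agents play `a k` whenever the context is `k`, and this is each time an
equilibrium of the stage game for the agents that have not used up their quota. -/
def Converged (ζ : ℝ) (t : ℕ) (σ : State N R K) : Prop :=
  ∃ a : Fin K → Profile N R, ∀ s : ℕ, ∀ τ ∈ (evolve p hp t σ s).support,
    τ.play (context K (t + s)) = a (context K (t + s)) ∧
      IsStageEquilibrium ζ {n | τ.accessed n = false} (a (context K (t + s)))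

end Dynamics

/-- The probability that `N` agents and `R` resources, with `K = ⌈N / R⌉` contexts, back-off
probability `p` and collision payoff `ζ`, have not converged within `T` time-steps. -/
def probNotConverged (N R : ℕ) [NeZero N] [NeZero R] (p : ℝ≥0) (hp : p ≤ 1) (ζ : ℝ) (T : ℕ) : ℝ :=
  ((law N R (numContexts N R) p hp T).toOuterMeasure {σ | ¬ Converged p hp ζ T σ}).toReal

/-- `T` is an indifference period for the discount factors `δ t ∈ (0, 1]`: there is no
discounting up to time `T`. -/
def IsIndifferencePeriod (δ : ℕ → ℝ) (T : ℕ) : Prop :=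
  (∀ t, 0 < δ t ∧ δ t ≤ 1) ∧ ∀ t ≤ T, δ t = 1

end Allocation

end

/-! The process is driven by independent noise: an initial action, a coin and a monitored resource
for every episode, context and agent. The agents active in context `k` of episode `t` form `act ω t
k`, a set determined by the noise of the contexts before `k`. It shrinks as `t` grows, because a
lone accessor that remains active is never dislodged (`act_succ_subset`).

The potential is `delay`, the sum over the contexts of the number of agents still active afterwards.
It is an integer, never increases, and is at least `minDelay`, since at most `R` agents succeed per
context. At the minimum every context either uses all resources or serves all its active agents;
such a state is an equilibrium and is absorbing (`Settled.of_delay_le`, `Follows.converged`). Hence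
the probability of not having converged is at most the expected excess of `delay` over its minimum.

The excess contracts by two estimates. Gain: an agent that newly succeeds in context `i` would
otherwise have stayed active for a while. Agents active after `i` are exchangeable with respect to
the later contexts (`expect_exchange`), and at most `R` of them leave per context, so each new
success lowers the expected delay by at least `(K - i) / 16` (`expect_newWin_le_delay`). Fill: an
unfilled resource rarely stays in collision for `L` episodes, where `L` is of order `log N`. Once
free, it is filled with probability of order `1 / R`: if `y` idle agents may monitor it, a holding
time `l` is chosen for which the mean number `y β ^ l / R` of agents that adopt and keep it is at
most `1 / 4` but not too small, and then a second-moment bound shows that it is held by exactly one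
agent at some time (`expect_idle_fill`). Hence the deficit of a context is at most of order `R (L +
1)` times the expected number of its new successes (`expect_deficit_le`).

The fill estimate requires that the active set of the context does not halve meanwhile; if it does,
the delay itself has dropped enough to pay for the deficits from that context on
(`le_delay_sub_of_drop`). Together, `2 L + 2` episodes multiply the expected excess by at most `1 -
1 / M`, with `M` of order `R log N` (`expect_excess_le`). With at least about `c R N` episodes the
excess is at most `N ^ 2 exp (-a N / (1 + log N) ^ 2)` up to a constant, hence `O(1 / N)`, which is
stronger than both claims. -/

noncomputable section
namespace Allocation

/-! ### One context of one episode: accessors, winners, and the update of a strategy row -/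

section Rows

variable {N R : ℕ}

/-- The agents in `A` whose entry in `row` is the resource `r`. -/
def accessors (A : Finset (Fin N)) (row : Profile N R) (r : Fin R) : Finset (Fin N) :=
  A.filter fun n => row n = some r

/-- The agents in `A` that are alone on their resource. -/
def winners (A : Finset (Fin N)) (row : Profile N R) : Finset (Fin N) :=
  A.filter fun n => ∃ r, accessors A row r = {n}

/-- The agents in `A` that yield. -/
def idle (A : Finset (Fin N)) (row : Profile N R) : Finset (Fin N) :=
  A.filter fun n => row n = none

/-- The resources accessed by exactly one agent of `A`. -/
def filled (A : Finset (Fin N)) (row : Profile N R) : Finset (Fin R) :=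
  Finset.univ.filter fun r => (accessors A row r).card = 1

/-- The agents that have not succeeded in any context before `k`, when `g j` is the strategy row
of context `j`. -/
def active (g : ℕ → Profile N R) : ℕ → Finset (Fin N)
  | 0 => Finset.univ
  | k + 1 => active g k \ winners (active g k) (g k)

/-- The new row of a context with active set `A`, when agent `n` draws the coin `(x n).1` and
monitors the resource `(x n).2`. -/
def nextRow (A : Finset (Fin N)) (row : Profile N R) (x : Fin N → Bool × Fin R) : Profile N R :=
  fun n => match row n with
    | some r => if n ∈ A ∧ 2 ≤ (accessors A row r).card then
        (if (x n).1 then none else some r) else some r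
    | none => if accessors A row (x n).2 = ∅ then some (x n).2 else none

variable {A A' : Finset (Fin N)} {row : Profile N R} {x : Fin N → Bool × Fin R} {r : Fin R}
  {n : Fin N}

theorem mem_accessors : n ∈ accessors A row r ↔ n ∈ A ∧ row n = some r := by
  simp [accessors]

theorem mem_winners : n ∈ winners A row ↔ n ∈ A ∧ ∃ r, accessors A row r = {n} := by
  simp [winners]

theorem mem_idle : n ∈ idle A row ↔ n ∈ A ∧ row n = none := by
  simp [idle]

theorem mem_filled : r ∈ filled A row ↔ (accessors A row r).card = 1 := by
  simp [filled]

theorem winners_subset : winners A row ⊆ A := Finset.filter_subset _ _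

theorem idle_subset : idle A row ⊆ A := Finset.filter_subset _ _

theorem accessors_subset : accessors A row r ⊆ A := Finset.filter_subset _ _

theorem eq_some_of_accessors_eq_singleton (h : accessors A row r = {n}) : row n = some r :=
  (mem_accessors.1 (h ▸ Finset.mem_singleton_self n)).2

theorem card_winners : (winners A row).card = (filled A row).card := by
  have h1 : ((winners A row).image row).card = (winners A row).card := by
    refine Finset.card_image_of_injOn fun n hn m hm hnm => ?_
    obtain ⟨_, r, hr⟩ := mem_winners.1 hn
    have hm' : m ∈ accessors A row r :=
      mem_accessors.2 ⟨winners_subset hm, by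
        rw [← hnm]; exact eq_some_of_accessors_eq_singleton hr⟩
    rw [hr, Finset.mem_singleton] at hm'
    exact hm'.symm
  have h2 : (winners A row).image row = (filled A row).image some := by
    ext o
    simp only [Finset.mem_image, mem_winners, mem_filled, Finset.card_eq_one]
    constructor
    · rintro ⟨n, ⟨_, r, hr⟩, rfl⟩
      exact ⟨r, ⟨n, hr⟩, (eq_some_of_accessors_eq_singleton hr).symm⟩
    · rintro ⟨r, ⟨n, hr⟩, rfl⟩
      exact ⟨n, ⟨accessors_subset (hr ▸ Finset.mem_singleton_self n), r, hr⟩,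
        eq_some_of_accessors_eq_singleton hr⟩
  rw [← h1, h2, Finset.card_image_of_injective _ (Option.some_injective _)]

theorem card_winners_le : (winners A row).card ≤ R := by
  rw [card_winners]
  simpa using Finset.card_le_univ (filled A row)

/-- Nobody joins a contested resource, because monitoring agents see it in use; only coins and loss
of activity matter. The smaller set `A'` is the active set of the next episode. -/
theorem nextRow_of_collision (hA : A' ⊆ A) (h : 2 ≤ (accessors A row r).card) :
    accessors A' (nextRow A row x) r =
      (accessors A row r).filter fun n => n ∈ A' ∧ (x n).1 = false := by
  ext n
  simp only [mem_accessors, Finset.mem_filter, nextRow]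
  constructor
  · rintro ⟨hn, hr⟩
    have hnA := hA hn
    rcases hrow : row n with _ | r'
    · rw [hrow] at hr
      simp only at hr
      split_ifs at hr with h0
      simp only [Option.some.injEq] at hr
      rw [hr] at h0
      simp [h0] at h
    · rw [hrow] at hr
      simp only at hr
      split_ifs at hr with h0 h1 <;> simp only [Option.some.injEq] at hr
      · subst hr
        exact ⟨⟨hnA, rfl⟩, hn, by simpa using h1⟩
      · subst hr
        exact absurd ⟨hnA, h⟩ h0
  · rintro ⟨⟨hnA, hr⟩, hn, hx⟩
    refine ⟨hn, ?_⟩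
    rw [hr]
    simp [hnA, h, hx]

theorem nextRow_of_free (hA : A' ⊆ A) (h : accessors A row r = ∅) :
    accessors A' (nextRow A row x) r =
      (idle A row).filter fun n => n ∈ A' ∧ (x n).2 = r := by
  ext n
  simp only [mem_accessors, mem_idle, Finset.mem_filter, nextRow]
  constructor
  · rintro ⟨hn, hr⟩
    have hnA := hA hn
    rcases hrow : row n with _ | r'
    · rw [hrow] at hr
      simp only at hr
      split_ifs at hr with h0
      simp only [Option.some.injEq] at hr
      exact ⟨⟨hnA, rfl⟩, hn, hr⟩
    · exfalso
      have hr' : r' = r := by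
        rw [hrow] at hr
        simp only at hr
        split_ifs at hr with h0 h1 <;> simpa using hr
      have : n ∈ accessors A row r := mem_accessors.2 ⟨hnA, by rw [hrow, hr']⟩
      simp [h] at this
  · rintro ⟨⟨hnA, hr⟩, hn, hx⟩
    refine ⟨hn, ?_⟩
    rw [hr]
    simp [hx, h]

/-- A lone accessor tosses no coin, and its presence keeps the monitoring agents away. This
stability makes the active sets monotone in time. -/
theorem nextRow_of_winner (hA : A' ⊆ A) (h : accessors A row r = {n}) (hn : n ∈ A') :
    accessors A' (nextRow A row x) r = {n} := by
  ext m
  simp only [mem_accessors, Finset.mem_singleton, nextRow]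
  constructor
  · rintro ⟨hm, hr⟩
    have hmA := hA hm
    rcases hrow : row m with _ | r'
    · rw [hrow] at hr
      simp only at hr
      split_ifs at hr with h0
      simp only [Option.some.injEq] at hr
      rw [hr, h] at h0
      simp at h0
    · have hr' : r' = r := by
        rw [hrow] at hr
        simp only at hr
        split_ifs at hr with h0 h1 <;> simpa using hr
      have : m ∈ accessors A row r := mem_accessors.2 ⟨hmA, by rw [hrow, hr']⟩
      rw [h, Finset.mem_singleton] at this
      exact this
  · rintro rfl
    refine ⟨hn, ?_⟩
    rw [eq_some_of_accessors_eq_singleton h]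
    simp [h]

theorem active_succ_subset (g : ℕ → Profile N R) (k : ℕ) : active g (k + 1) ⊆ active g k :=
  Finset.sdiff_subset

theorem active_anti (g : ℕ → Profile N R) {j k : ℕ} (h : j ≤ k) : active g k ⊆ active g j := by
  induction k, h using Nat.le_induction with
  | base => exact subset_rfl
  | succ k _ ih => exact (active_succ_subset g k).trans ih

theorem card_active_succ (g : ℕ → Profile N R) (k : ℕ) :
    (active g (k + 1)).card + (winners (active g k) (g k)).card = (active g k).card :=
  Finset.card_sdiff_add_card_eq_card winners_subset

theorem card_active_le_add (g : ℕ → Profile N R) (k j : ℕ) :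
    (active g k).card ≤ (active g (k + j)).card + j * R := by
  induction j with
  | zero => simp
  | succ j ih =>
    have h1 := card_active_succ g (k + j)
    have h2 : (winners (active g (k + j)) (g (k + j))).card ≤ R := card_winners_le
    rw [← add_assoc, add_one_mul]
    omega

theorem le_card_active (g : ℕ → Profile N R) (k : ℕ) : N - k * R ≤ (active g k).card := by
  have h := card_active_le_add g 0 k
  simp only [active, zero_add, Finset.card_univ, Fintype.card_fin] at h
  omega

theorem disjoint_winners (g : ℕ → Profile N R) {i j : ℕ} (h : i < j) :
    Disjoint (winners (active g i) (g i)) (active g j) := by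
  refine Disjoint.mono_right (active_anti g h) ?_
  exact Finset.disjoint_sdiff

end Rows

/-! ### The trajectory as a function of the noise, and its monotonicity -/

section Trajectory

variable {N R : ℕ}

/-- The noise used by the learning rule: for every episode, context and agent an initial action,
a coin and a monitored resource. -/
abbrev Noise (N R : ℕ) : Type := ℕ → ℕ → Fin N → Action R × Bool × Fin R

/-- The strategy rows at the start of episode `t`. -/
def rows (ω : Noise N R) : ℕ → ℕ → Profile N R
  | 0 => fun k n => (ω 0 k n).1
  | t + 1 => fun k => nextRow (active (rows ω t) k) (rows ω t k) fun n => (ω (t + 1) k n).2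

/-- The agents active in context `k` of episode `t`. -/
abbrev act (ω : Noise N R) (t k : ℕ) : Finset (Fin N) := active (rows ω t) k

/-- The agents that succeed in context `k` of episode `t`. -/
abbrev win (ω : Noise N R) (t k : ℕ) : Finset (Fin N) := winners (act ω t k) (rows ω t k)

/-- The agents accessing `r` in context `k` of episode `t`. -/
abbrev acc (ω : Noise N R) (t k : ℕ) (r : Fin R) : Finset (Fin N) :=
  accessors (act ω t k) (rows ω t k) r

/-- The agents succeeding in context `k` of episode `t + 1` but not of episode `t`. -/
def newWin (ω : Noise N R) (t k : ℕ) : Finset (Fin N) := win ω (t + 1) k \ win ω t k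

theorem rows_succ (ω : Noise N R) (t k : ℕ) :
    rows ω (t + 1) k = nextRow (act ω t k) (rows ω t k) fun n => (ω (t + 1) k n).2 := rfl

theorem active_congr {g g' : ℕ → Profile N R} {k : ℕ} (h : ∀ j < k, g j = g' j) :
    active g k = active g' k := by
  induction k with
  | zero => rfl
  | succ k ih =>
    simp only [active]
    rw [ih fun j hj => h j (hj.trans (Nat.lt_succ_self k)), h k (Nat.lt_succ_self k)]

theorem rows_congr {ω ω' : Noise N R} {t k : ℕ}
    (h : ∀ s ≤ t, ∀ j ≤ k, ω s j = ω' s j) : rows ω t k = rows ω' t k := by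
  induction t generalizing k with
  | zero => ext1 n; simp [rows, h 0 le_rfl k le_rfl]
  | succ t ih =>
    rw [rows_succ, rows_succ, ih fun s hs j hj => h s (hs.trans (Nat.le_succ t)) j hj,
      h (t + 1) le_rfl k le_rfl]
    congr 1
    exact active_congr fun j hj => ih fun s hs i hi =>
      h s (hs.trans (Nat.le_succ t)) i (hi.trans hj.le)

/-- The strict bound `j < k` is essential: the noise of context `k` never influences who is active
in context `k`, even in future episodes. -/
theorem act_congr {ω ω' : Noise N R} {t k : ℕ}
    (h : ∀ s ≤ t, ∀ j < k, ω s j = ω' s j) : act ω t k = act ω' t k :=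
  active_congr fun _ hj => rows_congr fun s hs i hi => h s hs i (hi.trans_lt hj)

/-- By induction on the context: an agent that won in context `k` and is still active there one
episode later wins there again, so it cannot be active after `k`. -/
theorem act_succ_subset (ω : Noise N R) (t k : ℕ) : act ω (t + 1) k ⊆ act ω t k := by
  induction k with
  | zero => simp [active]
  | succ k ih =>
    intro n hn
    simp only [active, Finset.mem_sdiff] at hn ⊢
    refine ⟨ih hn.1, fun hw => hn.2 ?_⟩
    obtain ⟨_, r, hr⟩ := mem_winners.1 hw
    exact mem_winners.2 ⟨hn.1, r, nextRow_of_winner ih hr hn.1⟩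

theorem act_anti (ω : Noise N R) (k : ℕ) {s t : ℕ} (h : s ≤ t) : act ω t k ⊆ act ω s k := by
  induction t, h using Nat.le_induction with
  | base => exact subset_rfl
  | succ t _ ih => exact (act_succ_subset ω t k).trans ih

theorem newWin_subset (ω : Noise N R) (t k : ℕ) : newWin ω t k ⊆ act ω t (k + 1) := by
  intro n hn
  simp only [newWin, Finset.mem_sdiff] at hn
  exact Finset.mem_sdiff.2 ⟨act_succ_subset ω t k (winners_subset hn.1), hn.2⟩

/-- An agent that newly wins in context `i < j` is no longer active in context `j` of episode `t +
1`, and it wins in only one context of that episode. The sets on the left are therefore disjoint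
parts of `act ω t j`. -/
theorem sum_card_newWin_inter_le (ω : Noise N R) (t j : ℕ) :
    ∑ i ∈ Finset.range j, (newWin ω t i ∩ act ω t j).card + (act ω (t + 1) j).card
      ≤ (act ω t j).card := by
  rw [← Finset.card_biUnion, ← Finset.card_union_of_disjoint]
  · refine Finset.card_le_card (Finset.union_subset ?_ (act_succ_subset ω t j))
    exact Finset.biUnion_subset.2 fun i _ => Finset.inter_subset_right
  · rw [Finset.disjoint_biUnion_left]
    intro i hi
    exact Disjoint.mono_left (Finset.inter_subset_left.trans Finset.sdiff_subset)
      (disjoint_winners (rows ω (t + 1)) (Finset.mem_range.1 hi))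
  · have key : ∀ i i', i < i' →
        Disjoint (newWin ω t i ∩ act ω t j) (newWin ω t i' ∩ act ω t j) := fun i i' h =>
      Disjoint.mono (Finset.inter_subset_left.trans Finset.sdiff_subset)
        ((Finset.inter_subset_left.trans Finset.sdiff_subset).trans winners_subset)
        (disjoint_winners (rows ω (t + 1)) h)
    intro i _ i' _ hne
    rcases lt_or_gt_of_ne hne with h | h
    · exact key i i' h
    · exact (key i' i h).symm

end Trajectory

/-! ### Exchanging a block of independent coordinates for a fresh copy -/

section Resample

variable {ι κ α S : Type} [Fintype ι] [DecidableEq ι] [Fintype κ] [CommSemiring S]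

theorem prod_extend_mul_prod {φ : κ → ι} (hφ : φ.Injective) (q : α → S) (ω : ι → α) (x : κ → α) :
    (∏ i, q (Function.extend φ x ω i)) * ∏ j, q (ω (φ j)) = (∏ i, q (ω i)) * ∏ j, q (x j) := by
  have key : ∀ f : ι → S, ∏ i, f i =
      (∏ j, f (φ j)) * ∏ i ∈ Finset.univ \ Finset.univ.image φ, f i := by
    intro f
    rw [← Finset.prod_image (s := Finset.univ) (g := φ) (f := f) hφ.injOn,
      mul_comm]
    exact (Finset.prod_sdiff (Finset.subset_univ _)).symm
  rw [key (fun i => q (Function.extend φ x ω i)), key (fun i => q (ω i))]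
  have h1 : ∀ i ∈ Finset.univ \ Finset.univ.image φ,
      q (Function.extend φ x ω i) = q (ω i) := by
    intro i hi
    rw [Function.extend_apply']
    rintro ⟨j, rfl⟩
    simp at hi
  rw [Finset.prod_congr rfl h1]
  simp only [hφ.extend_apply]
  ring

/-- Exchanging the coordinates in the range of `φ` with the fresh copy `x` is an involution that
preserves the product weight. -/
theorem sum_sum_resample [DecidableEq κ] [Fintype α] {φ : κ → ι} (hφ : φ.Injective) (q : α → S)
    (Ψ : (ι → α) → (κ → α) → S) :
    ∑ ω : ι → α, ∑ x : κ → α, (∏ i, q (ω i)) * (∏ j, q (x j)) * Ψ ω x =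
      ∑ ω : ι → α, ∑ x : κ → α, (∏ i, q (ω i)) * (∏ j, q (x j)) *
        Ψ (Function.extend φ x ω) (ω ∘ φ) := by
  rw [← Fintype.sum_prod_type', ← Fintype.sum_prod_type']
  let T : (ι → α) × (κ → α) → (ι → α) × (κ → α) :=
    fun z => (Function.extend φ z.2 z.1, z.1 ∘ φ)
  have hT : Function.Involutive T := by
    rintro ⟨ω, x⟩
    refine Prod.ext ?_ ?_
    · funext i
      by_cases hi : ∃ j, φ j = i
      · obtain ⟨j, rfl⟩ := hi
        simp [T, hφ.extend_apply]
      · simp [T, Function.extend_apply' _ _ _ hi]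
    · funext j
      simp [T, hφ.extend_apply]
  rw [← Equiv.sum_comp hT.toPerm]
  refine Finset.sum_congr rfl fun z _ => ?_
  obtain ⟨ω, x⟩ := z
  simp only [Function.Involutive.coe_toPerm, T, Function.comp_apply]
  rw [prod_extend_mul_prod hφ]

theorem sum_prod_eq_one [Fintype α] (q : α → S) (hq : ∑ a, q a = 1) : ∑ ω : ι → α, ∏ i, q (ω i) = 1 := by
  have h := Finset.prod_univ_sum (fun _ : ι => (Finset.univ : Finset α)) (fun _ x => q x)
  rw [Fintype.piFinset_univ] at h
  rw [← h]
  simp [hq]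

end Resample

/-! ### Swapping two agents in the late contexts -/

section Swap

variable {N R : ℕ}

/-- The noise in which agents `a` and `b` are exchanged in all contexts from `k₀` on. -/
def swapNoise (k₀ : ℕ) (a b : Fin N) (ω : Noise N R) : Noise N R :=
  fun t k n => if k₀ ≤ k then ω t k (Equiv.swap a b n) else ω t k n

end Swap

/-! ### Expectation over finitely many noise variables, symmetry and independence -/

section Expect

variable {N R : ℕ} [NeZero R]

/-- The noise with the values `ω` in the first `H` times and the first `K` contexts. -/
def extendNoise (H K : ℕ) (ω : Fin H × Fin K × Fin N → Action R × Bool × Fin R) : Noise N R :=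
  fun t k n => if h : t < H ∧ k < K then ω (⟨t, h.1⟩, ⟨k, h.2⟩, n) else (none, false, 0)

/-- The expectation of `F` when the first `H` times and the first `K` contexts carry independent
noise with weights `q`. -/
def expect (q : Action R × Bool × Fin R → ℝ) (H K : ℕ) (F : Noise N R → ℝ) : ℝ :=
  ∑ ω : Fin H × Fin K × Fin N → Action R × Bool × Fin R,
    (∏ i, q (ω i)) * F (extendNoise H K ω)

/-- Weights of a probability distribution of the noise. -/
structure IsWeight (q : Action R × Bool × Fin R → ℝ) : Prop where
  nonneg : ∀ a, 0 ≤ q a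
  sum_eq_one : ∑ a, q a = 1

variable {q : Action R × Bool × Fin R → ℝ} {H K : ℕ} {F G : Noise N R → ℝ}

theorem expect_mono (hq : IsWeight q) (h : ∀ ω, F ω ≤ G ω) : expect q H K F ≤ expect q H K G :=
  Finset.sum_le_sum fun _ _ =>
    mul_le_mul_of_nonneg_left (h _) (Finset.prod_nonneg fun _ _ => hq.nonneg _)

theorem expect_nonneg (hq : IsWeight q) (h : ∀ ω, 0 ≤ F ω) : 0 ≤ expect q H K F :=
  Finset.sum_nonneg fun _ _ => mul_nonneg (Finset.prod_nonneg fun _ _ => hq.nonneg _) (h _)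

theorem expect_add : expect q H K (fun ω => F ω + G ω) = expect q H K F + expect q H K G := by
  simp [expect, mul_add, Finset.sum_add_distrib]

theorem expect_sub : expect q H K (fun ω => F ω - G ω) = expect q H K F - expect q H K G := by
  simp [expect, mul_sub, Finset.sum_sub_distrib]

theorem expect_const_mul (c : ℝ) : expect q H K (fun ω => c * F ω) = c * expect q H K F := by
  simp only [expect, Finset.mul_sum]
  exact Finset.sum_congr rfl fun _ _ => by ring

theorem expect_sum {ι : Type} (s : Finset ι) (f : ι → Noise N R → ℝ) :
    expect q H K (fun ω => ∑ i ∈ s, f i ω) = ∑ i ∈ s, expect q H K (f i) := by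
  simp only [expect, Finset.mul_sum]
  exact Finset.sum_comm

theorem expect_const (hq : IsWeight q) (c : ℝ) : expect q H K (fun _ : Noise N R => c) = c := by
  simp only [expect, ← Finset.sum_mul]
  rw [sum_prod_eq_one q hq.sum_eq_one, one_mul]

theorem expect_swapNoise (k₀ : ℕ) (a b : Fin N) :
    expect q H K (fun ω => F (swapNoise k₀ a b ω)) = expect q H K F := by
  let e : Fin H × Fin K × Fin N → Fin H × Fin K × Fin N :=
    fun i => if k₀ ≤ i.2.1 then (i.1, i.2.1, Equiv.swap a b i.2.2) else i
  have he : Function.Involutive e := by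
    rintro ⟨t, k, n⟩
    by_cases h : k₀ ≤ (k : ℕ) <;> simp [e, h]
  let E : Equiv.Perm (Fin H × Fin K × Fin N) := he.toPerm
  unfold expect
  rw [← Equiv.sum_comp (Equiv.arrowCongr E (Equiv.refl _))
    (fun ω => (∏ i, q (ω i)) * F (extendNoise H K ω))]
  refine Finset.sum_congr rfl fun ω _ => ?_
  have h1 : ∏ i, q ((Equiv.arrowCongr E (Equiv.refl _)) ω i) = ∏ i, q (ω i) := by
    simp only [Equiv.arrowCongr_apply, Equiv.coe_refl, Function.comp_apply, id]
    exact Equiv.prod_comp E.symm (fun i => q (ω i))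
  have h2 : swapNoise k₀ a b (extendNoise H K ω) =
      extendNoise H K ((Equiv.arrowCongr E (Equiv.refl _)) ω) := by
    funext t k n
    have hs : ∀ i, E.symm i = e i := fun i => rfl
    simp only [swapNoise, extendNoise, Equiv.arrowCongr_apply, Equiv.coe_refl,
      Function.comp_apply, id, hs]
    by_cases h : t < H ∧ k < K
    · by_cases hk : k₀ ≤ k <;> simp [h, hk, e]
    · simp [h]
  rw [h1, ← h2]

/-- The coordinate is resampled: `F` does not notice, and the fresh value is integrated separately.
-/
theorem expect_mul_coord (hq : IsWeight q) {t k : ℕ} (ht : t < H) (hk : k < K) (n : Fin N)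
    (hF : ∀ ω ω' : Noise N R, (∀ s j m, (s, j, m) ≠ (t, k, n) → ω s j m = ω' s j m) →
      F ω = F ω') (f : Action R × Bool × Fin R → ℝ) :
    expect q H K (fun ω => F ω * f (ω t k n)) = expect q H K F * ∑ a, q a * f a := by
  let i₀ : Fin H × Fin K × Fin N := (⟨t, ht⟩, ⟨k, hk⟩, n)
  let φ : Unit → Fin H × Fin K × Fin N := fun _ => i₀
  have hφ : φ.Injective := fun _ _ _ => rfl
  have h := sum_sum_resample hφ q (fun ω x => F (extendNoise H K ω) * f (ω i₀))
  have hone : ∑ x : Unit → Action R × Bool × Fin R, ∏ j, q (x j) = 1 :=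
    sum_prod_eq_one q hq.sum_eq_one
  have hL : expect q H K (fun ω => F ω * f (ω t k n)) =
      ∑ ω : Fin H × Fin K × Fin N → Action R × Bool × Fin R,
        ∑ x : Unit → Action R × Bool × Fin R, (∏ i, q (ω i)) * (∏ j, q (x j)) *
          (F (extendNoise H K ω) * f (ω i₀)) := by
    unfold expect
    refine Finset.sum_congr rfl fun ω _ => ?_
    rw [← Finset.sum_mul, ← Finset.mul_sum, hone, mul_one]
    simp [extendNoise, ht, hk, i₀]
  rw [hL, h]
  unfold expect
  rw [Finset.sum_mul]
  refine Finset.sum_congr rfl fun ω _ => ?_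
  have h1 : ∀ x : Unit → Action R × Bool × Fin R,
      F (extendNoise H K (Function.extend φ x ω)) = F (extendNoise H K ω) := by
    intro x
    refine hF _ _ fun s j m hne => ?_
    unfold extendNoise
    by_cases hs : s < H ∧ j < K
    · simp only [hs, and_self, dite_true]
      rw [Function.extend_apply']
      rintro ⟨_, hu⟩
      simp only [φ, i₀, Prod.mk.injEq, Fin.mk.injEq] at hu
      exact hne (by rw [hu.1, hu.2.1, hu.2.2])
    · simp [hs]
  have h2 : ∀ x : Unit → Action R × Bool × Fin R, Function.extend φ x ω i₀ = x () := fun x =>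
    hφ.extend_apply x ω ()
  simp only [h1, h2]
  have h3 : ∑ x : Unit → Action R × Bool × Fin R, (∏ j, q (x j)) * f (x ()) =
      ∑ a, q a * f a := by
    rw [← Equiv.sum_comp (Equiv.funUnique Unit (Action R × Bool × Fin R)).symm]
    refine Finset.sum_congr rfl fun a _ => ?_
    simp
  rw [← h3, Finset.mul_sum]
  exact Finset.sum_congr rfl fun x _ => by ring

theorem expect_mul_prod (hq : IsWeight q) {k : ℕ} (hk : k < K) (B : Finset (ℕ × Fin N))
    (hB : ∀ c ∈ B, c.1 < H)
    (hF : ∀ ω ω' : Noise N R, (∀ s j m, (j = k → (s, m) ∉ B) → ω s j m = ω' s j m) →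
      F ω = F ω') (f : ℕ → Action R × Bool × Fin R → ℝ) :
    expect q H K (fun ω => F ω * ∏ c ∈ B, f c.1 (ω c.1 k c.2)) =
      expect q H K F * ∏ c ∈ B, ∑ a, q a * f c.1 a := by
  induction B using Finset.induction_on with
  | empty => simp
  | insert c B hc ih =>
    have h0 : ∀ ω : Noise N R, F ω * ∏ d ∈ insert c B, f d.1 (ω d.1 k d.2) =
        (F ω * ∏ d ∈ B, f d.1 (ω d.1 k d.2)) * f c.1 (ω c.1 k c.2) := by
      intro ω
      rw [Finset.prod_insert hc]
      ring
    simp only [h0]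
    rw [expect_mul_coord hq (hB c (Finset.mem_insert_self c B)) hk c.2 ?_ (f c.1),
      ih (fun d hd => hB d (Finset.mem_insert_of_mem hd)), Finset.prod_insert hc]
    · ring
    · intro ω ω' h
      refine hF ω ω' fun s j m hj => h s j m fun hjk hm => hj hjk (Finset.mem_insert_of_mem hm)
    · intro ω ω' h
      congr 1
      · refine hF ω ω' fun s j m hj => h s j m fun heq => ?_
        simp only [Prod.mk.injEq] at heq
        refine hj heq.2.1 ?_
        rw [heq.1, heq.2.2]
        exact Finset.mem_insert_self _ _
      · refine Finset.prod_congr rfl fun d hd => ?_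
        rw [h d.1 k d.2 fun heq => ?_]
        simp only [Prod.mk.injEq, true_and] at heq
        exact hc (by rwa [show c = d from Prod.ext heq.1.symm heq.2.symm])

/-- The case of a block of times and agents that is independent of `F`. -/
theorem expect_mul_prod_prod (hq : IsWeight q) {k : ℕ} (hk : k < K) (P : Finset (Fin N))
    (S : Finset ℕ) (hS : ∀ s ∈ S, s < H)
    (hF : ∀ ω ω' : Noise N R, (∀ s j m, (j = k → s ∉ S) → ω s j m = ω' s j m) →
      F ω = F ω') (f : ℕ → Action R × Bool × Fin R → ℝ) :
    expect q H K (fun ω => F ω * ∏ n ∈ P, ∏ s ∈ S, f s (ω s k n)) =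
      expect q H K F * (∏ s ∈ S, ∑ a, q a * f s a) ^ P.card := by
  have h := expect_mul_prod hq hk (S ×ˢ P) (H := H) (F := F)
    (fun c hc => hS _ (Finset.mem_product.1 hc).1)
    (fun ω ω' h => hF ω ω' fun s j m hj => h s j m fun hjk hm =>
      hj hjk (Finset.mem_product.1 hm).1) f
  simp only [Finset.prod_product_right, Finset.prod_const] at h
  exact h

end Expect

/-! ### Equivariance of the dynamics under permutations of the agents -/

section Equivariance

variable {N R : ℕ} {A : Finset (Fin N)} {row : Profile N R}

theorem accessors_map (σ : Equiv.Perm (Fin N)) (r : Fin R) :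
    accessors (A.map σ.toEmbedding) (row ∘ σ.symm) r =
      (accessors A row r).map σ.toEmbedding := by
  ext n
  simp [mem_accessors, Finset.mem_map_equiv]

theorem idle_map (σ : Equiv.Perm (Fin N)) :
    idle (A.map σ.toEmbedding) (row ∘ σ.symm) = (idle A row).map σ.toEmbedding := by
  ext n
  simp [mem_idle, Finset.mem_map_equiv]

theorem winners_map (σ : Equiv.Perm (Fin N)) :
    winners (A.map σ.toEmbedding) (row ∘ σ.symm) = (winners A row).map σ.toEmbedding := by
  ext n
  have h : ∀ r, accessors (A.map σ.toEmbedding) (row ∘ σ.symm) r = {n} ↔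
      accessors A row r = {σ.symm n} := by
    intro r
    rw [accessors_map]
    have h1 : ({n} : Finset (Fin N)) = ({σ.symm n} : Finset (Fin N)).map σ.toEmbedding := by
      simp
    rw [h1, Finset.map_inj]
  simp only [mem_winners, Finset.mem_map_equiv, h]

theorem nextRow_map (σ : Equiv.Perm (Fin N)) (x : Fin N → Bool × Fin R) :
    nextRow (A.map σ.toEmbedding) (row ∘ σ.symm) (x ∘ σ.symm) =
      nextRow A row x ∘ σ.symm := by
  funext n
  simp only [nextRow, accessors_map, Finset.mem_map_equiv, Finset.card_map, Finset.map_eq_empty,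
    Function.comp_apply]

theorem map_swap_eq_self {a b : Fin N} (ha : a ∈ A) (hb : b ∈ A) :
    A.map (Equiv.swap a b).toEmbedding = A := by
  ext n
  simp only [Finset.mem_map_equiv, Equiv.symm_swap]
  by_cases h1 : n = a
  · subst h1; simp [ha, hb]
  by_cases h2 : n = b
  · subst h2; simp [ha, hb]
  rw [Equiv.swap_apply_of_ne_of_ne h1 h2]

theorem rows_swapNoise_of_lt (ω : Noise N R) (a b : Fin N) (t : ℕ) {j k : ℕ} (h : j < k) :
    rows (swapNoise k a b ω) t j = rows ω t j :=
  rows_congr fun s _ i hi => by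
    funext n
    simp [swapNoise, Nat.not_le.2 (hi.trans_lt h)]

theorem act_swapNoise_of_le (ω : Noise N R) (a b : Fin N) (t : ℕ) {j k : ℕ} (h : j ≤ k) :
    act (swapNoise k a b ω) t j = act ω t j :=
  active_congr fun _ hi => rows_swapNoise_of_lt ω a b t (hi.trans_le h)

theorem win_swapNoise_of_lt (ω : Noise N R) (a b : Fin N) (t : ℕ) {j k : ℕ} (h : j < k) :
    win (swapNoise k a b ω) t j = win ω t j := by
  rw [win, act_swapNoise_of_le ω a b t h.le, rows_swapNoise_of_lt ω a b t h]

theorem newWin_swapNoise_of_lt (ω : Noise N R) (a b : Fin N) (t : ℕ) {j k : ℕ} (h : j < k) :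
    newWin (swapNoise k a b ω) t j = newWin ω t j := by
  rw [newWin, win_swapNoise_of_lt ω a b _ h, win_swapNoise_of_lt ω a b _ h, newWin]

theorem active_map_of_le {g g' : ℕ → Profile N R} {a b : Fin N} {k : ℕ}
    (h0 : active g' k = active g k) (ha : a ∈ active g k) (hb : b ∈ active g k)
    (h : ∀ j, k ≤ j → g' j = g j ∘ (Equiv.swap a b).symm) {j : ℕ} (hj : k ≤ j) :
    active g' j = (active g j).map (Equiv.swap a b).toEmbedding := by
  induction j, hj using Nat.le_induction with
  | base => rw [map_swap_eq_self ha hb, h0]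
  | succ j hj ih =>
    simp only [active]
    rw [ih, h j hj, winners_map]
    ext n
    simp [Finset.mem_map_equiv]

/-- The contexts before `k` are untouched by the swap. As `a` and `b` are both active at `k` up to
episode `t`, the swap preserves the active set with which the later contexts start, and these evolve
with the two names exchanged. -/
theorem rows_swapNoise_of_le {ω : Noise N R} {a b : Fin N} {t k : ℕ} (ha : a ∈ act ω t k)
    (hb : b ∈ act ω t k) {j : ℕ} (hj : k ≤ j) :
    rows (swapNoise k a b ω) t j = rows ω t j ∘ (Equiv.swap a b).symm := by
  induction t generalizing j with
  | zero => funext n; simp [rows, swapNoise, hj]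
  | succ t ih =>
    have ha' := act_succ_subset ω t k ha
    have hb' := act_succ_subset ω t k hb
    rw [rows_succ, rows_succ, ← nextRow_map, ih ha' hb' hj]
    congr 1
    · exact active_map_of_le (act_swapNoise_of_le ω a b t le_rfl) ha' hb'
        (fun i hi => ih ha' hb' hi) hj
    · funext n
      simp [swapNoise, hj]

theorem act_swapNoise_of_ge {ω : Noise N R} {a b : Fin N} {t k : ℕ} (ha : a ∈ act ω t k)
    (hb : b ∈ act ω t k) {j : ℕ} (hj : k ≤ j) :
    act (swapNoise k a b ω) t j = (act ω t j).map (Equiv.swap a b).toEmbedding :=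
  active_map_of_le (act_swapNoise_of_le ω a b t le_rfl) ha hb
    (fun _ hi => rows_swapNoise_of_le ha hb hi) hj

end Equivariance

/-! ### Exchangeability of active agents -/

section Exchange

variable {N R : ℕ} [NeZero R] {q : Action R × Bool × Fin R → ℝ} {H K : ℕ}

/-- Agents active in context `k` of episode `t` are exchangeable with respect to the contexts from
`k` on: the set `Z` is spread evenly over them. -/
theorem expect_exchange (t k : ℕ) (Z V : Noise N R → Finset (Fin N)) (G : Noise N R → ℝ)
    (hZ : ∀ ω, Z ω ⊆ act ω t k) (hV : ∀ ω, V ω ⊆ act ω t k)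
    (hZs : ∀ ω a b, a ∈ act ω t k → b ∈ act ω t k →
      Z (swapNoise k a b ω) = (Z ω).map (Equiv.swap a b).toEmbedding)
    (hVs : ∀ ω a b, a ∈ act ω t k → b ∈ act ω t k → V (swapNoise k a b ω) = V ω)
    (hGs : ∀ ω a b, a ∈ act ω t k → b ∈ act ω t k → G (swapNoise k a b ω) = G ω) :
    expect q H K (fun ω => G ω * ((Z ω ∩ V ω).card * (act ω t k).card)) =
      expect q H K (fun ω => G ω * ((Z ω).card * (V ω).card)) := by
  have hL : ∀ ω, G ω * (((Z ω ∩ V ω).card : ℝ) * (act ω t k).card) =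
      ∑ a, ∑ b, G ω * (if a ∈ V ω ∧ b ∈ act ω t k ∧ a ∈ Z ω then 1 else 0) := by
    intro ω
    simp only [← Finset.mul_sum]
    congr 1
    have h1 : ((Z ω ∩ V ω).card : ℝ) = ∑ a, if a ∈ Z ω ∩ V ω then 1 else 0 := by
      rw [Finset.sum_boole, Finset.filter_univ_mem]
    have h2 : ((act ω t k).card : ℝ) = ∑ b, if b ∈ act ω t k then 1 else 0 := by simp
    rw [h1, h2, Finset.sum_mul_sum]
    refine Finset.sum_congr rfl fun a _ => Finset.sum_congr rfl fun b _ => ?_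
    by_cases h3 : a ∈ Z ω <;> by_cases h4 : a ∈ V ω <;> by_cases h5 : b ∈ act ω t k <;>
      simp [h3, h4, h5]
  have hR : ∀ ω, G ω * (((Z ω).card : ℝ) * (V ω).card) =
      ∑ a, ∑ b, G ω * (if a ∈ V ω ∧ b ∈ act ω t k ∧ b ∈ Z ω then 1 else 0) := by
    intro ω
    simp only [← Finset.mul_sum]
    congr 1
    have h1 : ((Z ω).card : ℝ) = ∑ a, if a ∈ Z ω then 1 else 0 := by simp
    have h2 : ((V ω).card : ℝ) = ∑ b, if b ∈ V ω then 1 else 0 := by simp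
    rw [mul_comm, h1, h2, Finset.sum_mul_sum]
    refine Finset.sum_congr rfl fun a _ => Finset.sum_congr rfl fun b _ => ?_
    by_cases h3 : b ∈ Z ω
    · have h5 := hZ ω h3
      by_cases h4 : a ∈ V ω <;> simp [h3, h4, h5]
    · simp [h3]
  simp only [hL, hR, expect_sum]
  refine Finset.sum_congr rfl fun a _ => Finset.sum_congr rfl fun b _ => ?_
  -- Both sides count pairs `(a, b)` with `a ∈ V` and `b` active; the swap of `a` and `b` turns `b ∈
  -- Z` into `a ∈ Z`.
  rw [← expect_swapNoise (F := fun ω => G ω *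
    (if a ∈ V ω ∧ b ∈ act ω t k ∧ b ∈ Z ω then 1 else 0)) k a b]
  congr 1
  funext ω
  have hA : act (swapNoise k a b ω) t k = act ω t k := act_swapNoise_of_le ω a b t le_rfl
  by_cases ha : a ∈ act ω t k
  · by_cases hb : b ∈ act ω t k
    · rw [hGs ω a b ha hb, hVs ω a b ha hb, hZs ω a b ha hb, hA]
      simp [Finset.mem_map_equiv]
    · rw [hA]
      simp [hb]
  · have h1 : a ∉ V ω := fun h => ha (hV ω h)
    have h2 : a ∉ V (swapNoise k a b ω) := fun h => ha (hA ▸ hV _ h)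
    simp [h1, h2]

end Exchange

/-! ### The expected drop of the delay caused by new successes -/

section Gain

/-- The first `m / 8 + 1` terms are each at least `d / 2`, and `m ≤ 8 * (m / 8 + 1)` in spite of the
rounding. -/
theorem le_sum_of_linear_decay {f : ℕ → ℝ} {d ρ : ℝ} {m : ℕ} (hd : 0 ≤ d) (hρ : 0 ≤ ρ)
    (hf : ∀ j < m, 0 ≤ f j) (h : ∀ j < m, d - j * ρ ≤ f j) (hm : (m / 8 : ℕ) * ρ ≤ d / 2) :
    d * m / 16 ≤ ∑ j ∈ Finset.range m, f j := by
  rcases Nat.eq_zero_or_pos m with rfl | hpos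
  · simp
  have hb : m / 8 + 1 ≤ m := by omega
  have hb' : (m : ℝ) ≤ 8 * ((m / 8 : ℕ) + 1) := by
    have : m ≤ 8 * (m / 8 + 1) := by omega
    exact_mod_cast this
  calc d * m / 16 ≤ ((m / 8 : ℕ) + 1) * (d / 2) := by nlinarith
    _ = ∑ j ∈ Finset.range (m / 8 + 1), d / 2 := by simp
    _ ≤ ∑ j ∈ Finset.range (m / 8 + 1), f j := by
        refine Finset.sum_le_sum fun j hj => ?_
        have hj' : j < m / 8 + 1 := Finset.mem_range.1 hj
        have h1 := h j (hj'.trans_le hb)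
        have h2 : (j : ℝ) ≤ (m / 8 : ℕ) := by exact_mod_cast Nat.lt_succ_iff.1 hj'
        have h3 := mul_le_mul_of_nonneg_right h2 hρ
        linarith
    _ ≤ ∑ j ∈ Finset.range m, f j :=
        Finset.sum_le_sum_of_subset_of_nonneg (Finset.range_mono hb) fun j hj _ =>
          hf j (Finset.mem_range.1 hj)

variable {N R K : ℕ}

/-- The sum over all agents of the context in which they succeed. -/
def delay (K : ℕ) (ω : Noise N R) (t : ℕ) : ℝ :=
  ∑ j ∈ Finset.range K, ((act ω t (j + 1)).card : ℝ)

/-- At most `R` agents leave per context, and `(K - 1) * R < N` ensures that enough are active after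
context `i` for this linear loss to take long to halve their number. -/
theorem card_act_mul_le_sum (ω : Noise N R) (t i : ℕ) (hK : (K - 1) * R < N) :
    ((act ω t (i + 1)).card : ℝ) * (K - i : ℕ) / 16 ≤
      ∑ j ∈ Finset.range (K - i), ((act ω t (i + j + 1)).card : ℝ) := by
  refine le_sum_of_linear_decay (ρ := R) (by positivity) (by positivity)
    (fun _ _ => by positivity) (fun j _ => ?_) ?_
  · have h := card_active_le_add (rows ω t) (i + 1) j
    rw [show i + 1 + j = i + j + 1 by ring] at h
    rw [sub_le_iff_le_add]
    exact_mod_cast h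
  · rcases Nat.lt_or_ge (K - i) 8 with h8 | h8
    · rw [Nat.div_eq_of_lt h8]
      simp only [Nat.cast_zero, zero_mul]
      positivity
    · have h1 := le_card_active (rows ω t) (i + 1)
      have h2 : 2 * ((K - i) / 8 * R) ≤ (act ω t (i + 1)).card := by
        have h3 : (K - i) / 8 * 2 + (i + 1) ≤ K - 1 := by omega
        have h4 := Nat.mul_le_mul_right R h3
        rw [add_mul, mul_right_comm] at h4
        have h5 : N - (i + 1) * R ≤ (act ω t (i + 1)).card := h1
        omega
      rw [le_div_iff₀ two_pos, mul_comm]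
      exact_mod_cast h2

/-- Exchanging the sums groups the new winners by the context `i + j + 1` in which they would still
have been active; there `sum_card_newWin_inter_le` applies. -/
theorem sum_newWin_inter_le_delay (ω : Noise N R) (t : ℕ) :
    ∑ i ∈ Finset.range K, ∑ j ∈ Finset.range (K - i),
      ((newWin ω t i ∩ act ω t (i + j + 1)).card : ℝ) ≤ delay K ω t - delay K ω (t + 1) := by
  have h1 : ∑ i ∈ Finset.range K, ∑ j ∈ Finset.range (K - i),
      ((newWin ω t i ∩ act ω t (i + j + 1)).card : ℝ) =
      ∑ j ∈ Finset.range K, ∑ i ∈ Finset.range (j + 1),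
        ((newWin ω t i ∩ act ω t (j + 1)).card : ℝ) := by
    rw [Finset.sum_sigma', Finset.sum_sigma']
    refine Finset.sum_bij' (fun x _ => ⟨x.1 + x.2, x.1⟩) (fun x _ => ⟨x.2, x.1 - x.2⟩) ?_ ?_ ?_ ?_ ?_
    · rintro ⟨i, j⟩ h
      simp only [Finset.mem_sigma, Finset.mem_range] at h ⊢
      omega
    · rintro ⟨i, j⟩ h
      simp only [Finset.mem_sigma, Finset.mem_range] at h ⊢
      omega
    · rintro ⟨i, j⟩ h
      simp
    · rintro ⟨i, j⟩ h
      simp only [Finset.mem_sigma, Finset.mem_range] at h ⊢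
      simp only [Sigma.mk.injEq, heq_eq_eq, and_true]
      omega
    · rintro ⟨i, j⟩ h
      rfl
  rw [h1, delay, delay, ← Finset.sum_sub_distrib]
  refine Finset.sum_le_sum fun j _ => ?_
  have h2 := sum_card_newWin_inter_le ω t (j + 1)
  rw [le_sub_iff_add_le]
  exact_mod_cast h2

variable [NeZero R] {q : Action R × Bool × Fin R → ℝ} {H : ℕ}

/-- The set `newWin ω t i` depends only on the contexts up to `i`, also in episode `t + 1`, whereas
the active sets of later contexts in episode `t` are equivariant. By exchangeability each new winner
is as likely to stay active as any agent of `act ω t (i + 1)`, and `card_act_mul_le_sum` bounds the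
mean remaining stay. -/
theorem expect_card_newWin_le (hq : IsWeight q) (hK : (K - 1) * R < N) (t i : ℕ) :
    ((K - i : ℕ) : ℝ) / 16 * expect q H K (fun ω : Noise N R => ((newWin ω t i).card : ℝ)) ≤
      expect q H K (fun ω : Noise N R => ∑ j ∈ Finset.range (K - i),
        ((newWin ω t i ∩ act ω t (i + j + 1)).card : ℝ)) := by
  have hstep : ∀ j, expect q H K (fun ω : Noise N R =>
      ((newWin ω t i ∩ act ω t (i + j + 1)).card : ℝ)) =
      expect q H K (fun ω : Noise N R => ((act ω t (i + 1)).card : ℝ)⁻¹ *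
        ((act ω t (i + j + 1)).card * (newWin ω t i).card)) := by
    intro j
    rw [← expect_exchange t (i + 1) (fun ω => act ω t (i + j + 1)) (fun ω => newWin ω t i)
      (fun ω => ((act ω t (i + 1)).card : ℝ)⁻¹)
      (fun ω => active_anti _ (by omega)) (fun ω => newWin_subset ω t i)
      (fun ω a b ha hb => act_swapNoise_of_ge ha hb (by omega))
      (fun ω a b _ _ => newWin_swapNoise_of_lt ω a b t (Nat.lt_succ_self i))
      (fun ω a b _ _ => by rw [act_swapNoise_of_le ω a b t le_rfl])]
    congr 1
    funext ω
    rcases Nat.eq_zero_or_pos (act ω t (i + 1)).card with h0 | h0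
    · have h1 : newWin ω t i = ∅ :=
        Finset.subset_empty.1 (Finset.card_eq_zero.1 h0 ▸ newWin_subset ω t i)
      simp [h1]
    · have h1 : ((act ω t (i + 1)).card : ℝ) ≠ 0 := by positivity
      rw [Finset.inter_comm]
      field_simp
  rw [expect_sum]
  simp only [hstep]
  rw [← expect_sum, ← expect_const_mul]
  refine expect_mono hq fun ω => ?_
  rcases Nat.eq_zero_or_pos (act ω t (i + 1)).card with h0 | h0
  · have h1 : newWin ω t i = ∅ :=
      Finset.subset_empty.1 (Finset.card_eq_zero.1 h0 ▸ newWin_subset ω t i)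
    simp [h1]
  · have h1 : (0 : ℝ) < (act ω t (i + 1)).card := by positivity
    have h2 := card_act_mul_le_sum (K := K) ω t i hK
    rw [← Finset.mul_sum, ← Finset.sum_mul, ← mul_assoc]
    refine mul_le_mul_of_nonneg_right ?_ (by positivity)
    rw [inv_mul_eq_div, le_div_iff₀ h1]
    linarith

theorem expect_newWin_le_delay (hq : IsWeight q) (hK : (K - 1) * R < N) (t : ℕ) :
    ∑ i ∈ Finset.range K, ((K - i : ℕ) : ℝ) / 16 *
        expect q H K (fun ω : Noise N R => ((newWin ω t i).card : ℝ)) ≤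
      expect q H K (fun ω : Noise N R => delay K ω t) -
        expect q H K (fun ω : Noise N R => delay K ω (t + 1)) := by
  rw [← expect_sub]
  refine le_trans (Finset.sum_le_sum fun i _ => expect_card_newWin_le hq hK t i) ?_
  rw [← expect_sum]
  exact expect_mono hq fun ω => sum_newWin_inter_le_delay ω t

end Gain

/-! ### The history of a single resource and the noise on which it depends -/

section Paths

variable {N R : ℕ}

/-- The agents yielding in context `k` of episode `t`. -/
abbrev idl (ω : Noise N R) (t k : ℕ) : Finset (Fin N) := idle (act ω t k) (rows ω t k)

/-- Activity at any time, even after the block `S`, ignores the noise of context `k`. This permits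
conditioning on future activity while the coins of context `k` stay fresh. -/
theorem act_eq_of_agree {ω ω' : Noise N R} {k : ℕ} {S : Finset ℕ}
    (h : ∀ s j m, (j = k → s ∉ S) → ω s j m = ω' s j m) (t : ℕ) : act ω t k = act ω' t k :=
  act_congr fun s _ j hj => funext fun m => h s j m fun hjk => absurd hjk hj.ne

theorem rows_eq_of_agree {ω ω' : Noise N R} {k : ℕ} {S : Finset ℕ}
    (h : ∀ s j m, (j = k → s ∉ S) → ω s j m = ω' s j m) {t : ℕ} (hS : ∀ s ∈ S, t < s) :
    rows ω t k = rows ω' t k :=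
  rows_congr fun s hs j _ => funext fun m => h s j m fun _ hm => (hS s hm).not_ge hs

theorem acc_succ_of_collision {ω : Noise N R} {t k : ℕ} {r : Fin R}
    (h : 2 ≤ (acc ω t k r).card) :
    acc ω (t + 1) k r = (acc ω t k r).filter fun n =>
      n ∈ act ω (t + 1) k ∧ (ω (t + 1) k n).2.1 = false :=
  nextRow_of_collision (act_succ_subset ω t k) h

theorem acc_succ_of_free {ω : Noise N R} {t k : ℕ} {r : Fin R} (h : acc ω t k r = ∅) :
    acc ω (t + 1) k r = (idl ω t k).filter fun n =>
      n ∈ act ω (t + 1) k ∧ (ω (t + 1) k n).2.2 = r :=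
  nextRow_of_free (act_succ_subset ω t k) h

/-- During a lasting collision the set of accessors only shrinks, so whoever remains never backed
off. -/
theorem coin_eq_false_of_mem_acc {ω : Noise N R} {t k : ℕ} {r : Fin R} {l : ℕ}
    (h : ∀ s, t ≤ s → s < t + l → 2 ≤ (acc ω s k r).card) {n : Fin N}
    (hn : n ∈ acc ω (t + l) k r) : ∀ s ∈ Finset.Ioc t (t + l), (ω s k n).2.1 = false := by
  induction l with
  | zero => simp
  | succ l ih =>
    rw [← add_assoc, acc_succ_of_collision (h (t + l) (by omega) (by omega)),
      Finset.mem_filter] at hn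
    intro s hs
    rw [Finset.mem_Ioc] at hs
    rcases Nat.lt_or_ge (t + l) s with h1 | h1
    · obtain rfl : s = t + l + 1 := by omega
      exact hn.2.2
    · exact ih (fun s h2 h3 => h s h2 (by omega)) hn.1 s (Finset.mem_Ioc.2 ⟨hs.1, h1⟩)

/-- The agents that monitor `r` after episode `t` and keep it until episode `t + l`. -/
theorem acc_of_free {ω : Noise N R} {t k : ℕ} {r : Fin R} (h0 : acc ω t k r = ∅) {l : ℕ}
    (h : ∀ s ∈ Finset.Ioc t (t + (l + 1)), (acc ω s k r).card ≠ 1) {n : Fin N}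
    (hn : n ∈ idl ω t k) (hact : n ∈ act ω (t + (l + 1)) k)
    (hr : (ω (t + 1) k n).2.2 = r)
    (hc : ∀ s ∈ Finset.Ioc (t + 1) (t + (l + 1)), (ω s k n).2.1 = false) :
    ∀ m, m ∈ acc ω (t + (l + 1)) k r ↔ m ∈ idl ω t k ∧
      m ∈ act ω (t + (l + 1)) k ∧ (ω (t + 1) k m).2.2 = r ∧
        ∀ s ∈ Finset.Ioc (t + 1) (t + (l + 1)), (ω s k m).2.1 = false := by
  induction l with
  | zero =>
    intro m
    rw [zero_add, acc_succ_of_free h0]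
    simp
  | succ l ih =>
    have hIoc : ∀ s, s ∈ Finset.Ioc (t + 1) (t + (l + 1)) →
        s ∈ Finset.Ioc (t + 1) (t + (l + 1 + 1)) := fun s hs => by
      rw [Finset.mem_Ioc] at hs ⊢; omega
    have hact' := act_anti ω k (show t + (l + 1) ≤ t + (l + 1 + 1) by omega) hact
    have ih' := ih (fun s hs => h s (by rw [Finset.mem_Ioc] at hs ⊢; omega)) hact'
      (fun s hs => hc s (hIoc s hs))
    have hmem : n ∈ acc ω (t + (l + 1)) k r := by
      rw [ih']
      exact ⟨hn, hact', hr, fun s hs => hc s (hIoc s hs)⟩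
    have h2 : 2 ≤ (acc ω (t + (l + 1)) k r).card := by
      have h3 := Finset.card_pos.2 ⟨n, hmem⟩
      have h4 := h (t + (l + 1)) (by rw [Finset.mem_Ioc]; omega)
      omega
    rw [show t + (l + 1 + 1) = t + (l + 1) + 1 by ring, acc_succ_of_collision h2]
    intro m
    rw [Finset.mem_filter, ih']
    constructor
    · rintro ⟨⟨hm, _, hmr, hmc⟩, hma, hmx⟩
      refine ⟨hm, hma, hmr, fun s hs => ?_⟩
      rw [Finset.mem_Ioc] at hs
      rcases Nat.lt_or_ge (t + (l + 1)) s with h5 | h5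
      · obtain rfl : s = t + (l + 1) + 1 := by omega
        exact hmx
      · exact hmc s (Finset.mem_Ioc.2 ⟨hs.1, h5⟩)
    · rintro ⟨hm, hma, hmr, hmc⟩
      exact ⟨⟨hm, act_succ_subset ω _ k hma, hmr, fun s hs => hmc s (hIoc s hs)⟩, hma,
        hmc _ (by rw [Finset.mem_Ioc]; omega)⟩

end Paths

/-! ### Fresh blocks of noise, lasting collisions, and survival of half of the agents -/

section Fill

variable {N R : ℕ} [NeZero R]

/-- Weights under which coins show `false` with probability `β` and the monitored resource is
uniform. -/
structure IsSeed (q : Action R × Bool × Fin R → ℝ) (β : ℝ) : Prop extends IsWeight q where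
  coin : ∑ a, q a * (if a.2.1 = false then 1 else 0) = β
  monitor : ∀ r, ∑ a, q a * (if a.2.2 = r then 1 else 0) = 1 / (R : ℝ)

variable {q : Action R × Bool × Fin R → ℝ} {β : ℝ} {H K : ℕ}

/-- Summing a product over fresh noise over a random family of sets of agents of the same size. -/
theorem expect_sum_block (hq : IsWeight q) {k : ℕ} (hk : k < K) {S : Finset ℕ}
    (hS : ∀ s ∈ S, s < H) {W : Noise N R → ℝ}
    (hW : ∀ ω ω', (∀ s j m, (j = k → s ∉ S) → ω s j m = ω' s j m) → W ω = W ω')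
    {ι : Type} [Fintype ι] [DecidableEq ι] {Z : Noise N R → Finset ι}
    (hZ : ∀ ω ω', (∀ s j m, (j = k → s ∉ S) → ω s j m = ω' s j m) → Z ω = Z ω')
    (P : ι → Finset (Fin N)) {c : ℕ} (hP : ∀ ω, ∀ i ∈ Z ω, (P i).card = c)
    (f : ℕ → Action R × Bool × Fin R → ℝ) :
    expect q H K (fun ω => W ω * ∑ i ∈ Z ω, ∏ n ∈ P i, ∏ s ∈ S, f s (ω s k n)) =
      (∏ s ∈ S, ∑ a, q a * f s a) ^ c * expect q H K (fun ω => W ω * (Z ω).card) := by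
  have h1 : ∀ ω, W ω * ((Z ω).card : ℝ) = ∑ i : ι, W ω * (if i ∈ Z ω then 1 else 0) := by
    intro ω
    rw [← Finset.mul_sum, Finset.sum_boole, Finset.filter_univ_mem]
  have h2 : ∀ ω, W ω * ∑ i ∈ Z ω, ∏ n ∈ P i, ∏ s ∈ S, f s (ω s k n) =
      ∑ i : ι, W ω * (if i ∈ Z ω then 1 else 0) * ∏ n ∈ P i, ∏ s ∈ S, f s (ω s k n) := by
    intro ω
    simp only [mul_assoc, ← Finset.mul_sum]
    congr 1
    simp only [ite_mul, one_mul, zero_mul, Finset.sum_ite_mem, Finset.univ_inter]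
  simp only [h1, h2]
  rw [expect_sum, expect_sum, Finset.mul_sum]
  refine Finset.sum_congr rfl fun i _ => ?_
  rw [expect_mul_prod_prod (F := fun ω => W ω * (if i ∈ Z ω then (1 : ℝ) else 0)) hq hk (P i) S hS
    (fun ω ω' h => by simp only [hW ω ω' h, hZ ω ω' h]) f, mul_comm]
  by_cases hc : (P i).card = c
  · rw [hc]
  · have h3 : ∀ ω, i ∉ Z ω := fun ω hi => hc (hP ω i hi)
    simp [h3, expect]

/-- Union bound over the agent that survives the collision: it must have kept the resource at all
`l` coin tosses, which are independent of `W`. -/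
theorem expect_collision_le (hq : IsSeed q β) {k t l : ℕ} (hk : k < K) (hl : t + l < H)
    (r : Fin R) {W : Noise N R → ℝ} (hW0 : ∀ ω, 0 ≤ W ω)
    (hW : ∀ ω ω', (∀ s j m, (j = k → s ∉ Finset.Ioc t (t + l)) → ω s j m = ω' s j m) →
      W ω = W ω') :
    expect q H K (fun ω => W ω *
        (if ∀ s, t ≤ s → s ≤ t + l → 2 ≤ (acc ω s k r).card then 1 else 0)) ≤
      N * β ^ l * expect q H K W := by
  have h1 : ∀ ω, W ω * (if ∀ s, t ≤ s → s ≤ t + l → 2 ≤ (acc ω s k r).card then 1 else 0) ≤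
      ∑ n : Fin N, W ω * ∏ m ∈ ({n} : Finset (Fin N)), ∏ s ∈ Finset.Ioc t (t + l),
        (if (ω s k m).2.1 = false then (1 : ℝ) else 0) := by
    intro ω
    rw [← Finset.mul_sum]
    refine mul_le_mul_of_nonneg_left ?_ (hW0 ω)
    have hnn : ∀ n ∈ Finset.univ, 0 ≤ ∏ m ∈ ({n} : Finset (Fin N)), ∏ s ∈ Finset.Ioc t (t + l),
        (if (ω s k m).2.1 = false then (1 : ℝ) else 0) := fun n _ =>
      Finset.prod_nonneg fun _ _ => Finset.prod_nonneg fun _ _ => by split_ifs <;> norm_num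
    split_ifs with h
    · have h2 := h (t + l) (by omega) le_rfl
      obtain ⟨n, hn⟩ := Finset.card_pos.1 (by omega : 0 < (acc ω (t + l) k r).card)
      have h3 := coin_eq_false_of_mem_acc (fun s hs hs' => h s hs hs'.le) hn
      refine le_trans (le_of_eq ?_) (Finset.single_le_sum hnn (Finset.mem_univ n))
      rw [Finset.prod_singleton]
      exact (Finset.prod_eq_one fun s hs => if_pos (h3 s hs)).symm
    · exact Finset.sum_nonneg hnn
  refine (expect_mono hq.toIsWeight h1).trans (le_of_eq ?_)
  rw [expect_sum]
  have h2 : ∀ n : Fin N, _ := fun n => expect_mul_prod_prod (H := H) hq.toIsWeight hk {n}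
    (Finset.Ioc t (t + l)) (fun s hs => (Finset.mem_Ioc.1 hs).2.trans_lt hl) hW
    (fun _ a => if a.2.1 = false then (1 : ℝ) else 0)
  simp only [h2, hq.coin]
  simp
  ring

/-- A function of the noise in the contexts before `k`. -/
def DependsBefore {X : Type} (k : ℕ) (g : Noise N R → X) : Prop :=
  ∀ ω ω', (∀ s, ∀ j < k, ω s j = ω' s j) → g ω = g ω'

omit [NeZero R] in
theorem DependsBefore.swap {X : Type} {k : ℕ} {g : Noise N R → X} (hg : DependsBefore k g)
    (ω : Noise N R) (a b : Fin N) : g (swapNoise k a b ω) = g ω :=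
  hg _ _ fun s j hj => by
    funext n
    simp [swapNoise, Nat.not_le.2 hj]

omit [NeZero R] in
theorem DependsBefore.agree {X : Type} {k : ℕ} {g : Noise N R → X} (hg : DependsBefore k g)
    {ω ω' : Noise N R} {S : Finset ℕ}
    (h : ∀ s j m, (j = k → s ∉ S) → ω s j m = ω' s j m) : g ω = g ω' :=
  hg _ _ fun s j hj => funext fun m => h s j m fun hjk => absurd hjk hj.ne

/-- In an event that does not see the noise of context `k` after time `t`, a set of agents spread
evenly at time `t` retains half of its members if `act` does. -/
theorem expect_half_le (hq : IsSeed q β) {k t u : ℕ} {W : Noise N R → ℝ}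
    (Z : Noise N R → Finset (Fin N)) (hZ : ∀ ω, Z ω ⊆ act ω t k) (htu : t ≤ u)
    (hZs : ∀ ω a b, a ∈ act ω t k → b ∈ act ω t k →
      Z (swapNoise k a b ω) = (Z ω).map (Equiv.swap a b).toEmbedding)
    (hW0 : ∀ ω, 0 ≤ W ω)
    (hWs : ∀ ω a b, a ∈ act ω t k → b ∈ act ω t k → W (swapNoise k a b ω) = W ω)
    (hgood : ∀ ω, W ω ≠ 0 → (act ω t k).card ≤ 2 * (act ω u k).card) :
    expect q H K (fun ω => W ω * (Z ω).card) ≤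
      2 * expect q H K (fun ω => W ω * (Z ω ∩ act ω u k).card) := by
  have h1 := expect_exchange (q := q) (H := H) (K := K) t k Z (fun ω => act ω u k)
    (fun ω => W ω * ((act ω t k).card : ℝ)⁻¹) hZ (fun ω => act_anti ω k htu) hZs
    (fun ω a b _ _ => act_swapNoise_of_le ω a b u le_rfl)
    (fun ω a b ha hb => by rw [hWs ω a b ha hb, act_swapNoise_of_le ω a b t le_rfl])
  have h2 : ∀ ω, W ω * (Z ω ∩ act ω u k).card =
      W ω * ((act ω t k).card : ℝ)⁻¹ * (((Z ω ∩ act ω u k).card : ℝ) * (act ω t k).card) := by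
    intro ω
    rcases Nat.eq_zero_or_pos (act ω t k).card with h0 | h0
    · have hZe : Z ω = ∅ := Finset.subset_empty.1 (Finset.card_eq_zero.1 h0 ▸ hZ ω)
      simp [hZe]
    · have : ((act ω t k).card : ℝ) ≠ 0 := by positivity
      field_simp
  simp only [h2]
  rw [h1, ← expect_const_mul]
  refine expect_mono hq.toIsWeight fun ω => ?_
  rcases Nat.eq_zero_or_pos (act ω t k).card with h0 | h0
  · have hZe : Z ω = ∅ := Finset.subset_empty.1 (Finset.card_eq_zero.1 h0 ▸ hZ ω)
    simp [hZe]
  · by_cases hw : W ω = 0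
    · simp [hw]
    have h3 : (0 : ℝ) < (act ω t k).card := by positivity
    have h4 : ((act ω t k).card : ℝ) ≤ 2 * (act ω u k).card := by exact_mod_cast hgood ω hw
    have h5 : 1 ≤ 2 * (((act ω t k).card : ℝ)⁻¹ * (act ω u k).card) := by
      rw [inv_mul_eq_div, ← mul_div_assoc, le_div_iff₀ h3, one_mul]
      exact h4
    have h6 : 0 ≤ W ω * (Z ω).card := mul_nonneg (hW0 ω) (by positivity)
    nlinarith [mul_le_mul_of_nonneg_left h5 h6]

end Fill

/-! ### Filling a free resource -/

section FreeSlot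

variable {N R : ℕ} [NeZero R] {q : Action R × Bool × Fin R → ℝ} {β : ℝ} {H K : ℕ}

omit [NeZero R] in
theorem acc_swapNoise {ω : Noise N R} {a b : Fin N} {t k : ℕ} (ha : a ∈ act ω t k)
    (hb : b ∈ act ω t k) (r : Fin R) :
    acc (swapNoise k a b ω) t k r = (acc ω t k r).map (Equiv.swap a b).toEmbedding := by
  rw [acc, act_swapNoise_of_ge ha hb le_rfl, rows_swapNoise_of_le ha hb le_rfl, accessors_map]

omit [NeZero R] in
theorem idle_swapNoise {ω : Noise N R} {a b : Fin N} {t k : ℕ} (ha : a ∈ act ω t k)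
    (hb : b ∈ act ω t k) :
    idl (swapNoise k a b ω) t k = (idl ω t k).map (Equiv.swap a b).toEmbedding := by
  rw [idl, act_swapNoise_of_ge ha hb le_rfl, rows_swapNoise_of_le ha hb le_rfl, idle_map]

omit [NeZero R] in
theorem expect_coin_true (hq : IsSeed q β) :
    ∑ a, q a * (if a.2.1 = true then 1 else 0) = 1 - β := by
  have h : ∑ a, q a = β + ∑ a, q a * (if a.2.1 = true then 1 else 0) := by
    rw [← hq.coin, ← Finset.sum_add_distrib]
    refine Finset.sum_congr rfl fun a _ => ?_
    cases a.2.1 <;> simp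
  rw [hq.sum_eq_one] at h
  linarith

/-- With nobody idle, every agent left after context `k` is in a collision and backs off with
probability `1 - β`. The resource stays free for one more episode because no idle agent monitors it.
The factor `2` pays for requiring that the agent stay active. -/
theorem expect_busy_free_le (hq : IsSeed q β) {k t u : ℕ} (hk : k < K) (htu : t + 1 ≤ u)
    (hu : u < H) (r : Fin R) {g : Noise N R → ℝ} (hg0 : ∀ ω, 0 ≤ g ω) (hg : DependsBefore k g)
    (hgood : ∀ ω, g ω ≠ 0 → (act ω t k).card ≤ 2 * (act ω u k).card) :
    (1 - β) * expect q H K (fun ω => g ω *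
        (if acc ω t k r = ∅ ∧ idl ω t k = ∅ ∧ act ω t (k + 1) ≠ ∅ then 1 else 0)) ≤
      2 * expect q H K (fun ω => g ω *
        (if acc ω (t + 1) k r = ∅ ∧ idl ω (t + 1) k ≠ ∅ then 1 else 0)) := by
  -- Division by the number of agents left turns a sum over them into the choice of a uniformly
  -- random one.
  set W : Noise N R → ℝ := fun ω => g ω *
    (if acc ω t k r = ∅ ∧ idl ω t k = ∅ ∧ act ω t (k + 1) ≠ ∅ then 1 else 0) *
    ((act ω t (k + 1)).card : ℝ)⁻¹ with hWdef
  have hW0 : ∀ ω, 0 ≤ W ω := fun ω =>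
    mul_nonneg (mul_nonneg (hg0 ω) (by split_ifs <;> norm_num)) (by positivity)
  have hhalf := expect_half_le (H := H) (K := K) hq (W := W) (t := t) (u := u) (k := k)
    (fun ω => act ω t (k + 1)) (fun ω => active_succ_subset _ k) (by omega)
    (fun ω a b ha hb => act_swapNoise_of_ge ha hb (Nat.le_succ k)) hW0
    (fun ω a b ha hb => by
      simp only [hWdef]
      rw [hg.swap, acc_swapNoise ha hb, idle_swapNoise ha hb,
        act_swapNoise_of_ge ha hb (Nat.le_succ k)]
      simp only [Finset.map_eq_empty, Finset.card_map, ne_eq])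
    (fun ω hω => hgood ω (left_ne_zero_of_mul (left_ne_zero_of_mul hω)))
  have hL : expect q H K (fun ω => g ω *
        (if acc ω t k r = ∅ ∧ idl ω t k = ∅ ∧ act ω t (k + 1) ≠ ∅ then 1 else 0)) =
      expect q H K (fun ω => W ω * (act ω t (k + 1)).card) := by
    congr 1
    funext ω
    simp only [hWdef]
    split_ifs with h
    · have : ((act ω t (k + 1)).card : ℝ) ≠ 0 := by
        have := Finset.card_pos.2 (Finset.nonempty_iff_ne_empty.2 h.2.2)
        positivity
      field_simp
    · simp
  have hcoin : (1 - β) * expect q H K (fun ω => W ω * (act ω t (k + 1) ∩ act ω u k).card) =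
      expect q H K (fun ω => W ω * ∑ n ∈ act ω t (k + 1) ∩ act ω u k,
        if (ω (t + 1) k n).2.1 = true then 1 else 0) := by
    have hag : ∀ ω ω' : Noise N R,
        (∀ s j m, (j = k → s ∉ ({t + 1} : Finset ℕ)) → ω s j m = ω' s j m) →
        W ω = W ω' ∧ act ω t (k + 1) ∩ act ω u k = act ω' t (k + 1) ∩ act ω' u k := by
      intro ω ω' h
      have e1 := rows_eq_of_agree h (t := t) (by simp)
      have e2 := act_eq_of_agree h t
      have e3 := act_eq_of_agree h u
      have e4 : act ω t (k + 1) = act ω' t (k + 1) := by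
        simp only [act, active] at e2 ⊢
        rw [e1, e2]
      refine ⟨?_, by rw [e3, e4]⟩
      simp only [hWdef]
      rw [hg.agree h, acc, idl, acc, idl, e1, e2, e4]
    have h := expect_sum_block (H := H) hq.toIsWeight hk (S := {t + 1})
      (fun s hs => by rw [Finset.mem_singleton] at hs; omega) (fun ω ω' h => (hag ω ω' h).1)
      (fun ω ω' h => (hag ω ω' h).2) (fun n => {n}) (c := 1) (fun _ _ _ => rfl)
      (fun _ a => if a.2.1 = true then (1 : ℝ) else 0)
    simp only [Finset.prod_singleton, pow_one, expect_coin_true hq] at h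
    exact h.symm
  have hβ : 0 ≤ 1 - β := by
    rw [← expect_coin_true hq]
    exact Finset.sum_nonneg fun a _ => mul_nonneg (hq.nonneg a) (by split_ifs <;> norm_num)
  have hfin : expect q H K (fun ω => W ω * ∑ n ∈ act ω t (k + 1) ∩ act ω u k,
        if (ω (t + 1) k n).2.1 = true then 1 else 0) ≤
      expect q H K (fun ω => g ω *
        (if acc ω (t + 1) k r = ∅ ∧ idl ω (t + 1) k ≠ ∅ then 1 else 0)) := by
    refine expect_mono hq.toIsWeight fun ω => ?_
    simp only [hWdef]
    rw [mul_assoc, mul_assoc]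
    refine mul_le_mul_of_nonneg_left ?_ (hg0 ω)
    by_cases h : acc ω t k r = ∅ ∧ idl ω t k = ∅ ∧ act ω t (k + 1) ≠ ∅
    swap
    · rw [if_neg h, zero_mul]
      split_ifs <;> norm_num
    obtain ⟨hacc, hidl, hne⟩ := h
    rw [if_pos ⟨hacc, hidl, hne⟩, one_mul]
    have hpos : (0 : ℝ) < (act ω t (k + 1)).card := by
      exact_mod_cast Finset.card_pos.2 (Finset.nonempty_iff_ne_empty.2 hne)
    have hacc' : acc ω (t + 1) k r = ∅ := by
      rw [acc_succ_of_free hacc, hidl, Finset.filter_empty]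
    by_cases hex : ∃ n ∈ act ω t (k + 1) ∩ act ω u k, (ω (t + 1) k n).2.1 = true
    · obtain ⟨n, hn, hnx⟩ := hex
      rw [Finset.mem_inter] at hn
      have hnt : n ∈ act ω t k := active_succ_subset _ k hn.1
      have hidle : n ∈ idl ω (t + 1) k := by
        refine mem_idle.2 ⟨act_anti ω k htu hn.2, ?_⟩
        rw [rows_succ, nextRow]
        rcases hrow : rows ω t k n with _ | r'
        · exact absurd (mem_idle.2 ⟨hnt, hrow⟩) (Finset.eq_empty_iff_forall_notMem.1 hidl n)
        · have hmem : n ∈ acc ω t k r' := mem_accessors.2 ⟨hnt, hrow⟩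
          have hnw : (acc ω t k r').card ≠ 1 := by
            intro hc
            obtain ⟨m, hm⟩ := Finset.card_eq_one.1 hc
            rw [hm, Finset.mem_singleton] at hmem
            subst hmem
            exact (Finset.mem_sdiff.1 hn.1).2 (mem_winners.2 ⟨hnt, r', hm⟩)
          have h2 : 2 ≤ (acc ω t k r').card := by
            have := Finset.card_pos.2 ⟨n, hmem⟩
            omega
          simp [hnt, h2, hnx]
      rw [if_pos ⟨hacc', Finset.ne_empty_of_mem hidle⟩, inv_mul_le_iff₀ hpos, mul_one]
      rw [Finset.sum_boole]
      exact_mod_cast Finset.card_le_card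
        ((Finset.filter_subset _ _).trans Finset.inter_subset_left)
    · push Not at hex
      rw [Finset.sum_eq_zero fun n hn => by rw [if_neg (by simp [hex n hn])], mul_zero]
      split_ifs <;> norm_num
  rw [hL]
  calc _ ≤ (1 - β) * (2 * expect q H K
        (fun ω => W ω * (act ω t (k + 1) ∩ act ω u k).card)) :=
        mul_le_mul_of_nonneg_left hhalf hβ
    _ = 2 * ((1 - β) * expect q H K
        (fun ω => W ω * (act ω t (k + 1) ∩ act ω u k).card)) := by ring
    _ ≤ _ := by
        rw [hcoin]
        linarith

/-- A free resource that is monitored by `y` idle agents is filled with a probability of the order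
of the mean number `y * (1 / R) * β ^ l` of agents that adopt and keep it for `l` more episodes. -/
theorem expect_idle_fill (hq : IsSeed q β) (hβ0 : 0 ≤ β) {k t u l y : ℕ} (hk : k < K)
    (hlu : t + (l + 1) ≤ u) (hu : u < H) (r : Fin R) {g : Noise N R → ℝ} (hg0 : ∀ ω, 0 ≤ g ω)
    (hg : DependsBefore k g)
    (hgood : ∀ ω, g ω ≠ 0 → (act ω t k).card ≤ 2 * (act ω u k).card)
    (hy : y * (1 / (R : ℝ) * β ^ l) ≤ 1 / 4) :
    y * (1 / (R : ℝ) * β ^ l) / 4 * expect q H K (fun ω => g ω *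
        (if acc ω t k r = ∅ ∧ (idl ω t k).card = y then 1 else 0)) ≤
      expect q H K (fun ω => g ω *
        (if acc ω t k r = ∅ ∧ (idl ω t k).card = y then 1 else 0) *
        (if ∃ s ∈ Finset.Ioc t u, (acc ω s k r).card = 1 then 1 else 0)) := by
  set W : Noise N R → ℝ := fun ω => g ω *
    (if acc ω t k r = ∅ ∧ (idl ω t k).card = y then 1 else 0) with hWdef
  set S := Finset.Ioc t (t + (l + 1)) with hS
  set z := 1 / (R : ℝ) * β ^ l with hz
  have hz0 : 0 ≤ z := by positivity
  -- The event for one agent: it monitors `r` at time `t + 1`, then keeps it at the `l` following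
  -- coin tosses. Its probability is `z`.
  let f : ℕ → Action R × Bool × Fin R → ℝ := fun s a =>
    if s = t + 1 then (if a.2.2 = r then 1 else 0) else (if a.2.1 = false then 1 else 0)
  have hSins : S = insert (t + 1) (Finset.Ioc (t + 1) (t + (l + 1))) := by
    ext s
    simp only [hS, Finset.mem_Ioc, Finset.mem_insert]
    omega
  have hnotin : t + 1 ∉ Finset.Ioc (t + 1) (t + (l + 1)) := by simp
  have hprod : ∏ s ∈ S, ∑ a, q a * f s a = z := by
    rw [hSins, Finset.prod_insert hnotin]
    congr 1
    · simp only [f, if_true]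
      exact hq.monitor r
    · rw [Finset.prod_congr rfl (g := fun _ => β)]
      · rw [Finset.prod_const, Nat.card_Ioc]
        congr 1
        omega
      · intro s hs
        have : s ≠ t + 1 := fun h => hnotin (h ▸ hs)
        simp only [f, this, if_false]
        exact hq.coin
  obtain ⟨C, hC⟩ : ∃ C : Noise N R → Finset (Fin N), ∀ ω n, n ∈ C ω ↔
      ((ω (t + 1) k n).2.2 = r ∧
        ∀ s ∈ Finset.Ioc (t + 1) (t + (l + 1)), (ω s k n).2.1 = false) := by
    classical
    exact ⟨fun ω => Finset.univ.filter fun n => (ω (t + 1) k n).2.2 = r ∧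
      ∀ s ∈ Finset.Ioc (t + 1) (t + (l + 1)), (ω s k n).2.1 = false, by simp⟩
  have hval : ∀ (ω : Noise N R) n, ∏ s ∈ S, f s (ω s k n) = if n ∈ C ω then 1 else 0 := by
    intro ω n
    rw [hSins, Finset.prod_insert hnotin]
    split_ifs with hn
    · rw [hC] at hn
      rw [Finset.prod_eq_one, mul_one]
      · simp [f, hn.1]
      · intro s hs
        have : s ≠ t + 1 := fun h => hnotin (h ▸ hs)
        simp [f, this, hn.2 s hs]
    · rw [hC, not_and_or] at hn
      rcases hn with hn | hn
      · simp [f, hn]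
      · push Not at hn
        obtain ⟨s, hs, hne⟩ := hn
        have : s ≠ t + 1 := fun h => hnotin (h ▸ hs)
        rw [Finset.prod_eq_zero hs, mul_zero]
        simp [f, this, hne]
  have hag : ∀ ω ω' : Noise N R, (∀ s j m, (j = k → s ∉ S) → ω s j m = ω' s j m) →
      W ω = W ω' ∧ idl ω t k = idl ω' t k ∧ act ω u k = act ω' u k := by
    intro ω ω' h
    have e1 := rows_eq_of_agree h (t := t) (fun s hs => (Finset.mem_Ioc.1 hs).1)
    have e2 := act_eq_of_agree h t
    have e3 := act_eq_of_agree h u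
    refine ⟨?_, ?_, e3⟩
    · simp only [hWdef]
      rw [hg.agree h, acc, idl, acc, idl, e1, e2]
    · rw [idl, idl, e1, e2]
  have hSH : ∀ s ∈ S, s < H := fun s hs => by
    have := (Finset.mem_Ioc.1 hs).2
    omega
  have hone := expect_sum_block (H := H) hq.toIsWeight hk hSH (fun ω ω' h => (hag ω ω' h).1)
    (Z := fun ω => idl ω t k ∩ act ω u k)
    (fun ω ω' h => by simp only [(hag ω ω' h).2.1, (hag ω ω' h).2.2])
    (fun n => {n}) (c := 1) (fun _ _ _ => rfl) f
  have htwo := expect_sum_block (H := H) hq.toIsWeight hk hSH (fun ω ω' h => (hag ω ω' h).1)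
    (Z := fun ω => (idl ω t k).offDiag)
    (fun ω ω' h => by simp only [(hag ω ω' h).2.1])
    (fun p => {p.1, p.2}) (c := 2)
    (fun _ p hp => Finset.card_pair (Finset.mem_offDiag.1 hp).2.2) f
  rw [hprod] at hone htwo
  have hW0 : ∀ ω, 0 ≤ W ω := fun ω => mul_nonneg (hg0 ω) (by split_ifs <;> norm_num)
  have hhalf := expect_half_le (H := H) (K := K) hq (W := W) (t := t) (u := u) (k := k)
    (fun ω => idl ω t k) (fun ω => idle_subset) (by omega)
    (fun ω a b ha hb => idle_swapNoise ha hb) hW0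
    (fun ω a b ha hb => by
      simp only [hWdef]
      rw [hg.swap, acc_swapNoise ha hb, idle_swapNoise ha hb]
      simp only [Finset.map_eq_empty, Finset.card_map])
    (fun ω hω => hgood ω (left_ne_zero_of_mul hω))
  have hWy : ∀ F : ℝ → ℝ, expect q H K (fun ω => W ω * F (idl ω t k).card) =
      F y * expect q H K W := by
    intro F
    rw [← expect_const_mul]
    congr 1
    funext ω
    simp only [hWdef]
    split_ifs with h
    · rw [h.2]; ring
    · simp
  rw [hWy (fun v => v)] at hhalf
  have hoff : ∀ ω : Noise N R, (((idl ω t k).offDiag.card : ℕ) : ℝ) =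
      ((idl ω t k).card : ℝ) * (idl ω t k).card - (idl ω t k).card := by
    intro ω
    rw [Finset.offDiag_card, Nat.cast_sub (Nat.le_mul_self _), Nat.cast_mul]
  simp only [hoff] at htwo
  rw [hWy (fun v => v * v - v)] at htwo
  -- Inclusion and exclusion over the set `T` of agents that adopt and keep `r`: singles minus
  -- ordered pairs is at most `2 |T| - |T| ^ 2`. This is at most `1`, and at most `0` if `|T| ≠ 1`.
  -- If `r` is never filled, a nonempty `T` is the whole set of accessors, so `|T| = 1` is excluded.
  have hpt : ∀ ω, W ω * (∑ n ∈ idl ω t k ∩ act ω u k, ∏ m ∈ ({n} : Finset (Fin N)),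
        ∏ s ∈ S, f s (ω s k m)) -
      W ω * (∑ p ∈ (idl ω t k).offDiag, ∏ m ∈ ({p.1, p.2} : Finset (Fin N)),
        ∏ s ∈ S, f s (ω s k m)) ≤
      W ω * (if ∃ s ∈ Finset.Ioc t u, (acc ω s k r).card = 1 then 1 else 0) := by
    intro ω
    rw [← mul_sub]
    by_cases hacc : acc ω t k r = ∅
    swap
    · simp [hWdef, hacc]
    refine mul_le_mul_of_nonneg_left ?_ (hW0 ω)
    simp only [hval, Finset.prod_singleton]
    set T := idl ω t k ∩ (act ω (t + (l + 1)) k ∩ C ω) with hT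
    have h1 : (∑ n ∈ idl ω t k ∩ act ω u k, if n ∈ C ω then (1 : ℝ) else 0) ≤ T.card := by
      rw [Finset.sum_boole]
      refine Nat.cast_le.2 (Finset.card_le_card fun n hn => ?_)
      simp only [Finset.mem_filter, Finset.mem_inter] at hn
      simp only [hT, Finset.mem_inter]
      exact ⟨hn.1.1, act_anti ω k hlu hn.1.2, hn.2⟩
    have h2 : (T.card : ℝ) * T.card - T.card ≤ ∑ p ∈ (idl ω t k).offDiag,
        ∏ m ∈ ({p.1, p.2} : Finset (Fin N)), if m ∈ C ω then (1 : ℝ) else 0 := by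
      have h3 : (T.card : ℝ) * T.card - T.card = (T.offDiag.card : ℕ) := by
        rw [Finset.offDiag_card, Nat.cast_sub (Nat.le_mul_self _), Nat.cast_mul]
      rw [h3, ← nsmul_one, ← Finset.sum_const]
      refine (Finset.sum_le_sum (f := fun _ => (1 : ℝ)) fun p hp => ?_).trans
        (Finset.sum_le_sum_of_subset_of_nonneg (Finset.offDiag_mono Finset.inter_subset_left)
          fun p _ _ => Finset.prod_nonneg fun m _ => by split_ifs <;> norm_num)
      refine le_of_eq (Finset.prod_eq_one fun m hm => if_pos ?_).symm
      rw [Finset.mem_offDiag] at hp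
      simp only [Finset.mem_insert, Finset.mem_singleton] at hm
      rcases hm with rfl | rfl
      · exact (Finset.mem_inter.1 (Finset.mem_inter.1 hp.1).2).2
      · exact (Finset.mem_inter.1 (Finset.mem_inter.1 hp.2.1).2).2
    have h4 : 2 * (T.card : ℝ) - T.card * T.card ≤
        if ∃ s ∈ Finset.Ioc t u, (acc ω s k r).card = 1 then 1 else 0 := by
      split_ifs with hex
      · nlinarith [sq_nonneg ((T.card : ℝ) - 1)]
      · push Not at hex
        rcases T.eq_empty_or_nonempty with h0 | ⟨n, hn⟩
        · simp [h0]
        · have hn' := hn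
          simp only [hT, Finset.mem_inter, hC] at hn'
          have hfree := acc_of_free hacc (l := l)
            (fun s hs => hex s (by rw [Finset.mem_Ioc] at hs ⊢; omega)) hn'.1 hn'.2.1 hn'.2.2.1
            hn'.2.2.2
          have hTe : acc ω (t + (l + 1)) k r = T := by
            ext m
            rw [hfree]
            simp only [hT, Finset.mem_inter, hC]
          have h5 := hex (t + (l + 1)) (by rw [Finset.mem_Ioc]; omega)
          rw [hTe] at h5
          have h6 := Finset.card_pos.2 ⟨n, hn⟩
          have h7 : (2 : ℝ) ≤ T.card := by
            have : 2 ≤ T.card := by omega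
            exact_mod_cast this
          nlinarith
    linarith
  have hmain := expect_mono (H := H) (K := K) hq.toIsWeight hpt
  rw [expect_sub, hone, htwo] at hmain
  have hE0 : 0 ≤ expect q H K W := expect_nonneg hq.toIsWeight hW0
  have hyz : 0 ≤ (y : ℝ) * z := by positivity
  have h8 : z * (y * expect q H K W) ≤
      z * (2 * expect q H K (fun ω => W ω * (idl ω t k ∩ act ω u k).card)) :=
    mul_le_mul_of_nonneg_left hhalf hz0
  have h9 : 0 ≤ z ^ 2 * y * expect q H K W := by positivity
  -- Singles contribute at least `y z / 2`, pairs at most `(y z) ^ 2 ≤ y z / 4`; this leaves `y z /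
  -- 4`.
  have h10 : (y * z) * (y * z) * expect q H K W ≤ (y * z) * (1 / 4) * expect q H K W :=
    mul_le_mul_of_nonneg_right (mul_le_mul_of_nonneg_left hy hyz) hE0
  nlinarith

end FreeSlot

/-! ### Deficits, newly filled resources and new successes -/

section NewFill

variable {N R : ℕ}

/-- The number of episodes in `[t, u)` after which `r` becomes filled in context `k`. -/
def fills (ω : Noise N R) (t u k : ℕ) (r : Fin R) : ℕ :=
  ((Finset.Ico t u).filter fun s => (acc ω s k r).card ≠ 1 ∧ (acc ω (s + 1) k r).card = 1).card

theorem one_le_fills {ω : Noise N R} {t u k : ℕ} {r : Fin R} {s v : ℕ} (hts : t ≤ s)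
    (hsv : s ≤ v) (hvu : v ≤ u) (h0 : (acc ω s k r).card ≠ 1) (h1 : (acc ω v k r).card = 1) :
    1 ≤ fills ω t u k r := by
  induction v, hsv using Nat.le_induction with
  | base => exact absurd h1 h0
  | succ v hsv ih =>
    by_cases h2 : (acc ω v k r).card = 1
    · exact ih (by omega) h2
    · exact Finset.card_pos.2 ⟨v, Finset.mem_filter.2 ⟨Finset.mem_Ico.2 ⟨by omega, by omega⟩,
        h2, h1⟩⟩

/-- The agent alone on a newly filled resource is a new winner: had it won elsewhere before, it
would still be there. -/
theorem card_newFilled_le (ω : Noise N R) (s k : ℕ) :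
    (Finset.univ.filter fun r : Fin R =>
      (acc ω s k r).card ≠ 1 ∧ (acc ω (s + 1) k r).card = 1).card ≤ (newWin ω s k).card := by
  rw [← Finset.card_image_of_injective _ (Option.some_injective (Fin R))]
  refine (Finset.card_le_card ?_).trans
    (Finset.card_image_le (s := newWin ω s k) (f := rows ω (s + 1) k))
  intro o ho
  simp only [Finset.mem_image, Finset.mem_filter, Finset.mem_univ, true_and] at ho ⊢
  obtain ⟨r, ⟨h0, h1⟩, rfl⟩ := ho
  obtain ⟨n, hn⟩ := Finset.card_eq_one.1 h1
  have hrow := eq_some_of_accessors_eq_singleton hn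
  have hact : n ∈ act ω (s + 1) k := accessors_subset (hn ▸ Finset.mem_singleton_self n)
  refine ⟨n, Finset.mem_sdiff.2 ⟨mem_winners.2 ⟨hact, r, hn⟩, fun hw => h0 ?_⟩, hrow⟩
  obtain ⟨_, r', hr'⟩ := mem_winners.1 hw
  have h2 : acc ω (s + 1) k r' = {n} := nextRow_of_winner (act_succ_subset ω s k) hr' hact
  have h3 := eq_some_of_accessors_eq_singleton h2
  rw [hrow, Option.some.injEq] at h3
  rw [h3]
  exact Finset.card_eq_one.2 ⟨n, hr'⟩

theorem sum_fills_le (ω : Noise N R) (t u k : ℕ) :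
    ∑ r, fills ω t u k r ≤ ∑ s ∈ Finset.Ico t u, (newWin ω s k).card := by
  simp only [fills, Finset.card_filter]
  rw [Finset.sum_comm]
  refine Finset.sum_le_sum fun s _ => ?_
  rw [← Finset.card_filter]
  exact card_newFilled_le ω s k

theorem card_win_le (ω : Noise N R) {t s : ℕ} (hts : t ≤ s) (k : ℕ) :
    (win ω s k).card ≤ (win ω t k).card + ∑ v ∈ Finset.Ico t s, (newWin ω v k).card := by
  induction s, hts using Nat.le_induction with
  | base => simp
  | succ s hs ih =>
    rw [Finset.sum_Ico_succ_top hs]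
    have h1 : (win ω (s + 1) k).card ≤ (win ω s k).card + (newWin ω s k).card := by
      refine (Finset.card_le_card (t := win ω s k ∪ newWin ω s k) ?_).trans
        (Finset.card_union_le _ _)
      intro n hn
      by_cases h : n ∈ win ω s k <;> simp [newWin, h, hn]
    omega

/-- The number of agents missing in context `k`. -/
def deficit (ω : Noise N R) (t k : ℕ) : ℕ := min R (N - k * R) - (win ω t k).card

/-- The resources of context `k` that are not accessed by exactly one agent. -/
def unfilled (ω : Noise N R) (t k : ℕ) : Finset (Fin R) :=
  Finset.univ.filter fun r => (acc ω t k r).card ≠ 1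

theorem card_unfilled (ω : Noise N R) (t k : ℕ) :
    (unfilled ω t k).card + (win ω t k).card = R := by
  rw [win, card_winners, filled, unfilled, add_comm]
  have := Finset.card_filter_add_card_filter_not (s := Finset.univ)
    (fun r : Fin R => (acc ω t k r).card = 1)
  simpa using this

theorem deficit_le_card_unfilled (ω : Noise N R) (t k : ℕ) :
    deficit ω t k ≤ (unfilled ω t k).card := by
  have := card_unfilled ω t k
  unfold deficit
  omega

/-- If in some episode all active agents succeed in context `k`, the new successes up to then make
up the whole deficit. Otherwise every resource counted on the left has either become filled, or was
free at a time when some agent was still active after `k`. The ratio of the deficit to the number of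
unfilled resources is at most `1`. -/
theorem deficit_mul_le (ω : Noise N R) {t u l k : ℕ} (hlu : t + l ≤ u) :
    (deficit ω t k : ℝ) / (unfilled ω t k).card *
        ((unfilled ω t k).filter fun r => ∃ s ∈ Finset.Icc t (t + l),
          (acc ω s k r).card ≤ 1).card ≤
      ∑ s ∈ Finset.Ico t u, ((newWin ω s k).card : ℝ) +
        ∑ s ∈ Finset.Icc t (t + l), ∑ r : Fin R,
          (if acc ω s k r = ∅ ∧ act ω s (k + 1) ≠ ∅ then (1 : ℝ) else 0) := by
  set Q := (unfilled ω t k).filter fun r => ∃ s ∈ Finset.Icc t (t + l), (acc ω s k r).card ≤ 1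
    with hQ
  have hQle : Q.card ≤ (unfilled ω t k).card := Finset.card_filter_le _ _
  have hS0 : 0 ≤ ∑ s ∈ Finset.Icc t (t + l), ∑ r : Fin R,
      (if acc ω s k r = ∅ ∧ act ω s (k + 1) ≠ ∅ then (1 : ℝ) else 0) :=
    Finset.sum_nonneg fun _ _ => Finset.sum_nonneg fun _ _ => by split_ifs <;> norm_num
  rcases Nat.eq_zero_or_pos (unfilled ω t k).card with h0 | h0
  · rw [h0, Nat.cast_zero, div_zero, zero_mul]
    exact add_nonneg (Finset.sum_nonneg fun _ _ => Nat.cast_nonneg _) hS0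
  have h0' : (0 : ℝ) < (unfilled ω t k).card := by exact_mod_cast h0
  by_cases hex : ∃ s ∈ Finset.Icc t (t + l), act ω s (k + 1) = ∅
  · obtain ⟨s, hs, hse⟩ := hex
    rw [Finset.mem_Icc] at hs
    have h1 : (act ω s (k + 1)).card + (win ω s k).card = (act ω s k).card :=
      card_active_succ (rows ω s) k
    have h2 : N - k * R ≤ (act ω s k).card := le_card_active (rows ω s) k
    have h3 := card_win_le ω hs.1 k
    have h4 : ∑ v ∈ Finset.Ico t s, (newWin ω v k).card ≤
        ∑ v ∈ Finset.Ico t u, (newWin ω v k).card :=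
      Finset.sum_le_sum_of_subset (Finset.Ico_subset_Ico_right (by omega))
    have h5 : deficit ω t k ≤ ∑ v ∈ Finset.Ico t u, (newWin ω v k).card := by
      rw [hse, Finset.card_empty] at h1
      unfold deficit
      omega
    have h6 : (deficit ω t k : ℝ) / (unfilled ω t k).card * Q.card ≤ deficit ω t k := by
      rw [div_mul_eq_mul_div, div_le_iff₀ h0']
      exact mul_le_mul_of_nonneg_left (by exact_mod_cast hQle) (by positivity)
    have h7 : (deficit ω t k : ℝ) ≤ ∑ v ∈ Finset.Ico t u, ((newWin ω v k).card : ℝ) := by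
      exact_mod_cast h5
    linarith
  · push Not at hex
    have h1 : (deficit ω t k : ℝ) / (unfilled ω t k).card * Q.card ≤ Q.card := by
      refine mul_le_of_le_one_left (by positivity) ((div_le_one h0').2 ?_)
      exact_mod_cast deficit_le_card_unfilled ω t k
    have h2 : (Q.card : ℝ) ≤ ∑ r : Fin R, ((fills ω t u k r : ℝ) +
        ∑ s ∈ Finset.Icc t (t + l),
          (if acc ω s k r = ∅ ∧ act ω s (k + 1) ≠ ∅ then (1 : ℝ) else 0)) := by
      rw [← nsmul_one, ← Finset.sum_const]
      have hnn : ∀ r : Fin R, 0 ≤ ∑ s ∈ Finset.Icc t (t + l),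
          (if acc ω s k r = ∅ ∧ act ω s (k + 1) ≠ ∅ then (1 : ℝ) else 0) := fun r =>
        Finset.sum_nonneg fun _ _ => by split_ifs <;> norm_num
      refine (Finset.sum_le_sum (f := fun _ => (1 : ℝ)) fun r hr => ?_).trans
        (Finset.sum_le_sum_of_subset_of_nonneg (Finset.subset_univ Q) fun r _ _ =>
          add_nonneg (by positivity) (hnn r))
      simp only [hQ, unfilled, Finset.mem_filter, Finset.mem_univ, true_and] at hr
      obtain ⟨hr0, s, hs, hs1⟩ := hr
      rcases Nat.lt_or_ge (acc ω s k r).card 1 with h3 | h3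
      · have h4 : acc ω s k r = ∅ := Finset.card_eq_zero.1 (by omega)
        have h5 := Finset.single_le_sum (f := fun s =>
          if acc ω s k r = ∅ ∧ act ω s (k + 1) ≠ ∅ then (1 : ℝ) else 0)
          (fun _ _ => by split_ifs <;> norm_num) hs
        rw [if_pos ⟨h4, (hex s hs).ne_empty⟩] at h5
        have : (0 : ℝ) ≤ fills ω t u k r := by positivity
        linarith
      · rw [Finset.mem_Icc] at hs
        have h4 : 1 ≤ fills ω t u k r :=
          one_le_fills le_rfl hs.1 (by omega) hr0 (by omega)
        have h5 : (1 : ℝ) ≤ fills ω t u k r := by exact_mod_cast h4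
        linarith [hnn r]
    have h3 : ∑ r : Fin R, (fills ω t u k r : ℝ) ≤
        ∑ s ∈ Finset.Ico t u, ((newWin ω s k).card : ℝ) := by
      exact_mod_cast sum_fills_le ω t u k
    rw [Finset.sum_add_distrib, Finset.sum_comm] at h2
    linarith

end NewFill

/-! ### The deficit of a context is controlled by its new successes -/

section FillRate

variable {N R : ℕ} [NeZero R] {q : Action R × Bool × Fin R → ℝ} {β : ℝ} {H K : ℕ}

/-- For the least `l` with mean at most `1 / 4`, either `l = 0` and the mean is at least `1 / ρ`, or
the previous mean exceeded `1 / 4` and shrank by a factor `β` only. -/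
theorem exists_hold_time {β ρ y Y : ℝ} {L : ℕ} (hβ0 : 0 < β) (hβ1 : β < 1) (hρ : 1 ≤ ρ)
    (hy : 1 ≤ y) (hyY : y ≤ Y) (hL : Y * β ^ L ≤ 1 / 4) :
    ∃ l ≤ L, y * (1 / ρ * β ^ l) ≤ 1 / 4 ∧ β / (4 * ρ) ≤ y * (1 / ρ * β ^ l) := by
  have hρ0 : 0 < ρ := by linarith
  have hex : ∃ l, y * (1 / ρ * β ^ l) ≤ 1 / 4 := by
    refine ⟨L, le_trans ?_ hL⟩
    have h1 : 1 / ρ * β ^ L ≤ β ^ L :=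
      mul_le_of_le_one_left (by positivity) ((div_le_one hρ0).2 hρ)
    exact mul_le_mul hyY h1 (by positivity) (by linarith)
  classical
  refine ⟨Nat.find hex, Nat.find_min' hex ?_, Nat.find_spec hex, ?_⟩
  · refine le_trans ?_ hL
    have h1 : 1 / ρ * β ^ L ≤ β ^ L :=
      mul_le_of_le_one_left (by positivity) ((div_le_one hρ0).2 hρ)
    exact mul_le_mul hyY h1 (by positivity) (by linarith)
  · rcases hl : Nat.find hex with _ | l
    · rw [pow_zero, mul_one, div_le_iff₀ (by positivity)]
      have : y * (1 / ρ) * (4 * ρ) = 4 * y := by field_simp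
      rw [this]
      linarith
    · have h1 := Nat.find_min hex (m := l) (by omega)
      push Not at h1
      have h2 : β / (4 * ρ) ≤ β / 4 :=
        div_le_div_of_nonneg_left hβ0.le (by norm_num) (by linarith)
      have h3 : y * (1 / ρ * β ^ (l + 1)) = β * (y * (1 / ρ * β ^ l)) := by ring
      rw [h3]
      nlinarith

theorem expect_idle_le (hq : IsSeed q β) (hβ0 : 0 < β) (hβ1 : β < 1) {k t u L : ℕ} (hk : k < K)
    (hLu : t + (L + 1) ≤ u) (hu : u < H) (hL : N * β ^ L ≤ 1 / 4) (r : Fin R)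
    {g : Noise N R → ℝ} (hg0 : ∀ ω, 0 ≤ g ω) (hg : DependsBefore k g)
    (hgood : ∀ ω, g ω ≠ 0 → (act ω t k).card ≤ 2 * (act ω u k).card) :
    expect q H K (fun ω => g ω * (if acc ω t k r = ∅ ∧ idl ω t k ≠ ∅ then 1 else 0)) ≤
      16 / β * R * expect q H K (fun ω => g ω *
        (if acc ω t k r = ∅ ∧ ∃ s ∈ Finset.Ioc t u, (acc ω s k r).card = 1 then 1 else 0)) := by
  have hR : (1 : ℝ) ≤ R := by exact_mod_cast NeZero.one_le
  have hR0 : (0 : ℝ) < R := by linarith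
  have h1 : ∀ y ∈ Finset.Icc 1 N, expect q H K (fun ω => g ω *
        (if acc ω t k r = ∅ ∧ (idl ω t k).card = y then 1 else 0)) ≤
      16 / β * R * expect q H K (fun ω => g ω *
        (if acc ω t k r = ∅ ∧ (idl ω t k).card = y then 1 else 0) *
        (if ∃ s ∈ Finset.Ioc t u, (acc ω s k r).card = 1 then 1 else 0)) := by
    intro y hy
    rw [Finset.mem_Icc] at hy
    obtain ⟨l, hl, hl1, hl2⟩ := exists_hold_time (y := y) (Y := N) hβ0 hβ1 hR
      (by exact_mod_cast hy.1) (by exact_mod_cast hy.2) hL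
    have h2 := expect_idle_fill (H := H) (K := K) hq hβ0.le hk (l := l)
      (show t + (l + 1) ≤ u by omega) hu r hg0 hg hgood hl1
    have h3 : 0 ≤ expect q H K (fun ω => g ω *
        (if acc ω t k r = ∅ ∧ (idl ω t k).card = y then 1 else 0)) :=
      expect_nonneg hq.toIsWeight fun ω => mul_nonneg (hg0 ω) (by split_ifs <;> norm_num)
    -- The filling probability is at least `β / (4 R) / 4`, whence the constant `16 / β * R`.
    have h4 := (mul_le_mul_of_nonneg_right
      (div_le_div_of_nonneg_right hl2 (by norm_num : (0 : ℝ) ≤ 4)) h3).trans h2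
    refine le_trans (le_of_eq ?_) (mul_le_mul_of_nonneg_left h4
      (show 0 ≤ 16 / β * (R : ℝ) by positivity))
    field_simp
    norm_num
  have h2 : ∀ ω, g ω * (if acc ω t k r = ∅ ∧ idl ω t k ≠ ∅ then 1 else 0) ≤
      ∑ y ∈ Finset.Icc 1 N, g ω *
        (if acc ω t k r = ∅ ∧ (idl ω t k).card = y then 1 else 0) := by
    intro ω
    rw [← Finset.mul_sum]
    refine mul_le_mul_of_nonneg_left ?_ (hg0 ω)
    have hnn : ∀ y ∈ Finset.Icc 1 N,
        (0 : ℝ) ≤ if acc ω t k r = ∅ ∧ (idl ω t k).card = y then 1 else 0 := fun y _ => by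
      split_ifs <;> norm_num
    split_ifs with h
    · have hmem : (idl ω t k).card ∈ Finset.Icc 1 N := Finset.mem_Icc.2
        ⟨Finset.card_pos.2 (Finset.nonempty_iff_ne_empty.2 h.2), by
          simpa using Finset.card_le_univ (idl ω t k)⟩
      have h3 := Finset.single_le_sum hnn hmem
      rwa [if_pos ⟨h.1, rfl⟩] at h3
    · exact Finset.sum_nonneg hnn
  have h3 : ∀ ω, ∑ y ∈ Finset.Icc 1 N, g ω *
        (if acc ω t k r = ∅ ∧ (idl ω t k).card = y then 1 else 0) *
        (if ∃ s ∈ Finset.Ioc t u, (acc ω s k r).card = 1 then 1 else 0) ≤ g ω *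
        (if acc ω t k r = ∅ ∧ ∃ s ∈ Finset.Ioc t u, (acc ω s k r).card = 1 then 1 else 0) := by
    intro ω
    simp only [mul_assoc]
    rw [← Finset.mul_sum]
    refine mul_le_mul_of_nonneg_left ?_ (hg0 ω)
    by_cases h4 : acc ω t k r = ∅
    · by_cases h5 : ∃ s ∈ Finset.Ioc t u, (acc ω s k r).card = 1
      · simp only [h4, h5, true_and, and_self, if_true, mul_one]
        rw [Finset.sum_ite_eq]
        split_ifs <;> norm_num
      · rw [Finset.sum_eq_zero fun y _ => by rw [if_neg h5, mul_zero]]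
        split_ifs <;> norm_num
    · rw [Finset.sum_eq_zero fun y _ => by rw [if_neg fun h => h4 h.1, zero_mul]]
      split_ifs <;> norm_num
  calc _ ≤ ∑ y ∈ Finset.Icc 1 N, expect q H K (fun ω => g ω *
        (if acc ω t k r = ∅ ∧ (idl ω t k).card = y then 1 else 0)) := by
        rw [← expect_sum]
        exact expect_mono hq.toIsWeight h2
    _ ≤ _ := Finset.sum_le_sum h1
    _ ≤ _ := by
        rw [← Finset.mul_sum, ← expect_sum]
        exact mul_le_mul_of_nonneg_left (expect_mono hq.toIsWeight h3) (by positivity)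

/-- Either some agent is idle and `expect_idle_le` applies at once, or nobody is, and an idle agent
is likely to appear one episode later. This costs the factor `2 / (1 - β)` and the additional
episode in `L + 2`. -/
theorem expect_free_le (hq : IsSeed q β) (hβ0 : 0 < β) (hβ1 : β < 1) {k t₀ t u L : ℕ}
    (hk : k < K) (ht : t₀ ≤ t) (hLu : t + (L + 2) ≤ u) (hu : u < H) (hL : N * β ^ L ≤ 1 / 4)
    (r : Fin R) {g : Noise N R → ℝ} (hg0 : ∀ ω, 0 ≤ g ω) (hg : DependsBefore k g)
    (hgood : ∀ ω, g ω ≠ 0 → (act ω t₀ k).card ≤ 2 * (act ω u k).card) :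
    expect q H K (fun ω => g ω * (if acc ω t k r = ∅ ∧ act ω t (k + 1) ≠ ∅ then 1 else 0)) ≤
      16 / β * (1 + 2 / (1 - β)) * R * expect q H K (fun ω => g ω * fills ω t₀ u k r) := by
  have hgood' : ∀ s, t₀ ≤ s → ∀ ω, g ω ≠ 0 → (act ω s k).card ≤ 2 * (act ω u k).card :=
    fun s hs ω h => (Finset.card_le_card (act_anti ω k hs)).trans (hgood ω h)
  have hfill : ∀ s, t₀ ≤ s → expect q H K (fun ω => g ω *
      (if acc ω s k r = ∅ ∧ ∃ v ∈ Finset.Ioc s u, (acc ω v k r).card = 1 then 1 else 0)) ≤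
      expect q H K (fun ω => g ω * fills ω t₀ u k r) := by
    intro s hs
    refine expect_mono hq.toIsWeight fun ω => mul_le_mul_of_nonneg_left ?_ (hg0 ω)
    split_ifs with h
    · obtain ⟨h0, v, hv, h1⟩ := h
      rw [Finset.mem_Ioc] at hv
      have := one_le_fills (t := t₀) hs hv.1.le hv.2 (by simp [h0]) h1
      exact_mod_cast this
    · positivity
  have h1 := expect_idle_le (H := H) (K := K) hq hβ0 hβ1 hk (t := t) (by omega) hu hL r hg0 hg
    (hgood' t ht)
  have h2 := expect_idle_le (H := H) (K := K) hq hβ0 hβ1 hk (t := t + 1) (by omega) hu hL r hg0 hg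
    (hgood' (t + 1) (by omega))
  have h3 := expect_busy_free_le (H := H) (K := K) hq hk (t := t) (by omega) hu r hg0 hg
    (hgood' t ht)
  have hsplit : expect q H K (fun ω => g ω *
      (if acc ω t k r = ∅ ∧ act ω t (k + 1) ≠ ∅ then 1 else 0)) ≤
      expect q H K (fun ω => g ω * (if acc ω t k r = ∅ ∧ idl ω t k ≠ ∅ then 1 else 0)) +
      expect q H K (fun ω => g ω *
        (if acc ω t k r = ∅ ∧ idl ω t k = ∅ ∧ act ω t (k + 1) ≠ ∅ then 1 else 0)) := by
    rw [← expect_add]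
    refine expect_mono hq.toIsWeight fun ω => ?_
    rw [← mul_add]
    refine mul_le_mul_of_nonneg_left ?_ (hg0 ω)
    by_cases a1 : acc ω t k r = ∅ <;> by_cases a2 : idl ω t k = ∅ <;>
      by_cases a3 : act ω t (k + 1) = ∅ <;> simp [a1, a2, a3]
  set F := expect q H K (fun ω => g ω * fills ω t₀ u k r)
  have hβ' : 0 < 1 - β := by linarith
  have hc : 0 ≤ 16 / β * (R : ℝ) := by positivity
  have h1' := h1.trans (mul_le_mul_of_nonneg_left (hfill t ht) hc)
  have h2' := h2.trans (mul_le_mul_of_nonneg_left (hfill (t + 1) (by omega)) hc)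
  have h3' : expect q H K (fun ω => g ω *
        (if acc ω t k r = ∅ ∧ idl ω t k = ∅ ∧ act ω t (k + 1) ≠ ∅ then 1 else 0)) ≤
      2 / (1 - β) * (16 / β * R * F) := by
    rw [div_mul_eq_mul_div, le_div_iff₀ hβ', mul_comm]
    linarith
  calc _ ≤ _ := hsplit
    _ ≤ 16 / β * R * F + 2 / (1 - β) * (16 / β * R * F) := add_le_add h1' h3'
    _ = _ := by ring

/-- Within `L` episodes all but a quarter of the expected deficit, spread over the unfilled
resources, leaves the collisions. The rest is charged to new successes or to free resources, which
need up to `L + 2` more episodes; together they fit into `2 * L + 2`. -/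
theorem expect_deficit_le (hq : IsSeed q β) (hβ0 : 0 < β) (hβ1 : β < 1) {k t u L : ℕ}
    (hk : k < K) (hLu : t + (2 * L + 2) ≤ u) (hu : u < H) (hL : N * β ^ L ≤ 1 / 4) :
    expect q H K (fun ω : Noise N R =>
        (if (act ω t k).card ≤ 2 * (act ω u k).card then 1 else 0) * (deficit ω t k : ℝ)) ≤
      2 * (1 + 16 / β * (1 + 2 / (1 - β))) * R * (L + 1) *
        ∑ s ∈ Finset.Ico t u, expect q H K (fun ω : Noise N R => ((newWin ω s k).card : ℝ)) := by
  set g : Noise N R → ℝ := fun ω => if (act ω t k).card ≤ 2 * (act ω u k).card then 1 else 0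
    with hgdef
  have hg0 : ∀ ω, 0 ≤ g ω := fun ω => by simp only [hgdef]; split_ifs <;> norm_num
  have hg1 : ∀ ω, g ω ≤ 1 := fun ω => by simp only [hgdef]; split_ifs <;> norm_num
  have hg : DependsBefore k g := fun ω ω' h => by
    simp only [hgdef]
    rw [act_congr fun s _ j hj => h s j hj, act_congr (t := u) fun s _ j hj => h s j hj]
  have hgood : ∀ ω, g ω ≠ 0 → (act ω t k).card ≤ 2 * (act ω u k).card := fun ω h => by
    by_contra hc
    exact h (if_neg hc)
  have hR : (1 : ℝ) ≤ R := by exact_mod_cast NeZero.one_le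
  have hβ' : 0 < 1 - β := by linarith
  obtain ⟨v, hv⟩ : ∃ v : Noise N R → ℝ,
      ∀ ω, v ω = (deficit ω t k : ℝ) / (unfilled ω t k).card := ⟨_, fun _ => rfl⟩
  have hv0 : ∀ ω, 0 ≤ v ω := fun ω => by rw [hv]; positivity
  -- The deficit is spread evenly over the unfilled resources. In the last context there may be many
  -- more of these than missing agents.
  let W : Fin R → Noise N R → ℝ := fun r ω => g ω *
    (if r ∈ unfilled ω t k then v ω else 0)
  have hW0 : ∀ r ω, 0 ≤ W r ω := fun r ω => by
    refine mul_nonneg (hg0 ω) ?_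
    split_ifs
    exacts [hv0 ω, le_rfl]
  have hWsum : ∀ ω, ∑ r, W r ω = g ω * deficit ω t k := by
    intro ω
    simp only [W]
    rw [← Finset.mul_sum, Finset.sum_ite_mem, Finset.univ_inter, Finset.sum_const, nsmul_eq_mul,
      hv]
    congr 1
    rcases Nat.eq_zero_or_pos (unfilled ω t k).card with h0 | h0
    · have h1 := deficit_le_card_unfilled ω t k
      rw [h0] at h1
      simp [Nat.le_zero.1 h1]
    · have : ((unfilled ω t k).card : ℝ) ≠ 0 := by positivity
      field_simp
  have hcoll : ∀ r, expect q H K (fun ω => W r ω *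
      (if ∀ s, t ≤ s → s ≤ t + L → 2 ≤ (acc ω s k r).card then 1 else 0)) ≤
      1 / 4 * expect q H K (W r) := by
    intro r
    refine (expect_collision_le (H := H) hq hk (by omega) r (hW0 r) ?_).trans
      (mul_le_mul_of_nonneg_right hL (expect_nonneg hq.toIsWeight (hW0 r)))
    intro ω ω' h
    have e1 := rows_eq_of_agree h (t := t) (fun s hs => (Finset.mem_Ioc.1 hs).1)
    have e2 := act_eq_of_agree h t
    simp only [W]
    have e3 : unfilled ω t k = unfilled ω' t k := by
      unfold unfilled acc
      rw [e1, e2]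
    have e4 : deficit ω t k = deficit ω' t k := by
      unfold deficit win
      rw [e1, e2]
    rw [hg.agree h, hv, hv, e3, e4]
  have hpt : ∀ ω, g ω * deficit ω t k ≤ ∑ r, W r ω *
        (if ∀ s, t ≤ s → s ≤ t + L → 2 ≤ (acc ω s k r).card then 1 else 0) +
      (∑ s ∈ Finset.Ico t u, ((newWin ω s k).card : ℝ) +
        ∑ s ∈ Finset.Icc t (t + L), ∑ r : Fin R,
          g ω * (if acc ω s k r = ∅ ∧ act ω s (k + 1) ≠ ∅ then (1 : ℝ) else 0)) := by
    intro ω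
    have h1 := mul_le_mul_of_nonneg_left (deficit_mul_le ω (k := k) (show t + L ≤ u by omega))
      (hg0 ω)
    have h2 : ∑ r, W r ω - ∑ r, W r ω *
        (if ∀ s, t ≤ s → s ≤ t + L → 2 ≤ (acc ω s k r).card then 1 else 0) =
        g ω * ((deficit ω t k : ℝ) / (unfilled ω t k).card *
        ((unfilled ω t k).filter fun r => ∃ s ∈ Finset.Icc t (t + L),
          (acc ω s k r).card ≤ 1).card) := by
      rw [← Finset.sum_sub_distrib, ← hv, ← nsmul_eq_mul', ← Finset.sum_const, Finset.sum_filter,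
        Finset.mul_sum, ← Finset.sum_filter_add_sum_filter_not Finset.univ
        (fun r => r ∈ unfilled ω t k), Finset.filter_univ_mem]
      rw [Finset.sum_eq_zero (s := Finset.univ.filter fun r => r ∉ unfilled ω t k), add_zero]
      · refine Finset.sum_congr rfl fun r hr => ?_
        have h3 : (∃ s ∈ Finset.Icc t (t + L), (acc ω s k r).card ≤ 1) ↔
            ¬ ∀ s, t ≤ s → s ≤ t + L → 2 ≤ (acc ω s k r).card := by
          push Not
          simp only [Finset.mem_Icc, and_assoc]
          exact exists_congr fun s => by rw [Nat.lt_succ_iff]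
        have hWr : W r ω = g ω * v ω := by simp only [W, if_pos hr]
        rw [hWr]
        by_cases h4 : ∀ s, t ≤ s → s ≤ t + L → 2 ≤ (acc ω s k r).card
        · rw [if_pos h4, if_neg fun h => h3.1 h h4]
          ring
        · rw [if_neg h4, if_pos (h3.2 h4)]
          ring
      · intro r hr
        have hWr : W r ω = 0 := by
          simp only [W, if_neg (Finset.mem_filter.1 hr).2, mul_zero]
        rw [hWr, zero_mul, sub_zero]
    have h3 : g ω * ∑ s ∈ Finset.Ico t u, ((newWin ω s k).card : ℝ) ≤
        ∑ s ∈ Finset.Ico t u, ((newWin ω s k).card : ℝ) :=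
      mul_le_of_le_one_left (Finset.sum_nonneg fun _ _ => Nat.cast_nonneg _) (hg1 ω)
    have h4 : g ω * ∑ s ∈ Finset.Icc t (t + L), ∑ r : Fin R,
          (if acc ω s k r = ∅ ∧ act ω s (k + 1) ≠ ∅ then (1 : ℝ) else 0) =
        ∑ s ∈ Finset.Icc t (t + L), ∑ r : Fin R,
          g ω * (if acc ω s k r = ∅ ∧ act ω s (k + 1) ≠ ∅ then (1 : ℝ) else 0) := by
      rw [Finset.mul_sum]
      exact Finset.sum_congr rfl fun s _ => Finset.mul_sum _ _ _
    rw [mul_add] at h1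
    rw [hWsum] at h2
    linarith
  have hE := expect_mono (H := H) (K := K) hq.toIsWeight hpt
  rw [expect_add, expect_add, expect_sum, expect_sum, expect_sum] at hE
  simp only [expect_sum] at hE
  set D := expect q H K (fun ω => g ω * (deficit ω t k : ℝ)) with hD
  set NF := ∑ s ∈ Finset.Ico t u, expect q H K (fun ω : Noise N R => ((newWin ω s k).card : ℝ))
    with hNF
  have h1 : ∑ r, expect q H K (fun ω => W r ω *
      (if ∀ s, t ≤ s → s ≤ t + L → 2 ≤ (acc ω s k r).card then 1 else 0)) ≤ 1 / 4 * D := by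
    refine (Finset.sum_le_sum fun r _ => hcoll r).trans (le_of_eq ?_)
    rw [← Finset.mul_sum, ← expect_sum, hD]
    simp only [hWsum]
  have hNF0 : 0 ≤ NF := Finset.sum_nonneg fun s _ =>
    expect_nonneg hq.toIsWeight fun ω => Nat.cast_nonneg _
  have h2 : ∑ r, expect q H K (fun ω => g ω * (fills ω t u k r : ℝ)) ≤ NF := by
    rw [← expect_sum, hNF, ← expect_sum]
    refine expect_mono hq.toIsWeight fun ω => ?_
    rw [← Finset.mul_sum]
    refine (mul_le_of_le_one_left (Finset.sum_nonneg fun _ _ => Nat.cast_nonneg _) (hg1 ω)).trans ?_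
    exact_mod_cast sum_fills_le ω t u k
  set c := 16 / β * (1 + 2 / (1 - β)) with hc
  have hc0 : 0 ≤ c := by positivity
  have h3 : ∑ s ∈ Finset.Icc t (t + L), ∑ r : Fin R, expect q H K (fun ω =>
      g ω * (if acc ω s k r = ∅ ∧ act ω s (k + 1) ≠ ∅ then (1 : ℝ) else 0)) ≤
      (L + 1) * (c * R * NF) := by
    have h4 : ∀ s ∈ Finset.Icc t (t + L), ∑ r : Fin R, expect q H K (fun ω =>
        g ω * (if acc ω s k r = ∅ ∧ act ω s (k + 1) ≠ ∅ then (1 : ℝ) else 0)) ≤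
        c * R * NF := by
      intro s hs
      rw [Finset.mem_Icc] at hs
      refine (Finset.sum_le_sum fun r _ => expect_free_le (H := H) (K := K) hq hβ0 hβ1 hk hs.1
        (by omega) hu hL r hg0 hg hgood).trans ?_
      rw [← Finset.mul_sum]
      exact mul_le_mul_of_nonneg_left h2 (by positivity)
    refine (Finset.sum_le_sum h4).trans (le_of_eq ?_)
    rw [Finset.sum_const, Nat.card_Icc, nsmul_eq_mul]
    congr 1
    rw [show t + L + 1 - t = L + 1 by omega]
    push_cast
    ring
  have hD0 : 0 ≤ D := expect_nonneg hq.toIsWeight fun ω => mul_nonneg (hg0 ω) (by positivity)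
  have h5 : NF ≤ R * (L + 1) * NF := by
    refine le_mul_of_one_le_left hNF0 ?_
    have : (1 : ℝ) ≤ L + 1 := by linarith [(Nat.cast_nonneg L : (0 : ℝ) ≤ L)]
    nlinarith
  have h6 : 3 / 4 * D ≤ (1 + c) * R * (L + 1) * NF := by
    have : (1 + c) * R * (L + 1) * NF = R * (L + 1) * NF + (L + 1) * (c * R * NF) := by ring
    rw [this]
    linarith
  linarith

end FillRate

/-! ### Contraction of the expected excess delay -/

section Contraction

variable {N R K : ℕ}

/-- The least possible value of `delay`. -/
def minDelay (N R K : ℕ) : ℝ := ∑ j ∈ Finset.range K, ((N - (j + 1) * R : ℕ) : ℝ)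

theorem minDelay_le_delay (ω : Noise N R) (t : ℕ) : minDelay N R K ≤ delay K ω t :=
  Finset.sum_le_sum fun j _ => by exact_mod_cast le_card_active (rows ω t) (j + 1)

theorem delay_anti (ω : Noise N R) {t u : ℕ} (h : t ≤ u) : delay K ω u ≤ delay K ω t :=
  Finset.sum_le_sum fun j _ => by exact_mod_cast Finset.card_le_card (act_anti ω (j + 1) h)

theorem delay_le (ω : Noise N R) (t : ℕ) : delay K ω t ≤ K * N := by
  refine (Finset.sum_le_card_nsmul _ _ (N : ℝ) fun j _ => ?_).trans (by simp)
  exact_mod_cast (Finset.card_le_univ _).trans (by simp)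

theorem sum_sum_range_succ (d : ℕ → ℝ) (K : ℕ) :
    ∑ j ∈ Finset.range K, ∑ k ∈ Finset.range (j + 1), d k =
      ∑ k ∈ Finset.range K, ((K - k : ℕ) : ℝ) * d k := by
  induction K with
  | zero => simp
  | succ K ih =>
    rw [Finset.sum_range_succ, ih, Finset.sum_range_succ, Finset.sum_range_succ, ← add_assoc,
      ← Finset.sum_add_distrib]
    congr 1
    · refine Finset.sum_congr rfl fun k hk => ?_
      rw [Finset.mem_range] at hk
      rw [Nat.succ_sub hk.le]
      push_cast
      ring
    · simp

theorem card_act_le_add_sum_deficit (ω : Noise N R) (t j : ℕ) :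
    (act ω t j).card ≤ N - j * R + ∑ k ∈ Finset.range j, deficit ω t k := by
  induction j with
  | zero => simpa using Finset.card_le_univ (act ω t 0)
  | succ j ih =>
    have h1 : (act ω t (j + 1)).card + (win ω t j).card = (act ω t j).card :=
      card_active_succ (rows ω t) j
    have h2 : deficit ω t j = min R (N - j * R) - (win ω t j).card := rfl
    rw [Finset.sum_range_succ, add_one_mul]
    omega

/-- A missing agent of context `k` delays that context and all later ones, hence the weight `K - k`.
-/
theorem delay_sub_le (ω : Noise N R) (t : ℕ) :
    delay K ω t - minDelay N R K ≤
      ∑ k ∈ Finset.range K, ((K - k : ℕ) : ℝ) * deficit ω t k := by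
  rw [← sum_sum_range_succ, delay, minDelay, ← Finset.sum_sub_distrib]
  refine Finset.sum_le_sum fun j _ => ?_
  rw [sub_le_iff_le_add']
  exact_mod_cast card_act_le_add_sum_deficit ω t (j + 1)

theorem sum_deficit_le (ω : Noise N R) (t k K : ℕ) :
    ∑ i ∈ Finset.Ico k K, deficit ω t i ≤ N - k * R := by
  rcases Nat.lt_or_ge K k with h | h
  · simp [Finset.Ico_eq_empty_of_le h.le]
  · have : ∑ i ∈ Finset.Ico k K, deficit ω t i + (N - K * R) ≤ N - k * R := by
      induction K, h using Nat.le_induction with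
      | base => simp
      | succ K hK ih =>
        rw [Finset.sum_Ico_succ_top hK, add_one_mul]
        have h2 : deficit ω t K = min R (N - K * R) - (win ω t K).card := rfl
        omega
    omega

/-- Let `a` and `b` be the numbers of active agents at `k` in episodes `t` and `u`. The deficits
from `k` on sum to at most `a`, so their weighted sum is at most `(K - k) * a`. The gap `a - b > a /
2` closes by at most `R` per context, so the delay has dropped by at least `(a - b) * (K - k) / 16`.
-/
theorem le_delay_sub_of_drop (ω : Noise N R) {t u k : ℕ} (htu : t ≤ u) (hk : k < K)
    (hK : (K - 1) * R < N) (hdrop : 2 * (act ω u k).card < (act ω t k).card) :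
    ∑ i ∈ Finset.Ico k K, ((K - i : ℕ) : ℝ) * deficit ω t i ≤
      32 * (delay K ω t - delay K ω u) := by
  obtain ⟨k, rfl⟩ : ∃ j, k = j + 1 := by
    rcases k with _ | k
    · simp only [act, active] at hdrop
      omega
    · exact ⟨k, rfl⟩
  set a : ℝ := ((act ω t (k + 1)).card : ℝ) with ha
  set b : ℝ := ((act ω u (k + 1)).card : ℝ) with hb
  have hab : 2 * b < a := by rw [ha, hb]; exact_mod_cast hdrop
  have hb0 : 0 ≤ b := Nat.cast_nonneg _
  have h1 : (a - b) * (K - (k + 1) : ℕ) / 16 ≤ ∑ i ∈ Finset.range (K - (k + 1)),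
      (((act ω t (k + 1 + i)).card : ℝ) - (act ω u (k + 1 + i)).card) := by
    refine le_sum_of_linear_decay (ρ := R) (by linarith) (by positivity) (fun i _ => ?_)
      (fun i _ => ?_) ?_
    · rw [sub_nonneg]
      exact_mod_cast Finset.card_le_card (act_anti ω _ htu)
    · have h2 : a ≤ (act ω t (k + 1 + i)).card + i * R := by
        rw [ha]
        exact_mod_cast card_active_le_add (rows ω t) (k + 1) i
      have h3 : ((act ω u (k + 1 + i)).card : ℝ) ≤ b := by
        rw [hb]
        exact_mod_cast Finset.card_le_card (active_anti (rows ω u) (Nat.le_add_right (k + 1) i))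
      linarith
    · rcases Nat.lt_or_ge (K - (k + 1)) 8 with h8 | h8
      · rw [Nat.div_eq_of_lt h8, Nat.cast_zero, zero_mul]
        linarith
      · have h2 : N - (k + 1) * R ≤ (act ω t (k + 1)).card := le_card_active (rows ω t) (k + 1)
        have h3 : 4 * ((K - (k + 1)) / 8 * R) ≤ (act ω t (k + 1)).card := by
          have h4 : (K - (k + 1)) / 8 * 4 + (k + 1) ≤ K - 1 := by omega
          have h5 := Nat.mul_le_mul_right R h4
          rw [add_mul, mul_right_comm] at h5
          omega
        have h4 : 4 * ((((K - (k + 1)) / 8 : ℕ) : ℝ) * R) ≤ a := by rw [ha]; exact_mod_cast h3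
        linarith
  have h2 : ∑ i ∈ Finset.range (K - (k + 1)),
      (((act ω t (k + 1 + i)).card : ℝ) - (act ω u (k + 1 + i)).card) ≤
      delay K ω t - delay K ω u := by
    rw [delay, delay, ← Finset.sum_sub_distrib]
    have h3 : ∑ i ∈ Finset.range (K - (k + 1)),
        (((act ω t (k + 1 + i)).card : ℝ) - (act ω u (k + 1 + i)).card) =
        ∑ j ∈ Finset.Ico k (K - 1),
          (((act ω t (j + 1)).card : ℝ) - (act ω u (j + 1)).card) := by
      rw [Finset.sum_Ico_eq_sum_range, show K - 1 - k = K - (k + 1) by omega]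
      refine Finset.sum_congr rfl fun i _ => ?_
      rw [show k + 1 + i = k + i + 1 by ring]
    rw [h3]
    refine Finset.sum_le_sum_of_subset_of_nonneg (fun j hj => ?_) fun j _ _ => ?_
    · rw [Finset.mem_Ico] at hj
      rw [Finset.mem_range]
      omega
    · rw [sub_nonneg]
      exact_mod_cast Finset.card_le_card (act_anti ω _ htu)
  have h3 : ∑ i ∈ Finset.Ico (k + 1) K, ((K - i : ℕ) : ℝ) * deficit ω t i ≤
      (K - (k + 1) : ℕ) * a := by
    calc _ ≤ ∑ i ∈ Finset.Ico (k + 1) K, ((K - (k + 1) : ℕ) : ℝ) * deficit ω t i := by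
          refine Finset.sum_le_sum fun i hi => mul_le_mul_of_nonneg_right ?_ (Nat.cast_nonneg _)
          rw [Finset.mem_Ico] at hi
          exact_mod_cast Nat.sub_le_sub_left hi.1 K
      _ ≤ _ := by
          rw [← Finset.mul_sum]
          refine mul_le_mul_of_nonneg_left ?_ (Nat.cast_nonneg _)
          have := (sum_deficit_le ω t (k + 1) K).trans (le_card_active (rows ω t) (k + 1))
          rw [ha]
          exact_mod_cast this
  have hm : (0 : ℝ) ≤ (K - (k + 1) : ℕ) := Nat.cast_nonneg _
  nlinarith

/-- Split at the first context whose active set more than halves: the earlier contexts are good, and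
the drop of the delay pays for all the others. -/
theorem sum_deficit_le_good_add_drop (ω : Noise N R) {t u : ℕ} (htu : t ≤ u)
    (hK : (K - 1) * R < N) :
    ∑ k ∈ Finset.range K, ((K - k : ℕ) : ℝ) * deficit ω t k ≤
      ∑ k ∈ Finset.range K, ((K - k : ℕ) : ℝ) *
        ((if (act ω t k).card ≤ 2 * (act ω u k).card then 1 else 0) * (deficit ω t k : ℝ)) +
      32 * (delay K ω t - delay K ω u) := by
  have hd : 0 ≤ delay K ω t - delay K ω u := sub_nonneg.2 (delay_anti ω htu)
  have hnn : ∀ k, 0 ≤ ((K - k : ℕ) : ℝ) *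
        ((if (act ω t k).card ≤ 2 * (act ω u k).card then 1 else 0) * (deficit ω t k : ℝ)) :=
    fun k => mul_nonneg (Nat.cast_nonneg _)
      (mul_nonneg (by split_ifs <;> norm_num) (Nat.cast_nonneg _))
  by_cases hex : ∃ k, k < K ∧ 2 * (act ω u k).card < (act ω t k).card
  · classical
    have hk := Nat.find_spec hex
    have hmin := fun i (hi : i < Nat.find hex) => Nat.find_min hex hi
    set k := Nat.find hex
    rw [← Finset.sum_range_add_sum_Ico _ hk.1.le]
    refine add_le_add ?_ (le_delay_sub_of_drop ω htu hk.1 hK hk.2)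
    rw [← Finset.sum_range_add_sum_Ico _ hk.1.le]
    refine le_add_of_le_of_nonneg (Finset.sum_le_sum fun i hi => ?_)
      (Finset.sum_nonneg fun i _ => hnn i)
    rw [Finset.mem_range] at hi
    have h1 := hmin i hi
    rw [if_pos (by by_contra hc; exact h1 ⟨hi.trans hk.1, by omega⟩), one_mul]
  · push Not at hex
    refine le_add_of_le_of_nonneg (Finset.sum_le_sum fun i hi => ?_) (by linarith)
    rw [if_pos (hex i (Finset.mem_range.1 hi)), one_mul]

variable [NeZero R] {q : Action R × Bool × Fin R → ℝ} {β : ℝ} {H : ℕ}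

/-- The weights `K - k` of the deficits match those in the gain estimate, so the new successes
telescope into the drop `D` of the delay. -/
theorem expect_excess_le (hq : IsSeed q β) (hβ0 : 0 < β) (hβ1 : β < 1) (hK : (K - 1) * R < N)
    {t u L : ℕ} (hLu : t + (2 * L + 2) ≤ u) (hu : u < H) (hL : N * β ^ L ≤ 1 / 4) :
    expect q H K (fun ω : Noise N R => delay K ω t - minDelay N R K) ≤
      64 * (1 + 16 / β * (1 + 2 / (1 - β))) * R * (L + 1) *
        (expect q H K (fun ω : Noise N R => delay K ω t - minDelay N R K) -
          expect q H K (fun ω : Noise N R => delay K ω u - minDelay N R K)) := by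
  set c := 16 / β * (1 + 2 / (1 - β)) with hc
  have hβ' : 0 < 1 - β := by linarith
  have hc0 : 0 ≤ c := by positivity
  have hR : (1 : ℝ) ≤ R := by exact_mod_cast NeZero.one_le
  have hL1 : (1 : ℝ) ≤ L + 1 := by linarith [(Nat.cast_nonneg L : (0 : ℝ) ≤ L)]
  set B := 2 * (1 + c) * R * (L + 1) with hB
  have hB2 : 2 ≤ B := by
    have h1 : (1 : ℝ) ≤ R * (L + 1) := by nlinarith
    have h2 : 1 + c ≤ (1 + c) * (R * (L + 1)) := le_mul_of_one_le_right (by linarith) h1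
    rw [hB, show 2 * (1 + c) * R * (L + 1) = 2 * ((1 + c) * (R * (L + 1))) by ring]
    linarith
  set D := expect q H K (fun ω : Noise N R => delay K ω t) -
    expect q H K (fun ω : Noise N R => delay K ω u) with hD
  have hDeq : expect q H K (fun ω : Noise N R => delay K ω t - minDelay N R K) -
      expect q H K (fun ω : Noise N R => delay K ω u - minDelay N R K) = D := by
    rw [expect_sub, expect_sub, hD]
    ring
  have hD0 : 0 ≤ D := by
    rw [hD, ← expect_sub]
    exact expect_nonneg hq.toIsWeight fun ω => sub_nonneg.2 (delay_anti ω (by omega))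
  have htel : ∑ k ∈ Finset.range K, ((K - k : ℕ) : ℝ) * ∑ s ∈ Finset.Ico t u,
      expect q H K (fun ω : Noise N R => ((newWin ω s k).card : ℝ)) ≤ 16 * D := by
    have h1 : ∀ v, t ≤ v → ∑ s ∈ Finset.Ico t v, ∑ k ∈ Finset.range K, ((K - k : ℕ) : ℝ) / 16 *
        expect q H K (fun ω : Noise N R => ((newWin ω s k).card : ℝ)) ≤
        expect q H K (fun ω : Noise N R => delay K ω t) -
          expect q H K (fun ω : Noise N R => delay K ω v) := by
      intro v hv
      induction v, hv using Nat.le_induction with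
      | base => simp
      | succ v hv ih =>
        rw [Finset.sum_Ico_succ_top hv]
        have := expect_newWin_le_delay (H := H) hq.toIsWeight hK v
        linarith
    have h2 := h1 u (by omega)
    rw [Finset.sum_comm] at h2
    have h3 : ∑ k ∈ Finset.range K, ((K - k : ℕ) : ℝ) * ∑ s ∈ Finset.Ico t u,
        expect q H K (fun ω : Noise N R => ((newWin ω s k).card : ℝ)) =
        16 * ∑ k ∈ Finset.range K, ∑ s ∈ Finset.Ico t u, ((K - k : ℕ) : ℝ) / 16 *
        expect q H K (fun ω : Noise N R => ((newWin ω s k).card : ℝ)) := by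
      rw [Finset.mul_sum]
      refine Finset.sum_congr rfl fun k _ => ?_
      rw [← Finset.mul_sum]
      ring
    rw [h3]
    linarith
  have hgood : ∑ k ∈ Finset.range K, ((K - k : ℕ) : ℝ) * expect q H K (fun ω : Noise N R =>
      (if (act ω t k).card ≤ 2 * (act ω u k).card then 1 else 0) * (deficit ω t k : ℝ)) ≤
      B * (16 * D) := by
    refine le_trans (Finset.sum_le_sum (g := fun k => ((K - k : ℕ) : ℝ) *
      (B * ∑ s ∈ Finset.Ico t u,
        expect q H K (fun ω : Noise N R => ((newWin ω s k).card : ℝ)))) fun k hk => ?_) ?_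
    · exact mul_le_mul_of_nonneg_left (expect_deficit_le hq hβ0 hβ1 (Finset.mem_range.1 hk) hLu hu
        hL) (Nat.cast_nonneg _)
    · refine le_trans (le_of_eq ?_) (mul_le_mul_of_nonneg_left htel (by linarith))
      rw [Finset.mul_sum]
      exact Finset.sum_congr rfl fun k _ => by ring
  have hpt : ∀ ω : Noise N R, delay K ω t - minDelay N R K ≤
      ∑ k ∈ Finset.range K, ((K - k : ℕ) : ℝ) *
        ((if (act ω t k).card ≤ 2 * (act ω u k).card then 1 else 0) * (deficit ω t k : ℝ)) +
      32 * (delay K ω t - delay K ω u) := fun ω =>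
    (delay_sub_le ω t).trans (sum_deficit_le_good_add_drop ω (by omega) hK)
  have hE := expect_mono (H := H) (K := K) hq.toIsWeight hpt
  rw [expect_add, expect_sum, expect_const_mul, expect_sub (F := fun ω => delay K ω t)
    (G := fun ω => delay K ω u)] at hE
  simp only [expect_const_mul] at hE
  rw [hDeq]
  -- The good contexts cost `16 * B * D` and the halving ones `32 * D`; since `2 ≤ B`, the total is
  -- at most `32 * B * D`.
  have h5 : 64 * (1 + c) * R * (L + 1) = 32 * B := by rw [hB]; ring
  rw [h5]
  nlinarith

theorem expect_excess_iterate (hq : IsSeed q β) (hβ0 : 0 < β) (hβ1 : β < 1)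
    (hK : (K - 1) * R < N) {L J T : ℕ} (hJ : J * (2 * L + 2) ≤ T) (hT : T < H)
    (hL : N * β ^ L ≤ 1 / 4) :
    expect q H K (fun ω : Noise N R => delay K ω T - minDelay N R K) ≤
      Real.exp (-(J / (64 * (1 + 16 / β * (1 + 2 / (1 - β))) * R * (L + 1)))) * (K * N) := by
  set M := 64 * (1 + 16 / β * (1 + 2 / (1 - β))) * (R : ℝ) * (L + 1) with hM
  have hβ' : 0 < 1 - β := by linarith
  have hR : (0 : ℝ) < R := by exact_mod_cast NeZero.pos R
  have hM0 : 0 < M := by positivity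
  have hnn : ∀ t, 0 ≤ expect q H K (fun ω : Noise N R => delay K ω t - minDelay N R K) :=
    fun t => expect_nonneg hq.toIsWeight fun ω => sub_nonneg.2 (minDelay_le_delay ω t)
  have hanti : ∀ t u, t ≤ u → expect q H K (fun ω : Noise N R => delay K ω u - minDelay N R K) ≤
      expect q H K (fun ω : Noise N R => delay K ω t - minDelay N R K) := fun t u h =>
    expect_mono hq.toIsWeight fun ω => sub_le_sub_right (delay_anti ω h) _
  have key : ∀ j, j * (2 * L + 2) ≤ T →
      expect q H K (fun ω : Noise N R => delay K ω (j * (2 * L + 2)) - minDelay N R K) ≤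
        Real.exp (-(j / M)) * (K * N) := by
    intro j
    induction j with
    | zero =>
      intro _
      simp only [Nat.cast_zero, zero_div, neg_zero, Real.exp_zero, one_mul, zero_mul]
      refine (expect_mono hq.toIsWeight (G := fun _ => (K : ℝ) * N) fun ω => ?_).trans
        (le_of_eq (expect_const hq.toIsWeight _))
      have h1 : 0 ≤ minDelay N R K := Finset.sum_nonneg fun _ _ => Nat.cast_nonneg _
      linarith [delay_le (K := K) ω 0]
    | succ j ih =>
      intro hj
      have hj' : j * (2 * L + 2) + (2 * L + 2) ≤ T := by linarith [add_one_mul j (2 * L + 2)]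
      have h1 := expect_excess_le (H := H) hq hβ0 hβ1 hK (t := j * (2 * L + 2))
        (u := j * (2 * L + 2) + (2 * L + 2)) le_rfl (by omega) hL
      rw [add_one_mul]
      set x := expect q H K (fun ω : Noise N R => delay K ω (j * (2 * L + 2)) - minDelay N R K)
      set y := expect q H K
        (fun ω : Noise N R => delay K ω (j * (2 * L + 2) + (2 * L + 2)) - minDelay N R K)
      have h2 : y ≤ (1 - 1 / M) * x := by
        have : x / M ≤ x - y := by rw [div_le_iff₀ hM0]; linarith
        have h3 : (1 - 1 / M) * x = x - x / M := by ring
        linarith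
      have h3 : 1 - 1 / M ≤ Real.exp (-(1 / M)) := by
        linarith [Real.add_one_le_exp (-(1 / M))]
      have hx : 0 ≤ x := hnn _
      calc y ≤ (1 - 1 / M) * x := h2
        _ ≤ Real.exp (-(1 / M)) * x := mul_le_mul_of_nonneg_right h3 hx
        _ ≤ Real.exp (-(1 / M)) * (Real.exp (-(j / M)) * (K * N)) :=
            mul_le_mul_of_nonneg_left (ih (by omega)) (Real.exp_pos _).le
        _ = _ := by
            rw [← mul_assoc, ← Real.exp_add]
            congr 2
            push_cast
            ring
  exact (hanti _ _ hJ).trans (key J hJ)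

end Contraction

/-! ### Settled strategies are equilibria and persist -/

section Absorption

variable {N R : ℕ}

/-- In every context below `K` either all resources are in use or all active agents succeed. -/
def Settled (K : ℕ) (g : ℕ → Profile N R) : Prop :=
  ∀ j < K, (∀ r, ∃ n, accessors (active g j) (g j) r = {n}) ∨
    winners (active g j) (g j) = active g j

theorem Settled.accessors_eq {K : ℕ} {g : ℕ → Profile N R} (h : Settled K g) {j : ℕ} (hj : j < K)
    {n : Fin N} (hn : n ∈ active g j) {r : Fin R} (hr : g j n = some r) :
    accessors (active g j) (g j) r = {n} := by
  have hmem : n ∈ accessors (active g j) (g j) r := mem_accessors.2 ⟨hn, hr⟩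
  rcases h j hj with h1 | h1
  · obtain ⟨m, hm⟩ := h1 r
    rw [hm, Finset.mem_singleton] at hmem
    rw [hm, hmem]
  · rw [← h1, mem_winners] at hn
    obtain ⟨_, r', hr'⟩ := hn
    have := eq_some_of_accessors_eq_singleton hr'
    rw [hr, Option.some.injEq] at this
    rw [this, hr']

theorem Settled.accessors_ne_empty {K : ℕ} {g : ℕ → Profile N R} (h : Settled K g) {j : ℕ}
    (hj : j < K) {n : Fin N} (hn : n ∈ active g j) (hr : g j n = none) (r : Fin R) :
    ∃ m, m ≠ n ∧ m ∈ accessors (active g j) (g j) r := by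
  rcases h j hj with h1 | h1
  · obtain ⟨m, hm⟩ := h1 r
    refine ⟨m, ?_, hm ▸ Finset.mem_singleton_self m⟩
    rintro rfl
    rw [eq_some_of_accessors_eq_singleton hm] at hr
    exact Option.some_ne_none _ hr
  · rw [← h1, mem_winners] at hn
    obtain ⟨_, r', hr'⟩ := hn
    rw [eq_some_of_accessors_eq_singleton hr'] at hr
    exact absurd hr (Option.some_ne_none _)

/-- The joint action of the agents in `active g j`. -/
def activePlay (g : ℕ → Profile N R) (j : ℕ) : Profile N R :=
  fun n => if n ∈ active g j then g j n else none

theorem activePlay_eq_some {g : ℕ → Profile N R} {j : ℕ} {n : Fin N} {r : Fin R} :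
    activePlay g j n = some r ↔ n ∈ accessors (active g j) (g j) r := by
  rw [mem_accessors, activePlay]
  by_cases h : n ∈ active g j <;> simp [h]

theorem payoff_le_one {ζ : ℝ} (hζ : ζ < 0) (n : Fin N) (a : Profile N R) : payoff ζ n a ≤ 1 := by
  unfold payoff
  split_ifs <;> linarith

theorem Settled.isStageEquilibrium {K : ℕ} {g : ℕ → Profile N R} (h : Settled K g) {j : ℕ}
    (hj : j < K) {ζ : ℝ} (hζ : ζ < 0) :
    IsStageEquilibrium ζ {n | n ∈ active g j} (activePlay g j) := by
  intro n hn b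
  rw [Set.mem_ofPred_eq] at hn
  rcases hrow : g j n with _ | r
  · have h0 : activePlay g j n = none := by rw [activePlay, if_pos hn, hrow]
    have h1 : payoff ζ n (activePlay g j) = 0 := by rw [payoff, if_pos h0]
    rw [h1]
    rcases b with _ | r
    · rw [payoff, if_pos (by simp)]
    · obtain ⟨m, hmn, hm⟩ := h.accessors_ne_empty hj hn hrow r
      have h2 : ¬ ∀ i, i ≠ n → Function.update (activePlay g j) n (some r) i ≠
          Function.update (activePlay g j) n (some r) n := by
        push Not
        refine ⟨m, hmn, ?_⟩
        rw [Function.update_of_ne hmn, Function.update_self, activePlay_eq_some.2 hm]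
      rw [payoff, if_neg (by simp), if_neg h2]
      exact hζ.le
  · have hacc := h.accessors_eq hj hn hrow
    have h0 : activePlay g j n = some r := by rw [activePlay, if_pos hn, hrow]
    have h1 : payoff ζ n (activePlay g j) = 1 := by
      rw [payoff, if_neg (by simp [h0]), if_pos]
      intro i hi hia
      rw [h0, activePlay_eq_some, hacc, Finset.mem_singleton] at hia
      exact hi hia
    rw [h1]
    exact payoff_le_one hζ _ _

variable {K : ℕ}

/-- The state `σ` before context `k` follows the settled rows `g`. -/
def Follows (g : ℕ → Profile N R) (k : ℕ) (σ : State N R K) : Prop :=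
  (∀ n, σ.accessed n = true ↔ n ∉ active g k) ∧
    ∀ (j : Fin K) (n : Fin N), n ∈ active g j → σ.strategy n j = g j n

theorem Follows.play_eq {g : ℕ → Profile N R} {k : Fin K} {σ : State N R K}
    (h : Follows g k σ) : σ.play k = activePlay g k := by
  funext n
  rw [State.play, activePlay]
  by_cases hn : n ∈ active g k
  · have h1 : ¬ σ.accessed n = true := fun h2 => (h.1 n).1 h2 hn
    rw [if_neg h1, if_pos hn, h.2 k n hn]
  · rw [if_pos ((h.1 n).2 hn), if_neg hn]

theorem free_iff {g : ℕ → Profile N R} {k : Fin K} {σ : State N R K}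
    (h : σ.play k = activePlay g k) (r : Fin R) :
    σ.Free k r ↔ accessors (active g k) (g k) r = ∅ := by
  rw [State.Free, Finset.eq_empty_iff_forall_notMem]
  refine forall_congr' fun n => not_congr ?_
  rw [h, activePlay_eq_some]

theorem collision_iff {g : ℕ → Profile N R} {k : Fin K} {σ : State N R K}
    (h : σ.play k = activePlay g k) (r : Fin R) :
    σ.Collision k r ↔ 2 ≤ (accessors (active g k) (g k) r).card := by
  rw [State.Collision, Nat.succ_le_iff, Finset.one_lt_card]
  simp only [h, activePlay_eq_some]
  constructor
  · rintro ⟨n, m, hnm, hn, hm⟩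
    exact ⟨n, hn, m, hm, hnm⟩
  · rintro ⟨n, hn, m, hm, hnm⟩
    exact ⟨n, m, hnm, hn, hm⟩

theorem succeeds_iff {g : ℕ → Profile N R} {k : Fin K} {σ : State N R K}
    (h : σ.play k = activePlay g k) (n : Fin N) :
    σ.Succeeds k n ↔ n ∈ winners (active g k) (g k) := by
  rw [State.Succeeds, mem_winners]
  simp only [collision_iff h, h, activePlay_eq_some]
  constructor
  · rintro ⟨r, hn, hc⟩
    refine ⟨accessors_subset hn, r, Finset.eq_singleton_iff_unique_mem.2 ⟨hn, fun m hm => ?_⟩⟩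
    by_contra hne
    exact hc (Finset.one_lt_card.2 ⟨m, hm, n, hn, hne⟩)
  · rintro ⟨_, r, hr⟩
    exact ⟨r, hr ▸ Finset.mem_singleton_self n, by rw [hr]; simp⟩

theorem nextAccessed_iff {g : ℕ → Profile N R} {k : Fin K} {σ : State N R K}
    (h : σ.play k = activePlay g k) (ha : ∀ n, σ.accessed n = true ↔ n ∉ active g k)
    (n : Fin N) :
    nextAccessed σ k n = true ↔ n ∉ active g (if k.val + 1 = K then 0 else k.val + 1) := by
  unfold nextAccessed
  by_cases hk : k.val + 1 = K
  · simp [hk, active]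
  · simp only [hk, if_false, Bool.or_eq_true, decide_eq_true_eq, ha, succeeds_iff h, active,
      Finset.mem_sdiff, not_and_or, not_not]

variable [NeZero R] {p : ℝ≥0} {hp : p ≤ 1}

theorem mem_support_independent {ι α : Type} [Fintype ι] [DecidableEq ι] [Fintype α]
    {q : ι → PMF α} {e : ι → α} (h : e ∈ (independent q).support) (i : ι) :
    e i ∈ (q i).support := by
  rw [PMF.mem_support_iff] at h ⊢
  simp only [independent, PMF.ofFintype_apply] at h
  exact Finset.prod_ne_zero_iff.1 h i (Finset.mem_univ i)

/-- An active agent with an entry is alone and tosses no coin; an active idle agent finds every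
resource in use. Inactive agents may still adopt resources, but they never play these entries, so
`Follows` leaves them unconstrained. -/
theorem Follows.step {g : ℕ → Profile N R} (hg : Settled K g) {k : Fin K} {σ τ : State N R K}
    (h : Follows g k σ) (hτ : τ ∈ (step p hp k σ).support) :
    Follows g (if k.val + 1 = K then 0 else k.val + 1) τ := by
  rw [Allocation.step, PMF.mem_support_map_iff] at hτ
  obtain ⟨e, he, rfl⟩ := hτ
  refine ⟨nextAccessed_iff h.play_eq h.1, fun j n hn => ?_⟩
  by_cases hj : j = k
  · subst hj
    simp only [Function.update_self]
    have hen := mem_support_independent he n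
    have hs := h.2 j n hn
    rw [nextEntry, hs] at hen
    rcases hrow : g j n with _ | r
    · rw [hrow] at hen
      simp only [PMF.mem_support_map_iff] at hen
      obtain ⟨r, _, hr⟩ := hen
      obtain ⟨m, _, hm⟩ := hg.accessors_ne_empty j.2 hn hrow r
      rw [if_neg] at hr
      · exact hr.symm
      · rw [free_iff h.play_eq]
        exact Finset.ne_empty_of_mem hm
    · rw [hrow] at hen
      simp only at hen
      rw [if_neg] at hen
      · simpa using hen
      · rw [collision_iff h.play_eq, hg.accessors_eq j.2 hn hrow]
        simp
  · simp only [Function.update_of_ne hj]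
    exact h.2 j n hn

variable [NeZero K]

theorem context_val (t : ℕ) : (context K t).val = t % K := by
  simp [context, Fin.ofNat]

theorem succ_mod_eq (K t : ℕ) [NeZero K] :
    (if t % K + 1 = K then 0 else t % K + 1) = (t + 1) % K := by
  have hK : 0 < K := NeZero.pos K
  rw [Nat.add_mod t 1 K]
  have hlt := Nat.mod_lt t hK
  split_ifs with h
  · rcases Nat.lt_or_ge 1 K with h1 | h1
    · rw [Nat.mod_eq_of_lt h1, h, Nat.mod_self]
    · have : K = 1 := by omega
      subst this
      simp [Nat.mod_one]
  · have h1 : 1 < K := by omega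
    rw [Nat.mod_eq_of_lt h1, Nat.mod_eq_of_lt (show t % K + 1 < K by omega)]

theorem Follows.evolve {g : ℕ → Profile N R} (hg : Settled K g) {t : ℕ} {σ : State N R K}
    (h : Follows g (t % K) σ) (s : ℕ) :
    ∀ τ ∈ (evolve p hp t σ s).support, Follows g ((t + s) % K) τ := by
  induction s with
  | zero =>
    intro τ hτ
    rw [Allocation.evolve, PMF.mem_support_pure_iff] at hτ
    rw [hτ]
    exact h
  | succ s ih =>
    intro τ hτ
    rw [Allocation.evolve, PMF.mem_support_bind_iff] at hτ
    obtain ⟨τ', h1, h2⟩ := hτ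
    have h3 := ih τ' h1
    rw [← context_val] at h3
    have h4 := h3.step hg h2
    rw [context_val, succ_mod_eq] at h4
    exact h4

theorem Follows.converged {g : ℕ → Profile N R} (hg : Settled K g) {t : ℕ} {σ : State N R K}
    (h : Follows g (t % K) σ) {ζ : ℝ} (hζ : ζ < 0) : Converged p hp ζ t σ := by
  refine ⟨fun k => activePlay g k, fun s τ hτ => ?_⟩
  have h1 := h.evolve hg s τ hτ
  rw [← context_val] at h1
  refine ⟨h1.play_eq, ?_⟩
  have h2 : {n | τ.accessed n = false} = {n | n ∈ active g (context K (t + s)).val} := by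
    ext n
    have := h1.1 n
    simp only [Set.mem_ofPred_eq, ← Bool.not_eq_true, this, not_not]
  rw [h2]
  exact hg.isStageEquilibrium (context K (t + s)).2 hζ

theorem evolve_add (t : ℕ) (σ : State N R K) (s v : ℕ) :
    evolve p hp t σ (s + v) = (evolve p hp t σ s).bind fun τ => evolve p hp (t + s) τ v := by
  induction v with
  | zero => simp [evolve]
  | succ v ih =>
    rw [← add_assoc, evolve, ih, PMF.bind_bind]
    simp only [evolve, add_assoc]

theorem Converged.evolve {ζ : ℝ} {t : ℕ} {σ : State N R K} (h : Converged p hp ζ t σ) {s : ℕ}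
    {τ : State N R K} (hτ : τ ∈ (evolve p hp t σ s).support) : Converged p hp ζ (t + s) τ := by
  obtain ⟨a, ha⟩ := h
  refine ⟨a, fun v ρ hρ => ?_⟩
  rw [add_assoc]
  refine ha (s + v) ρ ?_
  rw [evolve_add, PMF.mem_support_bind_iff]
  exact ⟨τ, hτ, hρ⟩

theorem law_add (s v : ℕ) :
    law N R K p hp (s + v) = (law N R K p hp s).bind fun τ => evolve p hp s τ v := by
  simp only [law, PMF.bind_bind]
  congr 1
  funext σ
  rw [evolve_add, zero_add]

theorem law_not_converged_anti (ζ : ℝ) (s v : ℕ) :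
    (law N R K p hp (s + v)).toOuterMeasure {σ | ¬ Converged p hp ζ (s + v) σ} ≤
      (law N R K p hp s).toOuterMeasure {σ | ¬ Converged p hp ζ s σ} := by
  rw [law_add, PMF.toOuterMeasure_bind_apply, PMF.toOuterMeasure_apply]
  refine ENNReal.tsum_le_tsum fun σ => ?_
  by_cases h : Converged p hp ζ s σ
  · have h1 : (evolve p hp s σ v).toOuterMeasure {σ | ¬ Converged p hp ζ (s + v) σ} = 0 := by
      rw [PMF.toOuterMeasure_apply_eq_zero_iff, Set.disjoint_left]
      intro τ hτ hc
      exact hc (h.evolve hτ)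
    rw [h1, mul_zero]
    exact zero_le
  · rw [Set.indicator_of_mem (show σ ∈ {σ | ¬ Converged p hp ζ s σ} from h)]
    refine mul_le_of_le_one_right zero_le ?_
    refine ((evolve p hp s σ v).toOuterMeasure.mono (Set.subset_univ _)).trans (le_of_eq ?_)
    refine (PMF.toOuterMeasure_apply _ _).trans ?_
    rw [Set.indicator_univ]
    exact PMF.tsum_coe _

end Absorption

/-! ### The learning rule as a function of independent noise -/

section Law

theorem independent_map {ι α γ : Type} [Fintype ι] [DecidableEq ι] [Fintype α] [Fintype γ]
    (q : ι → PMF α) (f : ι → α → γ) :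
    independent (fun i => (q i).map (f i)) = (independent q).map fun x i => f i (x i) := by
  classical
  ext y
  rw [PMF.map_apply, tsum_fintype]
  simp only [independent, PMF.ofFintype_apply, PMF.map_apply, tsum_fintype]
  rw [Finset.prod_univ_sum, Fintype.piFinset_univ]
  refine Finset.sum_congr rfl fun x _ => ?_
  rw [Finset.prod_ite_zero]
  simp only [Finset.mem_univ, true_implies, funext_iff]

/-- As `F` does not read the block `φ` of `ω`, that block can serve as the fresh randomness. Thus
one noise array drives all time-steps. -/
theorem independent_resample {ι κ α γ : Type} [Fintype ι] [DecidableEq ι] [Fintype κ]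
    [DecidableEq κ] [Fintype α] (s : PMF α) {φ : κ → ι} (hφ : φ.Injective)
    (F : (ι → α) → (κ → α) → γ) (hF : ∀ ω x y, F (Function.extend φ x ω) y = F ω y) :
    ((independent fun _ : ι => s).bind fun ω => (independent fun _ : κ => s).map (F ω)) =
      (independent fun _ : ι => s).map fun ω => F ω (ω ∘ φ) := by
  classical
  have hs : ∑ a, s a = 1 := by
    rw [← tsum_fintype (L := .unconditional _)]
    exact s.tsum_coe
  ext b
  rw [PMF.bind_apply, PMF.map_apply, tsum_fintype, tsum_fintype]
  simp only [independent, PMF.ofFintype_apply, PMF.map_apply, tsum_fintype]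
  have h := sum_sum_resample hφ (fun a => s a) (fun ω x => if b = F ω x then (1 : ℝ≥0∞) else 0)
  simp only [hF] at h
  have h1 : ∀ ω : ι → α, (∏ i, s (ω i)) * ∑ x : κ → α, (if b = F ω x then ∏ i, s (x i) else 0) =
      ∑ x : κ → α, (∏ i, s (ω i)) * (∏ j, s (x j)) *
        (if b = F ω x then (1 : ℝ≥0∞) else 0) := by
    intro ω
    rw [Finset.mul_sum]
    refine Finset.sum_congr rfl fun x _ => ?_
    split_ifs <;> simp
  rw [Finset.sum_congr rfl fun ω _ => h1 ω, h]
  refine Finset.sum_congr rfl fun ω _ => ?_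
  have h2 : ∑ x : κ → α, ∏ j, s (x j) = 1 := sum_prod_eq_one (fun a => s a) hs
  split_ifs with hb
  · simp only [mul_one]
    rw [← Finset.mul_sum, h2, mul_one]
  · simp

theorem independent_comp {ι κ α : Type} [Fintype ι] [DecidableEq ι] [Fintype κ]
    [DecidableEq κ] [Fintype α] (s : PMF α) {φ : κ → ι} (hφ : φ.Injective) :
    (independent fun _ : ι => s).map (fun ω => ω ∘ φ) = independent fun _ : κ => s := by
  rw [← independent_resample s hφ (fun _ x => x) (fun _ _ _ => rfl)]
  rw [show (fun x : κ → α => x) = id from rfl, PMF.map_id, PMF.bind_const]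

theorem independent_uniform {ι α : Type} [Fintype ι] [DecidableEq ι] [Fintype α] [Nonempty α] :
    (independent fun _ : ι => PMF.uniformOfFintype α) = PMF.uniformOfFintype (ι → α) := by
  ext x
  simp only [independent, PMF.ofFintype_apply, PMF.uniformOfFintype_apply, Finset.prod_const,
    Fintype.card_fun, Finset.card_univ, Nat.cast_pow, ENNReal.inv_pow]

theorem uniform_map_equiv {α γ : Type} [Fintype α] [Nonempty α] [Fintype γ] [Nonempty γ]
    (e : α ≃ γ) : (PMF.uniformOfFintype α).map e = PMF.uniformOfFintype γ := by
  classical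
  ext y
  rw [PMF.map_apply, tsum_fintype, Finset.sum_eq_single (e.symm y)]
  · simp [Fintype.card_congr e]
  · intro x _ hx
    rw [if_neg]
    rintro rfl
    simp at hx
  · simp

variable {N R K : ℕ} [NeZero R] (p : ℝ≥0) (hp : p ≤ 1)

/-- The law of an initial action, a coin and a monitored resource. -/
def seed (R : ℕ) [NeZero R] (p : ℝ≥0) (hp : p ≤ 1) : PMF (Action R × Bool × Fin R) :=
  (PMF.uniformOfFintype (Action R)).bind fun a => (coin p hp).bind fun b =>
    (PMF.uniformOfFintype (Fin R)).map fun r => (a, b, r)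

theorem seed_map_action : (seed R p hp).map (fun a => a.1) = PMF.uniformOfFintype (Action R) := by
  have h : ∀ a : Action R,
      (PMF.uniformOfFintype (Fin R)).map (fun _ => a) = PMF.pure a := fun a => PMF.map_const _ _
  simp only [seed, PMF.map_bind, PMF.map_comp, Function.comp_def, h, PMF.bind_const]
  exact PMF.bind_pure _

theorem seed_map_coin : (seed R p hp).map (fun a => a.2.1) = coin p hp := by
  have h : ∀ a : Bool,
      (PMF.uniformOfFintype (Fin R)).map (fun _ => a) = PMF.pure a := fun a => PMF.map_const _ _
  simp only [seed, PMF.map_bind, PMF.map_comp, Function.comp_def, h, PMF.bind_const]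
  exact PMF.bind_pure _

theorem seed_map_monitor : (seed R p hp).map (fun a => a.2.2) = PMF.uniformOfFintype (Fin R) := by
  simp only [seed, PMF.map_bind, PMF.map_comp, Function.comp_def, PMF.bind_const]
  exact PMF.map_id _

theorem sum_toReal_mul_ite {α γ : Type} [Fintype α] [DecidableEq γ] (s : PMF α) (f : α → γ)
    (b : γ) : ∑ a, (s a).toReal * (if f a = b then 1 else 0) = ((s.map f) b).toReal := by
  classical
  rw [PMF.map_apply, tsum_fintype, ENNReal.toReal_sum]
  · refine Finset.sum_congr rfl fun a _ => ?_
    by_cases h : f a = b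
    · simp [h]
    · simp [h, Ne.symm h]
  · intro a _
    split_ifs
    · exact s.apply_ne_top a
    · exact ENNReal.zero_ne_top

theorem isSeed_seed : IsSeed (fun a => (seed R p hp a).toReal) (1 - (p : ℝ)) where
  nonneg _ := ENNReal.toReal_nonneg
  sum_eq_one := by
    rw [← ENNReal.toReal_sum fun a _ => (seed R p hp).apply_ne_top a,
      ← tsum_fintype (L := .unconditional _), (seed R p hp).tsum_coe, ENNReal.toReal_one]
  coin := by
    rw [sum_toReal_mul_ite (seed R p hp) (fun a => a.2.1) false, seed_map_coin]
    simp only [coin, PMF.ofFintype_apply, cond_false]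
    rw [ENNReal.toReal_sub_of_le (by exact_mod_cast hp) ENNReal.one_ne_top]
    simp
  monitor r := by
    rw [sum_toReal_mul_ite (seed R p hp) (fun a => a.2.2) r, seed_map_monitor]
    simp

/-- The state before context `k` of episode `t`. -/
def stateAt (K : ℕ) (ω : Noise N R) (t k : ℕ) : State N R K where
  strategy n j := if j.val < k then rows ω (t + 1) j n else rows ω t j n
  accessed n := decide (n ∉ act ω t k)

open Classical in
/-- The new entry of agent `n` in context `k` when it draws the coin and the resource `x`. -/
def newEntry (σ : State N R K) (k : Fin K) (n : Fin N) (x : Bool × Fin R) : Action R :=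
  match σ.strategy n k with
  | some r => if σ.accessed n = false ∧ σ.Collision k r then
      (if x.1 then none else some r) else some r
  | none => if σ.Free k x.2 then some x.2 else none

/-- The new state after context `k`. -/
def newState (k : Fin K) (σ : State N R K) (x : Fin N → Bool × Fin R) : State N R K where
  strategy n := Function.update (σ.strategy n) k (newEntry σ k n (x n))
  accessed := nextAccessed σ k

theorem nextEntry_eq_map (σ : State N R K) (k : Fin K) (n : Fin N) :
    nextEntry p hp σ k n = (seed R p hp).map fun a => newEntry σ k n a.2 := by
  unfold nextEntry newEntry
  rcases σ.strategy n k with _ | r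
  · simp only
    rw [← seed_map_monitor p hp, PMF.map_comp]
    rfl
  · simp only
    split_ifs
    · rw [← seed_map_coin (R := R) p hp, PMF.map_comp]
      rfl
    · exact (PMF.map_const _ _).symm

theorem step_eq_map (σ : State N R K) (k : Fin K) :
    step p hp k σ = (independent fun _ : Fin N => seed R p hp).map fun x =>
      newState k σ fun n => (x n).2 := by
  rw [step]
  have h : nextEntry p hp σ k = fun n => (seed R p hp).map fun a => newEntry σ k n a.2 :=
    funext fun n => nextEntry_eq_map p hp σ k n
  rw [h, independent_map, PMF.map_comp]
  rfl

omit [NeZero R] in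
theorem stateAt_play (ω : Noise N R) (t : ℕ) (k : Fin K) :
    (stateAt K ω t k).play k = activePlay (rows ω t) k := by
  funext n
  by_cases h : n ∈ active (rows ω t) k <;> simp [State.play, stateAt, activePlay, h]

omit [NeZero R] in
-- Before context `k`, the entries of the earlier contexts are already those of the next episode, so
-- noise with time index `t + 1` governs the update made during episode `t`.
theorem newState_stateAt (ω : Noise N R) (t : ℕ) (k : Fin K) :
    newState k (stateAt K ω t k) (fun n => (ω (t + 1) k n).2) =
      if k.val + 1 = K then stateAt K ω (t + 1) 0 else stateAt K ω t (k.val + 1) := by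
  have hplay := stateAt_play ω t k
  have hentry : ∀ n, newEntry (stateAt K ω t k) k n (ω (t + 1) k n).2 = rows ω (t + 1) k n := by
    intro n
    have hs : (stateAt K ω t k).strategy n k = rows ω t k n := by simp [stateAt]
    rw [newEntry, rows_succ, nextRow, hs]
    rcases rows ω t k n with _ | r
    · simp only [free_iff hplay]
    · have ha : (stateAt K ω t k).accessed n = false ↔ n ∈ act ω t k := by simp [stateAt]
      simp only [collision_iff hplay, ha]
  have hacc := nextAccessed_iff hplay (fun n => by simp [stateAt])
  have hstrat : ∀ n, Function.update ((stateAt K ω t k).strategy n) k (rows ω (t + 1) k n) =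
      fun j : Fin K => if j.val < k.val + 1 then rows ω (t + 1) j n else rows ω t j n := by
    intro n
    funext j
    by_cases hj : j = k
    · subst hj
      simp
    · have hne : j.val ≠ k.val := fun h => hj (Fin.ext h)
      rw [Function.update_of_ne hj]
      simp only [stateAt]
      by_cases h1 : j.val < k.val
      · rw [if_pos h1, if_pos (by omega)]
      · rw [if_neg h1, if_neg (by omega)]
  have hnew : newState k (stateAt K ω t k) (fun n => (ω (t + 1) k n).2) =
      ⟨fun n (j : Fin K) => if j.val < k.val + 1 then rows ω (t + 1) j n else rows ω t j n,
        nextAccessed (stateAt K ω t k) k⟩ := by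
    unfold newState
    simp only [hentry, hstrat]
  rw [hnew]
  split_ifs with hk
  · refine congrArg₂ State.mk ?_ ?_
    · funext n j
      rw [if_pos (by omega), if_neg (by omega)]
    · funext n
      have := hacc n
      rw [if_pos hk] at this
      rw [Bool.eq_iff_iff, this, decide_eq_true_eq]
      simp [active]
  · refine congrArg₂ State.mk rfl ?_
    funext n
    have := hacc n
    rw [if_neg hk] at this
    rw [Bool.eq_iff_iff, this, decide_eq_true_eq]

omit [NeZero R] in
theorem stateAt_congr {ω ω' : Noise N R} {t : ℕ} {k : Fin K}
    (h : ∀ s j m, (s = t + 1 → j ≠ k.val) → j < K → ω s j m = ω' s j m) :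
    stateAt K ω t k = stateAt K ω' t k := by
  have h1 : ∀ j < K, rows ω t j = rows ω' t j := fun j hj =>
    rows_congr fun s hs i hi => funext fun m => h s i m (fun hst => by omega) (by omega)
  have h2 : ∀ j < k.val, rows ω (t + 1) j = rows ω' (t + 1) j := fun j hj =>
    rows_congr fun s hs i hi => funext fun m => h s i m (fun _ => by omega) (by omega)
  have h3 : act ω t k = act ω' t k := active_congr fun j hj => h1 j (hj.trans k.2)
  unfold stateAt
  congr 1
  · funext n j
    split_ifs with hj
    · rw [h2 j hj]
    · rw [h1 j j.2]
  · rw [h3]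

theorem initial_eq_map {H : ℕ} (hH : 0 < H) :
    initial N R K = (independent fun _ : Fin H × Fin K × Fin N => seed R p hp).map fun ω =>
      stateAt K (extendNoise H K ω) 0 0 := by
  let φ : Fin N × Fin K → Fin H × Fin K × Fin N := fun i => (⟨0, hH⟩, i.2, i.1)
  have hφ : φ.Injective := by
    rintro ⟨a, b⟩ ⟨c, d⟩ h
    simp only [φ, Prod.mk.injEq, true_and] at h
    rw [h.1, h.2]
  have h1 : (PMF.uniformOfFintype (Fin N → Fin K → Action R)) =
      (independent fun _ : Fin H × Fin K × Fin N => seed R p hp).map fun ω n k =>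
        (ω (⟨0, hH⟩, k, n)).1 := by
    rw [← uniform_map_equiv (Equiv.curry (Fin N) (Fin K) (Action R)), ← independent_uniform]
    simp only [← seed_map_action (R := R) p hp]
    rw [independent_map, ← independent_comp (seed R p hp) hφ, PMF.map_comp, PMF.map_comp]
    rfl
  rw [initial, h1, PMF.map_comp]
  congr 1
  funext ω
  simp only [Function.comp_apply, stateAt]
  congr 1
  · funext n k
    simp [rows, extendNoise, hH]
  · funext n
    simp [active]

variable [NeZero K]

/-- Each step reads one new block, that of time `T / K + 1` and context `T % K`, on which the
present state does not depend. -/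
theorem law_eq_map {H E T : ℕ} (hT : T ≤ E * K) (hE : E < H) :
    law N R K p hp T = (independent fun _ : Fin H × Fin K × Fin N => seed R p hp).map fun ω =>
      stateAt K (extendNoise H K ω) (T / K) (T % K) := by
  have hK : 0 < K := NeZero.pos K
  induction T with
  | zero =>
    have h0 : law N R K p hp 0 = initial N R K := PMF.bind_pure _
    rw [h0, initial_eq_map p hp (H := H) (by omega), Nat.zero_div, Nat.zero_mod]
  | succ T ih =>
    have hdiv : T / K + 1 < H := by
      have := (Nat.div_lt_iff_lt_mul hK).2 (show T < E * K by omega)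
      omega
    have h1 : law N R K p hp (T + 1) = (law N R K p hp T).bind (step p hp (context K T)) := by
      simp only [law, evolve, PMF.bind_bind, zero_add]
    have hctx : (context K T).val = T % K := context_val T
    let φ : Fin N → Fin H × Fin K × Fin N := fun n => (⟨T / K + 1, hdiv⟩, context K T, n)
    have hφ : φ.Injective := fun a b h => by
      simp only [φ, Prod.mk.injEq, true_and] at h
      exact h
    let F : (Fin H × Fin K × Fin N → Action R × Bool × Fin R) →
        (Fin N → Action R × Bool × Fin R) → State N R K := fun ω x =>
      newState (context K T) (stateAt K (extendNoise H K ω) (T / K) (context K T).val)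
        fun n => (x n).2
    have hF : ∀ ω x y, F (Function.extend φ x ω) y = F ω y := by
      intro ω x y
      simp only [F]
      congr 1
      refine stateAt_congr fun s j m hs hj => ?_
      unfold extendNoise
      split_ifs with h
      · refine Function.extend_apply' _ _ _ ?_
        rintro ⟨n, hn⟩
        simp only [φ, Prod.mk.injEq, Fin.ext_iff] at hn
        exact hs hn.1.symm hn.2.1.symm
      · rfl
    have h2 := independent_resample (seed R p hp) hφ F hF
    rw [h1, ih (by omega), PMF.bind_map]
    have h3 : (step p hp (context K T) ∘ fun ω => stateAt K (extendNoise H K ω) (T / K) (T % K)) =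
        fun ω => (independent fun _ : Fin N => seed R p hp).map (F ω) := by
      funext ω
      rw [Function.comp_apply, step_eq_map, ← hctx]
    rw [h3, h2]
    congr 1
    funext ω
    have h4 : F ω (ω ∘ φ) = newState (context K T)
        (stateAt K (extendNoise H K ω) (T / K) (context K T).val)
        (fun n => (extendNoise H K ω (T / K + 1) (context K T).val n).2) := by
      simp only [F]
      congr 1
      funext n
      have hlt : T / K + 1 < H ∧ (context K T).val < K := ⟨hdiv, (context K T).2⟩
      simp only [extendNoise, dif_pos hlt]
      rfl
    rw [h4, newState_stateAt, ← succ_mod_eq K T, hctx]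
    have hlt := Nat.mod_lt T hK
    have hdm := Nat.div_add_mod T K
    split_ifs with hk
    · have : (T + 1) / K = T / K + 1 := by
        rw [show T + 1 = K * (T / K + 1) by rw [mul_add]; omega, Nat.mul_div_cancel_left _ hK]
      rw [this]
    · have : (T + 1) / K = T / K := by
        refine Nat.div_eq_of_lt_le ?_ ?_
        · rw [mul_comm]
          omega
        · rw [add_mul, mul_comm]
          omega
      rw [this]

end Law

/-! ### From the excess delay to the probability of not having converged -/

section Probability

variable {N R K : ℕ}

/-- Equality of the sums forces every active set to be as small as possible. Hence each context has
`R` winners or, where the truncated difference is zero, leaves no active agent. -/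
theorem Settled.of_delay_le {ω : Noise N R} {t : ℕ} (h : delay K ω t ≤ minDelay N R K) :
    Settled K (rows ω t) := by
  have hle : ∀ j ∈ Finset.range K, ((N - (j + 1) * R : ℕ) : ℝ) ≤ (act ω t (j + 1)).card :=
    fun j _ => by exact_mod_cast le_card_active (rows ω t) (j + 1)
  have heq : ∀ j < K, (act ω t (j + 1)).card = N - (j + 1) * R := by
    have hsum : minDelay N R K = delay K ω t := (minDelay_le_delay ω t).antisymm h
    unfold minDelay delay at hsum
    intro j hj
    have := (Finset.sum_eq_sum_iff_of_le hle).1 hsum j (Finset.mem_range.2 hj)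
    exact_mod_cast this.symm
  have heq' : ∀ j ≤ K, (act ω t j).card = N - j * R := by
    intro j hj
    rcases j with _ | j
    · simp [active]
    · exact heq j hj
  intro j hj
  have h1 : (act ω t (j + 1)).card + (winners (act ω t j) (rows ω t j)).card = (act ω t j).card :=
    card_active_succ (rows ω t) j
  have h2 : (act ω t (j + 1)).card = N - (j + 1) * R := heq j hj
  have h3 : (act ω t j).card = N - j * R := heq' j hj.le
  rw [add_mul, one_mul] at h2
  rcases le_total (j * R + R) N with h4 | h4
  · left
    have h5 : (filled (act ω t j) (rows ω t j)).card = Fintype.card (Fin R) := by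
      rw [← card_winners, Fintype.card_fin]
      omega
    intro r
    have h6 : r ∈ filled (act ω t j) (rows ω t j) := by
      rw [(Finset.card_eq_iff_eq_univ _).1 h5]
      exact Finset.mem_univ r
    exact Finset.card_eq_one.1 (mem_filled.1 h6)
  · right
    refine Finset.eq_of_subset_of_card_le winners_subset ?_
    change (act ω t j).card ≤ (winners (act ω t j) (rows ω t j)).card
    omega

theorem follows_stateAt (ω : Noise N R) (t : ℕ) :
    Follows (rows ω t) 0 (stateAt K ω t 0) := by
  refine ⟨fun n => ?_, fun j n _ => ?_⟩ <;> simp [stateAt]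

theorem one_le_excess {ω : Noise N R} {t : ℕ} (h : ¬ delay K ω t ≤ minDelay N R K) :
    1 ≤ delay K ω t - minDelay N R K := by
  rw [le_sub_iff_add_le']
  unfold delay minDelay at h ⊢
  rw [not_le] at h
  norm_cast at h ⊢

variable [NeZero R] [NeZero K] (p : ℝ≥0) (hp : p ≤ 1)

/-- Markov's inequality: the excess is a nonnegative integer, so it is at least `1` unless the state
is settled. -/
theorem toReal_law_not_converged_le {ζ : ℝ} (hζ : ζ < 0) {H E : ℕ} (hE : E < H) :
    ((law N R K p hp (E * K)).toOuterMeasure {σ | ¬ Converged p hp ζ (E * K) σ}).toReal ≤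
      expect (fun a => (seed R p hp a).toReal) H K
        (fun ω : Noise N R => delay K ω E - minDelay N R K) := by
  classical
  have hK : 0 < K := NeZero.pos K
  rw [law_eq_map p hp le_rfl hE, PMF.toOuterMeasure_map_apply, PMF.toOuterMeasure_apply_fintype,
    Nat.mul_div_cancel _ hK, Nat.mul_mod_left, ENNReal.toReal_sum]
  · refine Finset.sum_le_sum fun ω _ => ?_
    have hw : 0 ≤ ∏ i, (seed R p hp (ω i)).toReal :=
      Finset.prod_nonneg fun _ _ => ENNReal.toReal_nonneg
    by_cases hc : Converged p hp ζ (E * K) (stateAt K (extendNoise H K ω) E 0)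
    · rw [Set.indicator_of_notMem (by simpa using hc), ENNReal.toReal_zero]
      exact mul_nonneg hw (sub_nonneg.2 (minDelay_le_delay _ _))
    · rw [Set.indicator_of_mem (show _ ∈ _ from hc)]
      have hval : ((independent fun _ : Fin H × Fin K × Fin N => seed R p hp) ω).toReal =
          ∏ i, (seed R p hp (ω i)).toReal := by
        simp only [independent, PMF.ofFintype_apply, ENNReal.toReal_prod]
      rw [hval]
      refine le_mul_of_one_le_right hw (one_le_excess fun h => hc ?_)
      refine Follows.converged (Settled.of_delay_le h) ?_ hζ
      rw [Nat.mul_mod_left]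
      exact follows_stateAt _ _
  · intro ω _
    exact ne_top_of_le_ne_top ((PMF.apply_ne_top _ ω)) (Set.indicator_le_self _ _ ω)

theorem toReal_law_not_converged_anti (ζ : ℝ) {s t : ℕ} (hst : s ≤ t) :
    ((law N R K p hp t).toOuterMeasure {σ | ¬ Converged p hp ζ t σ}).toReal ≤
      ((law N R K p hp s).toOuterMeasure {σ | ¬ Converged p hp ζ s σ}).toReal := by
  obtain ⟨v, rfl⟩ := Nat.exists_eq_add_of_le hst
  refine ENNReal.toReal_mono ?_ (law_not_converged_anti ζ s v)
  refine ne_top_of_le_ne_top ENNReal.one_ne_top ?_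
  refine ((law N R K p hp s).toOuterMeasure.mono (Set.subset_univ _)).trans (le_of_eq ?_)
  refine (PMF.toOuterMeasure_apply _ _).trans ?_
  rw [Set.indicator_univ]
  exact PMF.tsum_coe _

theorem one_le_numContexts (N R : ℕ) [NeZero N] [NeZero R] : 1 ≤ numContexts N R :=
  NeZero.one_le

theorem numContexts_sub_one_mul_lt (N R : ℕ) [NeZero N] [NeZero R] :
    (numContexts N R - 1) * R < N := by
  have hR : (0 : ℝ) < R := Nat.cast_pos.2 (NeZero.pos R)
  have h1 : ((numContexts N R - 1 : ℕ) : ℝ) < (N : ℝ) / R := by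
    have := Nat.ceil_lt_add_one (show (0 : ℝ) ≤ (N : ℝ) / R by positivity)
    rw [Nat.cast_sub (one_le_numContexts N R), numContexts]
    push_cast
    linarith
  rw [lt_div_iff₀ hR] at h1
  exact_mod_cast h1

theorem numContexts_le (N R : ℕ) [NeZero N] [NeZero R] : numContexts N R ≤ N := by
  refine Nat.ceil_le.2 (div_le_self (Nat.cast_nonneg N) ?_)
  exact_mod_cast NeZero.one_le

end Probability

/-! ### Elementary estimates and the choice of the waiting time -/

section Asymptotics

/-- From `log x ≤ 4 x ^ (1/4)` and `1 ≤ x ^ (1/4)`; the constant is `5 ^ 2`. -/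
theorem one_add_log_sq_le {x : ℝ} (hx : 1 ≤ x) : (1 + Real.log x) ^ 2 ≤ 25 * √x := by
  have h0 : 0 ≤ Real.log x := Real.log_nonneg hx
  have h1 : Real.log x ≤ x ^ (1 / 4 : ℝ) / (1 / 4) :=
    Real.log_le_rpow_div (by linarith) (by norm_num)
  have h2 : 1 ≤ x ^ (1 / 4 : ℝ) := Real.one_le_rpow hx (by norm_num)
  have h3 : (x ^ (1 / 4 : ℝ)) ^ 2 = √x := by
    rw [← Real.rpow_natCast, ← Real.rpow_mul (by linarith), Real.sqrt_eq_rpow]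
    norm_num
  rw [← h3]
  nlinarith

/-- The exponent is at least `(a / 25) * √x`, and the sixth-order term of the exponential series
supplies `x ^ 3`. -/
theorem cube_mul_exp_le {a x : ℝ} (ha : 0 < a) (hx : 1 ≤ x) :
    x ^ 3 * Real.exp (-(a * x / (1 + Real.log x) ^ 2)) ≤ 720 * (25 / a) ^ 6 := by
  have hx0 : 0 < x := by linarith
  have hl : 0 < (1 + Real.log x) ^ 2 := by
    have := Real.log_nonneg hx
    positivity
  have hs : 0 < √x := Real.sqrt_pos.2 hx0
  have hss : √x * √x = x := Real.mul_self_sqrt hx0.le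
  have h1 : a / 25 * √x ≤ a * x / (1 + Real.log x) ^ 2 := by
    rw [le_div_iff₀ hl]
    calc a / 25 * √x * (1 + Real.log x) ^ 2 ≤ a / 25 * √x * (25 * √x) := by
          gcongr
          exact one_add_log_sq_le hx
      _ = a * (√x * √x) := by ring
      _ = a * x := by rw [hss]
  have h2 : Real.exp (-(a * x / (1 + Real.log x) ^ 2)) ≤ Real.exp (-(a / 25 * √x)) :=
    Real.exp_le_exp.2 (neg_le_neg h1)
  have h3 := Real.pow_div_factorial_le_exp (a / 25 * √x) (by positivity) 6
  have h4 : (a / 25 * √x) ^ 6 = (a / 25) ^ 6 * x ^ 3 := by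
    rw [mul_pow, show √x ^ 6 = (√x * √x) ^ 3 by ring, hss]
  rw [h4] at h3
  have h5 : x ^ 3 ≤ 720 * (25 / a) ^ 6 * Real.exp (a / 25 * √x) := by
    have h6 : x ^ 3 = 720 * (25 / a) ^ 6 * ((a / 25) ^ 6 * x ^ 3 / (Nat.factorial 6 : ℕ)) := by
      rw [show Nat.factorial 6 = 720 from rfl]
      push_cast
      field_simp
    rw [h6]
    gcongr
  calc x ^ 3 * Real.exp (-(a * x / (1 + Real.log x) ^ 2))
      ≤ 720 * (25 / a) ^ 6 * Real.exp (a / 25 * √x) * Real.exp (-(a / 25 * √x)) := by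
        gcongr
    _ = 720 * (25 / a) ^ 6 := by rw [mul_assoc, ← Real.exp_add, add_neg_cancel, Real.exp_zero,
        mul_one]

/-- Any number above `log (4 * x) / log β⁻¹` is a suitable waiting time. -/
theorem exists_waiting_time {β : ℝ} (hβ0 : 0 < β) (hβ1 : β < 1) {x : ℝ} (hx : 1 ≤ x) :
    ∃ L : ℕ, x * β ^ L ≤ 1 / 4 ∧
      (L + 1 : ℝ) ≤ (2 / -Real.log β + 2) * (1 + Real.log x) := by
  have hb : 0 < -Real.log β := by linarith [Real.log_neg hβ0 hβ1]
  have hx0 : 0 < x := by linarith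
  have hlx := Real.log_nonneg hx
  have hl4 : Real.log (4 * x) ≤ 2 * (1 + Real.log x) := by
    rw [Real.log_mul (by norm_num) hx0.ne', show (4 : ℝ) = 2 ^ 2 by norm_num, Real.log_pow]
    have := Real.log_two_lt_d9
    push_cast
    linarith
  have hl0 : 0 ≤ Real.log (4 * x) := Real.log_nonneg (by linarith)
  refine ⟨⌈Real.log (4 * x) / -Real.log β⌉₊, ?_, ?_⟩
  · have h1 := Nat.le_ceil (Real.log (4 * x) / -Real.log β)
    rw [div_le_iff₀ hb] at h1
    set L := ⌈Real.log (4 * x) / -Real.log β⌉₊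
    have h2 : β ^ L ≤ (4 * x)⁻¹ := by
      rw [← Real.log_le_log_iff (by positivity) (by positivity), Real.log_pow, Real.log_inv]
      linarith
    calc x * β ^ L ≤ x * (4 * x)⁻¹ := by gcongr
      _ = 1 / 4 := by field_simp
  · have h1 := Nat.ceil_lt_add_one (div_nonneg hl0 hb.le)
    have h2 : Real.log (4 * x) / -Real.log β ≤ 2 / -Real.log β * (1 + Real.log x) := by
      rw [div_mul_eq_mul_div]
      gcongr
    linarith

end Asymptotics

/-- The probability of not having converged is of order `1 / N`. -/
theorem exists_probNotConverged_le (p : ℝ≥0) (hp0 : 0 < p) (hp1 : p < 1) (c : ℝ) (hc : 0 < c) :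
    ∃ C : ℝ, 0 < C ∧ ∀ (N R : ℕ) [NeZero N] [NeZero R] (ζ : ℝ) (T : ℕ), ζ < 0 →
      c * R * N * numContexts N R ≤ T → probNotConverged N R p hp1.le ζ T ≤ C / N := by
  have hβ0 : 0 < 1 - (p : ℝ) := by
    have : (p : ℝ) < 1 := by exact_mod_cast hp1
    linarith
  have hβ1 : 1 - (p : ℝ) < 1 := by
    have : (0 : ℝ) < p := by exact_mod_cast hp0
    linarith
  set β : ℝ := 1 - (p : ℝ) with hβ
  set B : ℝ := 64 * (1 + 16 / β * (1 + 2 / (1 - β))) with hB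
  have hB1 : 1 ≤ B := by
    have : 0 ≤ 16 / β * (1 + 2 / (1 - β)) :=
      mul_nonneg (div_nonneg (by norm_num) hβ0.le)
        (add_nonneg zero_le_one (div_nonneg zero_le_two (by linarith)))
    linarith
  set A : ℝ := 2 / -Real.log β + 2 with hA
  have hA0 : 0 < A := by
    have : 0 < -Real.log β := by linarith [Real.log_neg hβ0 hβ1]
    positivity
  have ha : 0 < c / (2 * B * A ^ 2) := by positivity
  refine ⟨Real.exp 2 * (720 * (25 / (c / (2 * B * A ^ 2))) ^ 6), by positivity, ?_⟩
  intro N R _ _ ζ T hζ hT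
  have hN1 : (1 : ℝ) ≤ N := by exact_mod_cast NeZero.one_le (n := N)
  have hR1 : (1 : ℝ) ≤ R := by exact_mod_cast NeZero.one_le (n := R)
  obtain ⟨L, hL, hLA⟩ := exists_waiting_time hβ0 hβ1 hN1
  set K := numContexts N R with hK
  have hK0 : 0 < K := one_le_numContexts N R
  have hK0' : (0 : ℝ) < K := Nat.cast_pos.2 hK0
  have hKN : (K : ℝ) ≤ N := by exact_mod_cast numContexts_le N R
  set E := T / K with hE
  set J := E / (2 * L + 2) with hJ
  have hEr : c * R * N ≤ E + 1 := by
    have h1 : (T : ℝ) ≤ (E + 1) * K := by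
      have := Nat.lt_div_mul_add (a := T) hK0
      have h2 : T ≤ (E + 1) * K := by rw [add_mul, one_mul]; exact this.le
      exact_mod_cast h2
    exact le_of_mul_le_mul_right (hT.trans h1) hK0'
  have hJr : (E : ℝ) ≤ (J + 1) * (2 * (L + 1)) := by
    have h2 : E ≤ (J + 1) * (2 * L + 2) := by
      have := Nat.lt_div_mul_add (a := E) (b := 2 * L + 2) (by omega)
      rw [add_mul, one_mul]
      exact this.le
    have h3 : (E : ℝ) ≤ (J + 1) * (2 * L + 2) := by exact_mod_cast h2
    linarith
  have hl0 : 0 ≤ Real.log N := Real.log_nonneg hN1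
  have hL0 : (1 : ℝ) ≤ (L : ℝ) + 1 := by linarith [Nat.cast_nonneg (α := ℝ) L]
  -- Rounding to whole episodes and to whole periods of `2 * L + 2` episodes costs at most `2` in
  -- `J`, and hence at most `2` in the exponent.
  have hexp : c / (2 * B * A ^ 2) * N / (1 + Real.log N) ^ 2 - 2 ≤ J / (B * R * (L + 1)) := by
    have h1 : c / (2 * B * A ^ 2) * N / (1 + Real.log N) ^ 2 ≤ c * N / (2 * B * (L + 1) ^ 2) := by
      have h2 : ((L : ℝ) + 1) ^ 2 ≤ A ^ 2 * (1 + Real.log N) ^ 2 := by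
        rw [← mul_pow]
        gcongr
      rw [div_mul_eq_mul_div, div_div, mul_assoc (2 * B)]
      gcongr
    refine (sub_le_sub_right h1 2).trans ?_
    have hM : 1 ≤ B * R * (L + 1) :=
      one_le_mul_of_one_le_of_one_le (one_le_mul_of_one_le_of_one_le hB1 hR1) hL0
    have h3 : c * N / (2 * B * (L + 1) ^ 2) = c * R * N / (2 * (L + 1)) / (B * R * (L + 1)) := by
      field_simp
    rw [h3, le_div_iff₀ (by linarith), sub_mul, div_mul_cancel₀ _ (by linarith)]
    have h4 : c * R * N / (2 * (L + 1)) ≤ J + 2 := by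
      rw [div_le_iff₀ (by linarith)]
      nlinarith
    linarith
  have hmain := expect_excess_iterate (N := N) (R := R) (K := K) (H := E + 1) (L := L) (J := J)
    (T := E) (isSeed_seed (R := R) p hp1.le) hβ0 hβ1 (numContexts_sub_one_mul_lt N R)
    (Nat.div_mul_le_self _ _) (Nat.lt_succ_self E) hL
  calc probNotConverged N R p hp1.le ζ T
      ≤ ((law N R K p hp1.le (E * K)).toOuterMeasure
          {σ | ¬ Converged p hp1.le ζ (E * K) σ}).toReal :=
        toReal_law_not_converged_anti p hp1.le ζ (Nat.div_mul_le_self _ _)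
    _ ≤ _ := toReal_law_not_converged_le p hp1.le hζ (Nat.lt_succ_self E)
    _ ≤ Real.exp (-(J / (B * R * (L + 1)))) * (K * N) := hmain
    _ ≤ Real.exp (2 + -(c / (2 * B * A ^ 2) * N / (1 + Real.log N) ^ 2)) * (N * N) := by
        gcongr
        linarith
    _ = Real.exp 2 *
          (N ^ 3 * Real.exp (-(c / (2 * B * A ^ 2) * N / (1 + Real.log N) ^ 2))) / N := by
        rw [Real.exp_add]
        field_simp
    _ ≤ _ := by
        have := cube_mul_exp_le ha hN1
        exact div_le_div_of_nonneg_right (mul_le_mul_of_nonneg_left this (Real.exp_pos 2).le)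
          (by linarith)

end Allocation
end

theorem mainTheorem3 (p : ℝ≥0) (hp0 : 0 < p) (hp1 : p < 1) (c : ℝ) (hc : 0 < c) :
    (∃ C : ℝ, ∀ (N R : ℕ) [NeZero N] [NeZero R] (ζ : ℝ) (δ : ℕ → ℝ) (T : ℕ),
      ζ < 0 → Allocation.IsIndifferencePeriod δ T →
      c * R * N * Allocation.numContexts N R ≤ T →
      Allocation.probNotConverged N R p hp1.le ζ T ≤
        C * ((Real.log (Allocation.numContexts N R) + 1) * (Real.log N + R) / N)) ∧
    (∀ ε : ℝ, 0 < ε → ∃ M : ℝ, ∀ (N R : ℕ) [NeZero N] [NeZero R] (ζ : ℝ) (δ : ℕ → ℝ) (T : ℕ),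
      ζ < 0 → Allocation.IsIndifferencePeriod δ T →
      c * R * N * Allocation.numContexts N R ≤ T →
      M ≤ (N : ℝ) / R →
      Allocation.probNotConverged N R p hp1.le ζ T < ε) := by
  obtain ⟨C, hC, h⟩ := Allocation.exists_probNotConverged_le p hp0 hp1 c hc
  constructor
  · refine ⟨C, fun N R _ _ ζ δ T hζ _ hT => (h N R ζ T hζ hT).trans ?_⟩
    have hN1 : (1 : ℝ) ≤ N := by exact_mod_cast NeZero.one_le (n := N)
    have hR1 : (1 : ℝ) ≤ R := by exact_mod_cast NeZero.one_le (n := R)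
    have hK1 : (1 : ℝ) ≤ Allocation.numContexts N R := by
      exact_mod_cast Allocation.one_le_numContexts N R
    -- The numerator of the claimed bound is at least `1`, so the bound `C / N` suffices.
    have h1 : 1 ≤ (Real.log (Allocation.numContexts N R) + 1) * (Real.log N + R) :=
      one_le_mul_of_one_le_of_one_le (by linarith [Real.log_nonneg hK1])
        (by linarith [Real.log_nonneg hN1])
    rw [div_eq_mul_one_div]
    gcongr
  -- Since `N / R ≤ N`, a large ratio makes `N` itself large enough for `C / N < ε`.
  · refine fun ε hε => ⟨C / ε + 1, fun N R _ _ ζ δ T hζ _ hT hM =>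
      (h N R ζ T hζ hT).trans_lt ?_⟩
    have hN1 : (1 : ℝ) ≤ N := by exact_mod_cast NeZero.one_le (n := N)
    have hR1 : (1 : ℝ) ≤ R := by exact_mod_cast NeZero.one_le (n := R)
    have h1 : C / ε < N := by linarith [div_le_self (zero_le_one.trans hN1) hR1]
    rwa [div_lt_comm₀ (by linarith) hε]
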